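/- Let $V=\mathbb{C}^N$, and for $T\in\mathrm{End}(V^{\otimes 2})$ let $T_i$ denote $T$ acting in the factors $i,i+1$ of a tensor power of $V$. Let $\{R,F\}$ be a compatible pair of strict skew invertible Yang–Baxter matrices: $R,F\in\mathrm{Aut}(V^{\otimes 2})$ satisfy the braid relation $X_1X_2X_1=X_2X_1X_2$ and the relations $R_1F_2F_1=F_2F_1R_2$, $R_2F_1F_2=F_1F_2R_1$, and for each $X\in\{R,R^{-1},F,F^{-1}\}$ there is $\Psi_X\in\mathrm{End}(V^{\otimes 2})$ with $\mathrm{Tr}_{(2)}X_1(\Psi_X)_2=\mathrm{Tr}_{(2)}(\Psi_X)_1X_2=P_{13}$, the permutation of the factors $1$ and $3$. Put $D_R=\mathrm{Tr}_{(2)}\Psi_R$ and let $\mathrm{Tr}_R$ be the trace weighted by $D_R$ in each factor. *BMW and orthogonal type.* Put $\kappa_i=\frac{(q-\sigma_i)(q^{-1}+\sigma_i)}{\mu(q-q^{-1})}$, $\eta=\frac{(q-\mu)(q^{-1}+\mu)}{\mu(q-q^{-1})}$. The matrix $R$ is of BMW type with parameters $q\in\mathbb{C}\setminus\{0,\pm1\}$,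 $\mu\in\mathbb{C}\setminus\{0,q,-q^{-1}\}$ if for all $n$ the assignment $\rho_R:\sigma_i\mapsto R_i$ ($1\le i\le n-1$) satisfies the relations of the Birman–Murakami–Wenzl algebra, i.e. the braid relations and $\sigma_i\kappa_i=\kappa_i\sigma_i=\mu\kappa_i$, $\kappa_i\sigma_{i\pm1}^{\epsilon}=\kappa_i\kappa_{i\pm1}\sigma_i^{-\epsilon}$, $\sigma_{i\pm1}^{\epsilon}\kappa_i=\sigma_i^{-\epsilon}\kappa_{i\pm1}\kappa_i$ ($\epsilon=\pm1$), $\kappa_i\kappa_{i\pm1}\kappa_i=\kappa_i$, $\kappa_i^2=\eta\kappa_i$. Put $\sigma_i^-(x)=1+\frac{x-1}{q-q^{-1}}\sigma_i+\frac{\mu(x-1)}{\mu+qx}\kappa_i$, $m_q=\frac{q^m-q^{-m}}{q-q^{-1}}$, $a^{(1)}=1$ and $a^{(i+1)}=\frac{q^i}{(i+1)_q}a^{(i)}\sigma_i^-(q^{-2i})a^{(i)}$; let $a^{(i)\uparrow1}$ be obtained from $a^{(i)}$ by $\sigma_j\mapsto\sigma_{j+1}$. For $k\ge2$, $R$ is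 of type $O(k)$ with parameter $q$ if it is skew invertible and of BMW type with $\mu=q^{1-k}$, $q^{2i}\ne1$ and $\mu\ne-q^{1-2i}$ for $1\le i\le k$, $\rho_R(a^{(i)})\ne0$ for $2\le i\le k$, $\rho_R\big(a^{(k)\uparrow1}\sigma_1^-(q^{-2k})a^{(k)\uparrow1}\big)=0$, and $\mathrm{rk}\,\rho_R(a^{(k)})=1$. *Algebras.* $\mathcal{M}(R,F)$ is the unital associative $\mathbb{C}$-algebra generated by the entries of $M=(M^a_b)_{a,b=1}^N$ with relations $R_1M_{\overline1}M_{\overline2}=M_{\overline1}M_{\overline2}R_1$, where $M_{\overline1}=M_1$ is $M$ in the first factor and $M_{\overline{i+1}}=F_iM_{\overline i}F_i^{-1}$. For $\alpha$ in the braid group $B_n$ or in its group algebra put $\mathrm{ch}(\alpha)=\mathrm{Tr}_{R\,(1,\dots,n)}\big(M_{\overline1}\cdots M_{\overline n}\,\rho_R(\alpha)\big)$. The characteristic subalgebra $\mathcal{C}(R,F)$ is the linear span of $1$ and all $\mathrm{ch}(\alpha)$, $\alpha\in B_n$, $n\ge1$. The contraction is $g=\eta^{-1}\mathrm{ch}(\kappa_1)$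 (with $\kappa_1$ on two strands), and the elementary sums are $e_0=1$, $e_i=\mathrm{ch}(a^{(i)})$. For $R$ of type $O(k)$, $O_k(R,F)$ denotes the extended algebra, i.e. $\mathcal{M}(R,F)$ with the inverse $g^{-1}$ of $g$ adjoined; its characteristic subalgebra is the subalgebra obtained from (the image of) $\mathcal{C}(R,F)$ by adjoining $g^{-1}$. If $k=2\ell$ and $g^{-\ell}e_{2\ell}$ is central in $O_{2\ell}(R,F)$, the component $O^{\pm}_{2\ell}(R,F)$ is the quotient of $O_{2\ell}(R,F)$ by the relation $g^{-\ell}e_{2\ell}=\pm1$; its characteristic subalgebra is the image of that of $O_{2\ell}(R,F)$. **Corollary.** In each of the following statements "generated" means: generated as a unital $\mathbb{C}$-algebra by the listed elements together with $g^{-1}$. 1. If $R$ is of type $O(2\ell-1)$, the characteristic subalgebra of $O_{2\ell-1}(R,F)$ is generated by $g^{1/2}:=g^{1-\ell}e_{2\ell-1}$ and $e_0,\dots,e_{\ell-1}$. 2. If $R$ is of type $O(2\ell)$ and $g^{-\ell}e_{2\ell}$ is central in $O_{2\ell}(R,F)$, the characteristic subalgebra of $O^+_{2\ell}(R,F)$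 is generated by $g$ and $e_0,\dots,e_\ell$. 3. Under the assumptions of 2, the characteristic subalgebra of $O^-_{2\ell}(R,F)$ is generated by $g$ and $e_0,\dots,e_{\ell-1}$. -/

import Mathlib

open scoped Matrix

noncomputable section

namespace OrthQM

/-! ### Operators on tensor powers

`V = ℂ^N`, and `V^{⊗ n}` has the basis `Fin n → Fin N`; operators are matrices in this basis.
Tensor factors are numbered from `0`, so the operator `T_i` (acting in the factors `i, i+1` when
one counts from `1`) is `twoSite n (i-1) T` below. -/

/-- Operators on `V^{⊗ n}` with coefficients in `A`. -/
abbrev Op (N n : ℕ) (A : Type*) : Type _ := Matrix (Fin n → Fin N) (Fin n → Fin N) A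

/-- Operators on `V ⊗ V`. -/
abbrev Op₂ (N : ℕ) : Type := Matrix (Fin N × Fin N) (Fin N × Fin N) ℂ

/-- Invertible operators on `V ⊗ V`. -/
abbrev Aut₂ (N : ℕ) : Type := (Op₂ N)ˣ

/-- A matrix acting in the first factor of `V^{⊗ n}` (used for `n ≥ 1`). -/
def oneSite {N : ℕ} {A : Type*} [Ring A] (n : ℕ) (X : Matrix (Fin N) (Fin N) A) : Op N n A :=
  fun I J =>
    if h : 0 < n then
      if ∀ m : Fin n, (m : ℕ) ≠ 0 → I m = J m then X (I ⟨0, h⟩) (J ⟨0, h⟩) else 0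
    else if I = J then 1 else 0

/-- The operator `1 ⊗ ⋯ ⊗ T ⊗ ⋯ ⊗ 1` acting as `T` in the factors `i, i+1` (numbered from `0`) of
`V^{⊗ n}`; used for `i + 1 < n`. -/
def twoSite {N : ℕ} (n i : ℕ) (T : Op₂ N) : Op N n ℂ :=
  fun I J =>
    if h : i + 1 < n then
      if ∀ m : Fin n, (m : ℕ) ≠ i → (m : ℕ) ≠ i + 1 → I m = J m then
        T (I ⟨i, by omega⟩, I ⟨i + 1, h⟩) (J ⟨i, by omega⟩, J ⟨i + 1, h⟩)
      else 0
    else if I = J then 1 else 0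

/-- A numerical operator regarded as an operator with coefficients in the `ℂ`-algebra `A`. -/
def scalarOp {N n : ℕ} (A : Type*) [Ring A] [Algebra ℂ A] (T : Op N n ℂ) : Op N n A :=
  T.map (algebraMap ℂ A)

/-! ### Yang–Baxter matrices, skew invertibility, compatible pairs -/

/-- The braid relation `R₁ R₂ R₁ = R₂ R₁ R₂` on `V^{⊗ 3}`. -/
def IsYangBaxter {N : ℕ} (R : Aut₂ N) : Prop :=
  twoSite 3 0 (R : Op₂ N) * twoSite 3 1 (R : Op₂ N) * twoSite 3 0 (R : Op₂ N) =
    twoSite 3 1 (R : Op₂ N) * twoSite 3 0 (R : Op₂ N) * twoSite 3 1 (R : Op₂ N)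

/-- `Ψ` is a skew inverse of `T`: `Tr₍₂₎ T₁ Ψ₂ = Tr₍₂₎ Ψ₁ T₂ = P`, where `P` is the permutation
of the factors `1` and `3`. -/
def IsSkewInverse {N : ℕ} (T Ψ : Op₂ N) : Prop :=
  ∀ a b c d : Fin N,
    (∑ x, ∑ y, T (a, x) (c, y) * Ψ (y, b) (x, d) = if a = d ∧ b = c then 1 else 0) ∧
    (∑ x, ∑ y, Ψ (a, x) (c, y) * T (y, b) (x, d) = if a = d ∧ b = c then 1 else 0)

/-- Skew invertibility of an operator on `V ⊗ V`. -/
def SkewInvertible {N : ℕ} (T : Op₂ N) : Prop := ∃ Ψ, IsSkewInverse T Ψ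

/-- Both `R` and `R⁻¹` are skew invertible. -/
def StrictSkewInvertible {N : ℕ} (R : Aut₂ N) : Prop :=
  SkewInvertible (R : Op₂ N) ∧ SkewInvertible ((R⁻¹ : Aut₂ N) : Op₂ N)

open Classical in
/-- The skew inverse `Ψ_T` of `T` (it is unique when it exists; `0` when it does not). -/
def skewInverse {N : ℕ} (T : Op₂ N) : Op₂ N :=
  if h : SkewInvertible T then h.choose else 0

/-- The matrix `D_R`, the trace of `Ψ_R` over the second factor. -/
def dMatrix {N : ℕ} (T : Op₂ N) : Matrix (Fin N) (Fin N) ℂ :=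
  fun a c => ∑ b, skewInverse T (a, b) (c, b)

/-- The R-trace `Tr_R (1,…,n)` over all the factors: the ordinary trace of
`D_R ⊗ ⋯ ⊗ D_R` times the argument. -/
def rTrace {N n : ℕ} {A : Type*} [Ring A] [Algebra ℂ A] (T : Op₂ N) (Y : Op N n A) : A :=
  ∑ I : Fin n → Fin N, ∑ J : Fin n → Fin N, (∏ m, dMatrix T (I m) (J m)) • Y J I

/-- A compatible pair of Yang–Baxter matrices (twist relations). -/
structure CompatiblePair {N : ℕ} (R F : Aut₂ N) : Prop where
  yangBaxter_left : IsYangBaxter R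
  yangBaxter_right : IsYangBaxter F
  twist₁ : twoSite 3 0 (R : Op₂ N) * twoSite 3 1 (F : Op₂ N) * twoSite 3 0 (F : Op₂ N) =
    twoSite 3 1 (F : Op₂ N) * twoSite 3 0 (F : Op₂ N) * twoSite 3 1 (R : Op₂ N)
  twist₂ : twoSite 3 1 (R : Op₂ N) * twoSite 3 0 (F : Op₂ N) * twoSite 3 1 (F : Op₂ N) =
    twoSite 3 0 (F : Op₂ N) * twoSite 3 1 (F : Op₂ N) * twoSite 3 0 (R : Op₂ N)

/-! ### Birman–Murakami–Wenzl relations and `q`-antisymmetrizers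

Elements of the BMW algebra are given by formulas in its generators `σ_i`; below such a formula is
evaluated at an arbitrary sequence `s` of elements of an algebra (`s i` in the role of
`σ_{i+1}`). -/

section BMW

variable {A : Type*} [Ring A] [Algebra ℂ A]

/-- `κ = (q - σ)(q⁻¹ + σ) / (μ (q - q⁻¹))`. -/
def kappa (q μ : ℂ) (σ : A) : A :=
  (μ * (q - q⁻¹))⁻¹ • ((algebraMap ℂ A q - σ) * (algebraMap ℂ A q⁻¹ + σ))

/-- `η = (q - μ)(q⁻¹ + μ) / (μ (q - q⁻¹))`. -/
def eta (q μ : ℂ) : ℂ := (q - μ) * (q⁻¹ + μ) / (μ * (q - q⁻¹))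

/-- The defining relations of the BMW algebra on `n` strands for the elements
`s 0, …, s (n-2)` in the role of `σ_1, …, σ_{n-1}`, with inverses `t 0, …, t (n-2)`. -/
structure BMWRelations (q μ : ℂ) (n : ℕ) (s t : ℕ → A) : Prop where
  mul_inv : ∀ i, i + 1 < n → s i * t i = 1
  inv_mul : ∀ i, i + 1 < n → t i * s i = 1
  braid : ∀ i, i + 2 < n → s i * s (i + 1) * s i = s (i + 1) * s i * s (i + 1)
  comm : ∀ i j, i + 1 < j → j + 1 < n → s i * s j = s j * s i
  mul_kappa : ∀ i, i + 1 < n → s i * kappa q μ (s i) = μ • kappa q μ (s i)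
  kappa_mul : ∀ i, i + 1 < n → kappa q μ (s i) * s i = μ • kappa q μ (s i)
  kappa_mul_pos : ∀ i j, i + 1 < n → j + 1 < n → (j = i + 1 ∨ i = j + 1) →
    kappa q μ (s i) * s j = kappa q μ (s i) * kappa q μ (s j) * t i
  kappa_mul_neg : ∀ i j, i + 1 < n → j + 1 < n → (j = i + 1 ∨ i = j + 1) →
    kappa q μ (s i) * t j = kappa q μ (s i) * kappa q μ (s j) * s i
  mul_kappa_pos : ∀ i j, i + 1 < n → j + 1 < n → (j = i + 1 ∨ i = j + 1) →
    s j * kappa q μ (s i) = t i * kappa q μ (s j) * kappa q μ (s i)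
  mul_kappa_neg : ∀ i j, i + 1 < n → j + 1 < n → (j = i + 1 ∨ i = j + 1) →
    t j * kappa q μ (s i) = s i * kappa q μ (s j) * kappa q μ (s i)
  kappa_mul_kappa_mul_kappa : ∀ i j, i + 1 < n → j + 1 < n → (j = i + 1 ∨ i = j + 1) →
    kappa q μ (s i) * kappa q μ (s j) * kappa q μ (s i) = kappa q μ (s i)
  kappa_sq : ∀ i, i + 1 < n → kappa q μ (s i) * kappa q μ (s i) = eta q μ • kappa q μ (s i)

/-- The baxterized element
`σ⁻(x) = 1 + (x - 1)/(q - q⁻¹) σ + μ (x - 1)/(μ + q x) κ`. -/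
def baxterMinus (q μ x : ℂ) (σ : A) : A :=
  1 + ((x - 1) / (q - q⁻¹)) • σ + (μ * (x - 1) / (μ + q * x)) • kappa q μ σ

/-- The `q`-number `i_q = (q^i - q^{-i}) / (q - q⁻¹)`. -/
def qNumber (q : ℂ) (i : ℕ) : ℂ := (q ^ i - (q⁻¹) ^ i) / (q - q⁻¹)

/-- The `q`-antisymmetrizers: `a^{(1)} = 1` and
`a^{(i+1)} = q^i / (i+1)_q · a^{(i)} σ⁻_i(q^{-2i}) a^{(i)}` (and `a^{(0)} = 1`). -/
def antisymmetrizer (q μ : ℂ) (s : ℕ → A) : ℕ → A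
  | 0 => 1
  | 1 => 1
  | i + 2 =>
    (q ^ (i + 1) / qNumber q (i + 2)) •
      (antisymmetrizer q μ s (i + 1) * baxterMinus q μ ((q⁻¹) ^ (2 * (i + 1))) (s i) *
        antisymmetrizer q μ s (i + 1))

end BMW

/-- `R` is a Yang–Baxter matrix of BMW type with parameters `q, μ`: for every `n` the assignment
`σ_i ↦ R_i` extends to a representation of the BMW algebra on `V^{⊗ n}`. -/
structure IsBMWType {N : ℕ} (R : Aut₂ N) (q μ : ℂ) : Prop where
  q_ne_zero : q ≠ 0
  q_sq_ne_one : q ^ 2 ≠ 1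
  mu_ne_zero : μ ≠ 0
  mu_ne_q : μ ≠ q
  mu_ne_neg_inv : μ ≠ -q⁻¹
  relations : ∀ n : ℕ, BMWRelations q μ n (fun i => twoSite n i (R : Op₂ N))
    (fun i => twoSite n i ((R⁻¹ : Aut₂ N) : Op₂ N))

/-- The operator `ρ_R(a^{(i)})` on `V^{⊗ i}`. -/
def antisymOp {N : ℕ} (R : Aut₂ N) (q μ : ℂ) (i : ℕ) : Op N i ℂ :=
  antisymmetrizer q μ (fun j => twoSite i j (R : Op₂ N)) i

/-- The operator `ρ_R(a^{(k)↑1} σ⁻_1(q^{-2k}) a^{(k)↑1})` on `V^{⊗ (k+1)}`. -/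
def heightOp {N : ℕ} (R : Aut₂ N) (q μ : ℂ) (k : ℕ) : Op N (k + 1) ℂ :=
  antisymmetrizer q μ (fun j => twoSite (k + 1) (j + 1) (R : Op₂ N)) k *
    baxterMinus q μ ((q⁻¹) ^ (2 * k)) (twoSite (k + 1) 0 (R : Op₂ N)) *
    antisymmetrizer q μ (fun j => twoSite (k + 1) (j + 1) (R : Op₂ N)) k

/-- `R` is a (skew invertible, BMW type) Yang–Baxter matrix of height `k ≥ 2`. -/
structure HasHeight {N : ℕ} (R : Aut₂ N) (q μ : ℂ) (k : ℕ) : Prop where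
  two_le : 2 ≤ k
  isBMWType : IsBMWType R q μ
  skewInvertible : SkewInvertible (R : Op₂ N)
  q_pow_ne_one : ∀ i : ℕ, 1 ≤ i → i ≤ k → q ^ (2 * i) ≠ 1
  mu_ne : ∀ i : ℕ, 1 ≤ i → i ≤ k → μ ≠ -q ^ (1 - 2 * (i : ℤ))
  rank_ne_zero : ∀ i : ℕ, 2 ≤ i → i ≤ k → (antisymOp R q μ i).rank ≠ 0
  heightOp_eq_zero : heightOp R q μ k = 0

/-- The value `μ = q^{1-k}` of the orthogonal series. -/
def orthMu (q : ℂ) (k : ℕ) : ℂ := q ^ (1 - (k : ℤ))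

/-- `R` is an orthogonal Yang–Baxter matrix of the type `O(k)`, with parameter `q`. -/
structure IsOrthogonalType {N : ℕ} (R : Aut₂ N) (q : ℂ) (k : ℕ) : Prop where
  hasHeight : HasHeight R q (orthMu q k) k
  rank_eq_one : (antisymOp R q (orthMu q k) k).rank = 1

/-! ### Expressions in the entries of a matrix over an algebra -/

section Words

variable {N : ℕ} {A : Type*} [Ring A] [Algebra ℂ A]

/-- The copies `X_{\bar 1} = X_1`, `X_{\overline{i+1}} = F_i X_{\bar i} F_i⁻¹` in `V^{⊗ n}`
(`copy F X n i` is `X_{\overline{i+1}}`). -/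
def copy (F : Aut₂ N) (X : Matrix (Fin N) (Fin N) A) (n : ℕ) : ℕ → Op N n A
  | 0 => oneSite n X
  | i + 1 => scalarOp A (twoSite n i (F : Op₂ N)) * copy F X n i *
      scalarOp A (twoSite n i ((F⁻¹ : Aut₂ N) : Op₂ N))

/-- The string `X_{\bar 1} X_{\bar 2} ⋯ X_{\bar n}` on `V^{⊗ n}`. -/
def matString (F : Aut₂ N) (X : Matrix (Fin N) (Fin N) A) (n : ℕ) : Op N n A :=
  ((List.range n).map (copy F X n)).prod

/-- `Tr_R (1,…,n) (X_{\bar 1} ⋯ X_{\bar n} α)` for an operator `α` on `V^{⊗ n}`. -/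
def ch (R F : Aut₂ N) (X : Matrix (Fin N) (Fin N) A) (n : ℕ) (α : Op N n ℂ) : A :=
  rTrace (R : Op₂ N) (matString F X n * scalarOp A α)

/-- The contraction `g = η⁻¹ Tr_R (1,2) (X_{\bar 1} X_{\bar 2} K_1)`. -/
def contraction (R F : Aut₂ N) (q μ : ℂ) (X : Matrix (Fin N) (Fin N) A) : A :=
  (eta q μ)⁻¹ • ch R F X 2 (kappa q μ (twoSite 2 0 (R : Op₂ N)))

/-- The elementary sums: `e_0 = 1`, `e_i = ch(a^{(i)})` for `i ≥ 1`. -/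
def elemSum (R F : Aut₂ N) (q μ : ℂ) (X : Matrix (Fin N) (Fin N) A) : ℕ → A
  | 0 => 1
  | i + 1 => ch R F X (i + 1) (antisymOp R q μ (i + 1))

end Words

/-- The image `ρ_R(B_n)` of the braid group on `n` strands in the operators on `V^{⊗ n}`: all
products of the operators `R_i` and `R_i⁻¹`. -/
def braidImage {N : ℕ} (R : Aut₂ N) (n : ℕ) : Submonoid (Op N n ℂ) :=
  Submonoid.closure
    {T | ∃ i : ℕ, i + 1 < n ∧
      (T = twoSite n i (R : Op₂ N) ∨ T = twoSite n i ((R⁻¹ : Aut₂ N) : Op₂ N))}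

/-! ### The quantum matrix algebra and its characteristic subalgebra -/

/-- The matrix of generators of the free algebra `ℂ⟨M^a_b⟩`. -/
def freeMatrix (N : ℕ) : Matrix (Fin N) (Fin N) (FreeAlgebra ℂ (Fin N × Fin N)) :=
  fun a b => FreeAlgebra.ι ℂ (a, b)

/-- The entries of `R_1 M_{\bar 1} M_{\bar 2} = M_{\bar 1} M_{\bar 2} R_1`. -/
inductive QMRel {N : ℕ} (R F : Aut₂ N) :
    FreeAlgebra ℂ (Fin N × Fin N) → FreeAlgebra ℂ (Fin N × Fin N) → Prop
  | entry (I J : Fin 2 → Fin N) :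
      QMRel R F
        ((scalarOp (FreeAlgebra ℂ (Fin N × Fin N)) (twoSite 2 0 (R : Op₂ N)) *
          matString F (freeMatrix N) 2 : Op N 2 (FreeAlgebra ℂ (Fin N × Fin N))) I J)
        ((matString F (freeMatrix N) 2 *
          scalarOp (FreeAlgebra ℂ (Fin N × Fin N)) (twoSite 2 0 (R : Op₂ N)) :
            Op N 2 (FreeAlgebra ℂ (Fin N × Fin N))) I J)

/-- The quantum matrix algebra `M(R,F)`. -/
def QMAlgebra {N : ℕ} (R F : Aut₂ N) : Type := RingQuot (QMRel R F)

instance {N : ℕ} (R F : Aut₂ N) : Ring (QMAlgebra R F) :=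
  inferInstanceAs (Ring (RingQuot (QMRel R F)))

instance {N : ℕ} (R F : Aut₂ N) : Algebra ℂ (QMAlgebra R F) :=
  inferInstanceAs (Algebra ℂ (RingQuot (QMRel R F)))

/-- The quantum matrix `M`. -/
def qMatrix {N : ℕ} (R F : Aut₂ N) : Matrix (Fin N) (Fin N) (QMAlgebra R F) :=
  fun a b => RingQuot.mkAlgHom ℂ (QMRel R F) (freeMatrix N a b)

/-- The characteristic subalgebra `C(R,F)` of `M(R,F)`, as a linear subspace: the span of the
unity and of the elements `ch(α)`, `α ∈ B_n`, `n ≥ 1`. -/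
def charSpace {N : ℕ} (R F : Aut₂ N) : Submodule ℂ (QMAlgebra R F) :=
  Submodule.span ℂ
    ({1} ∪ {x | ∃ n : ℕ, 1 ≤ n ∧ ∃ α ∈ braidImage R n, x = ch R F (qMatrix R F) n α})

/-! ### Adjoining the inverse of an element to a (noncommutative) algebra -/

section Localization

variable {A : Type} [Ring A] [Algebra ℂ A]

/-- Relations presenting `A` with a two-sided inverse of `a` adjoined: `some x` stands for the
element `x` of `A` and `none` for the inverse. -/
inductive InvRel (a : A) : FreeAlgebra ℂ (Option A) → FreeAlgebra ℂ (Option A) → Prop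
  | add (x y : A) : InvRel a (FreeAlgebra.ι ℂ (some (x + y)))
      (FreeAlgebra.ι ℂ (some x) + FreeAlgebra.ι ℂ (some y))
  | mul (x y : A) : InvRel a (FreeAlgebra.ι ℂ (some (x * y)))
      (FreeAlgebra.ι ℂ (some x) * FreeAlgebra.ι ℂ (some y))
  | scalar (c : ℂ) : InvRel a (FreeAlgebra.ι ℂ (some (algebraMap ℂ A c)))
      (algebraMap ℂ (FreeAlgebra ℂ (Option A)) c)
  | mul_inv : InvRel a (FreeAlgebra.ι ℂ (some a) * FreeAlgebra.ι ℂ none) 1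
  | inv_mul : InvRel a (FreeAlgebra.ι ℂ none * FreeAlgebra.ι ℂ (some a)) 1

/-- The algebra `A` with the inverse of `a` adjoined. -/
def AdjoinInv (a : A) : Type := RingQuot (InvRel a)

instance (a : A) : Ring (AdjoinInv a) := inferInstanceAs (Ring (RingQuot (InvRel a)))

instance (a : A) : Algebra ℂ (AdjoinInv a) := inferInstanceAs (Algebra ℂ (RingQuot (InvRel a)))

/-- The quotient map from the free algebra. -/
def AdjoinInv.mk (a : A) : FreeAlgebra ℂ (Option A) →ₐ[ℂ] AdjoinInv a :=
  RingQuot.mkAlgHom ℂ (InvRel a)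

theorem AdjoinInv.mk_eq {a : A} {x y : FreeAlgebra ℂ (Option A)} (h : InvRel a x y) :
    AdjoinInv.mk a x = AdjoinInv.mk a y :=
  RingQuot.mkAlgHom_rel ℂ h

/-- The canonical homomorphism from `A`. -/
def AdjoinInv.of (a : A) : A →ₐ[ℂ] AdjoinInv a :=
  AlgHom.ofLinearMap
    { toFun := fun x => AdjoinInv.mk a (FreeAlgebra.ι ℂ (some x))
      map_add' := fun x y => by rw [AdjoinInv.mk_eq (InvRel.add x y), map_add]
      map_smul' := fun c x => by
        rw [Algebra.smul_def, AdjoinInv.mk_eq (InvRel.mul _ _), map_mul,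
          AdjoinInv.mk_eq (InvRel.scalar c), AlgHom.commutes, RingHom.id_apply,
          Algebra.smul_def] }
    (by
      have h := AdjoinInv.mk_eq (InvRel.scalar (a := a) 1)
      simpa using h)
    (fun x y => by
      have h := AdjoinInv.mk_eq (InvRel.mul (a := a) x y)
      simpa using h)

/-- The element `a` as a unit of the algebra with its inverse adjoined. -/
def AdjoinInv.unit (a : A) : (AdjoinInv a)ˣ where
  val := AdjoinInv.of a a
  inv := AdjoinInv.mk a (FreeAlgebra.ι ℂ none)
  val_inv := by
    have h := AdjoinInv.mk_eq (InvRel.mul_inv (a := a))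
    rw [map_mul, map_one] at h
    exact h
  inv_val := by
    have h := AdjoinInv.mk_eq (InvRel.inv_mul (a := a))
    rw [map_mul, map_one] at h
    exact h

end Localization

/-! ### The extended algebra, its characteristic subalgebra, and the components -/

/-- The extended algebra `M^•(R,F)`: the algebra `M(R,F)` with the inverse `g⁻¹` of the contraction
adjoined. -/
abbrev ExtAlgebra {N : ℕ} (R F : Aut₂ N) (q μ : ℂ) : Type :=
  AdjoinInv (contraction R F q μ (qMatrix R F))

/-- The contraction `g` as a unit of the extended algebra. -/
def extG {N : ℕ} (R F : Aut₂ N) (q μ : ℂ) : (ExtAlgebra R F q μ)ˣ :=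
  AdjoinInv.unit (contraction R F q μ (qMatrix R F))

/-- The elementary sum `e_i` in the extended algebra. -/
def extE {N : ℕ} (R F : Aut₂ N) (q μ : ℂ) (i : ℕ) : ExtAlgebra R F q μ :=
  AdjoinInv.of _ (elemSum R F q μ (qMatrix R F) i)

/-- The characteristic subalgebra `C^•(R,F)` of the extended algebra: `C(R,F)` with `g⁻¹`
adjoined. -/
def extChar {N : ℕ} (R F : Aut₂ N) (q μ : ℂ) : Subalgebra ℂ (ExtAlgebra R F q μ) :=
  Algebra.adjoin ℂ
    (AdjoinInv.of (contraction R F q μ (qMatrix R F)) '' (charSpace R F : Set (QMAlgebra R F)) ∪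
      {(((extG R F q μ)⁻¹ : (ExtAlgebra R F q μ)ˣ) : ExtAlgebra R F q μ)})

/-- `g^{1/2} = g^{1-ℓ} e_{2ℓ-1}`, for the type `O(2ℓ-1)`. -/
def extGHalf {N : ℕ} (R F : Aut₂ N) (q μ : ℂ) (ℓ : ℕ) : ExtAlgebra R F q μ :=
  ((extG R F q μ ^ (1 - (ℓ : ℤ)) : (ExtAlgebra R F q μ)ˣ) : ExtAlgebra R F q μ) *
    extE R F q μ (2 * ℓ - 1)

/-- The element `g^{-ℓ} e_{2ℓ}`, for the type `O(2ℓ)`. -/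
def extSign {N : ℕ} (R F : Aut₂ N) (q μ : ℂ) (ℓ : ℕ) : ExtAlgebra R F q μ :=
  ((extG R F q μ ^ (-(ℓ : ℤ)) : (ExtAlgebra R F q μ)ˣ) : ExtAlgebra R F q μ) *
    extE R F q μ (2 * ℓ)

/-- The relation `g^{-ℓ} e_{2ℓ} = ε`. -/
inductive ComponentRel {N : ℕ} (R F : Aut₂ N) (q μ : ℂ) (ℓ : ℕ) (ε : ℂ) :
    ExtAlgebra R F q μ → ExtAlgebra R F q μ → Prop
  | sign : ComponentRel R F q μ ℓ ε (extSign R F q μ ℓ) (algebraMap ℂ (ExtAlgebra R F q μ) ε)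

/-- The component algebra: the quotient of the extended algebra by the relation
`g^{-ℓ} e_{2ℓ} = ε`. It is `O⁺_{2ℓ}(R,F)` for `ε = 1` and `O⁻_{2ℓ}(R,F)` for `ε = -1`. -/
abbrev Component {N : ℕ} (R F : Aut₂ N) (q μ : ℂ) (ℓ : ℕ) (ε : ℂ) : Type :=
  RingQuot (ComponentRel R F q μ ℓ ε)

/-- The quotient map from the extended algebra to a component. -/
def toComponent {N : ℕ} (R F : Aut₂ N) (q μ : ℂ) (ℓ : ℕ) (ε : ℂ) :
    ExtAlgebra R F q μ →ₐ[ℂ] Component R F q μ ℓ ε :=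
  RingQuot.mkAlgHom ℂ (ComponentRel R F q μ ℓ ε)

/-- The characteristic subalgebra of a component: the image of that of the extended algebra. -/
def compChar {N : ℕ} (R F : Aut₂ N) (q μ : ℂ) (ℓ : ℕ) (ε : ℂ) :
    Subalgebra ℂ (Component R F q μ ℓ ε) :=
  (extChar R F q μ).map (toComponent R F q μ ℓ ε)

/-- The contraction `g` as a unit of a component. -/
def compG {N : ℕ} (R F : Aut₂ N) (q μ : ℂ) (ℓ : ℕ) (ε : ℂ) : (Component R F q μ ℓ ε)ˣ :=
  Units.map (toComponent R F q μ ℓ ε : ExtAlgebra R F q μ →* Component R F q μ ℓ ε)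
    (extG R F q μ)

/-- The elementary sum `e_i` in a component. -/
def compE {N : ℕ} (R F : Aut₂ N) (q μ : ℂ) (ℓ : ℕ) (ε : ℂ) (i : ℕ) : Component R F q μ ℓ ε :=
  toComponent R F q μ ℓ ε (extE R F q μ i)

/-- The subalgebra generated by a set `S` and the inverse of a unit `u`, that is, the smallest
subalgebra containing `S` and `u⁻¹`. -/
def generatedWithInv {A : Type*} [Ring A] [Algebra ℂ A] (u : Aˣ) (S : Set A) : Subalgebra ℂ A :=
  Algebra.adjoin ℂ (S ∪ {((u⁻¹ : Aˣ) : A)})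

end OrthQM

end

/-! Write `χ` for `ch` of the quantum matrix, applied to elements of the image of the BMW algebra in
the operators on the tensor powers. Everything rests on two properties. First, `χ` is a trace
(`ch_mul_comm`), because every `R_i` commutes with the string of copies of `M` and with `D ⊗ ⋯ ⊗ D`.
Second, `χ` is multiplicative under juxtaposition of strands (`ch_mul`), because the conjugation by
the `F_i` that shifts a block of copies by one factor is invisible to the weighted partial trace
(`ptrs_conjChain`).

Generation by `g` and `e_0, …, e_k` (`ch_mem`): if `W` is the BMW algebra on all strands but the
last, adding that strand gives `W + WσW + WκW`. A word containing a `κ` can be conjugated until the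
`κ` sits on the last two strands; there it compresses the rest of the word to two strands fewer and
splits off a factor `g`. The remaining words reduce, by cyclicity and multiplicativity, to the
Coxeter elements `σ_1 ⋯ σ_{n-1}`. These are treated through the hooks `σ_1 ⋯ σ_d a^{(m)}`: expanding
the recursion for the antisymmetrizer trades a longer Coxeter part for a larger antisymmetrizer, and
the height condition stops this at `m = k`.

Reciprocity `e_k e_i = e_{k-i} g^i` (`elemSum_mul_elemSum`): put `b = k - i` and let `P` be
`a^{(k)}` on the first `k` strands times `a^{(i)}` on the last `i` of `b + 2i` strands. Joining the
last `i` strands of `a^{(k)}` to the `i` remaining ones by nested cups and caps gives, after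
normalization, an idempotent `Q` with `PQ = QP = Q`. For the ordinary matrix trace, the trace of an
idempotent is its rank, and since `a^{(k)}` has rank one, `tr (P - Q) = rk a^{(i)} - rk a^{(b)} ρ^i`
with `ρ = rk κ`. This is nonnegative, and so is the same expression with `b` and `i` exchanged. As
`ρ ≥ 1` when `κ ≠ 0`, both vanish, so `P = Q` (`nestedSandwich_eq`); applying `χ` gives the
relation. If `κ = 0` then `g = 0`, and inverting it makes the algebra trivial.

Conclusion: with `g` invertible, reciprocity expresses the upper half of the `e_i` through `e_k` and
the lower half. For odd `k` the case `i = k` reads `e_k² = g^k`, so `g^{1/2}` squares to `g` and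
recovers `e_k`. On the components `e_{2ℓ} = ±g^ℓ`; for the minus sign the case `i = ℓ` reads `-g^ℓ
e_ℓ = e_ℓ g^ℓ`, and since `g` commutes with the `e_i` this forces `e_ℓ = 0`. -/

open scoped Matrix

noncomputable section

namespace OrthQM

/-! ### Elementary identities for `κ` and the baxterized elements. -/

section Algebra

variable {A : Type*} [Ring A] [Algebra ℂ A]

/-- Admissible parameters of the BMW algebra. -/
structure Admissible (q μ : ℂ) : Prop where
  q_ne_zero : q ≠ 0
  q_sq_ne_one : q ^ 2 ≠ 1
  mu_ne_zero : μ ≠ 0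
  mu_ne_q : μ ≠ q
  mu_ne_neg_inv : μ ≠ -q⁻¹

namespace Admissible

variable {q μ : ℂ} (hp : Admissible q μ)
include hp

theorem sub_inv_ne_zero : q - q⁻¹ ≠ 0 := by
  intro h
  apply hp.q_sq_ne_one
  have := hp.q_ne_zero
  field_simp at h
  linear_combination h

theorem eta_ne_zero : eta q μ ≠ 0 := by
  refine div_ne_zero (mul_ne_zero ?_ ?_) (mul_ne_zero hp.mu_ne_zero hp.sub_inv_ne_zero)
  · exact fun h => hp.mu_ne_q (by linear_combination -h)
  · exact fun h => hp.mu_ne_neg_inv (by linear_combination h)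

end Admissible

variable {q μ : ℂ} {n : ℕ} {s t : ℕ → A}

theorem kappa_eq (hp : Admissible q μ) (x : A) :
    kappa q μ x = (μ * (q - q⁻¹))⁻¹ • (1 + (q - q⁻¹) • x - x * x) := by
  unfold kappa
  have h := mul_inv_cancel₀ hp.q_ne_zero
  simp only [Algebra.algebraMap_eq_smul_one, sub_mul, mul_add, smul_mul_assoc, mul_smul_comm,
    one_mul, mul_one]
  congr 1
  linear_combination (norm := module) h • (1 : A)

/-- The definition of `κ` solved for the square: words in a single generator reduce to the span of
`1`, `σ`, `κ`. -/
theorem mul_self_eq (hp : Admissible q μ) (x : A) :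
    x * x = 1 + (q - q⁻¹) • x - ((q - q⁻¹) * μ) • kappa q μ x := by
  rw [kappa_eq hp, smul_smul, mul_comm (q - q⁻¹) μ,
    mul_inv_cancel₀ (mul_ne_zero hp.mu_ne_zero hp.sub_inv_ne_zero), one_smul]
  abel

theorem kappa_mem {B : Subalgebra ℂ A} {x : A} (hx : x ∈ B) : kappa q μ x ∈ B :=
  B.smul_mem (B.mul_mem (B.sub_mem (B.algebraMap_mem _) hx) (B.add_mem (B.algebraMap_mem _) hx)) _

theorem baxterMinus_mem {B : Subalgebra ℂ A} {x : A} (hx : x ∈ B) (y : ℂ) :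
    baxterMinus q μ y x ∈ B :=
  B.add_mem (B.add_mem B.one_mem (B.smul_mem hx _)) (B.smul_mem (kappa_mem hx) _)

theorem map_kappa {B : Type*} [Ring B] [Algebra ℂ B] (f : A →ₐ[ℂ] B) (x : A) :
    f (kappa q μ x) = kappa q μ (f x) := by
  simp [kappa]

theorem map_baxterMinus {B : Type*} [Ring B] [Algebra ℂ B] (f : A →ₐ[ℂ] B) (x : A) (y : ℂ) :
    f (baxterMinus q μ y x) = baxterMinus q μ y (f x) := by
  simp [baxterMinus, map_kappa]

theorem map_antisymmetrizer {B : Type*} [Ring B] [Algebra ℂ B] (f : A →ₐ[ℂ] B) (s : ℕ → A) :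
    ∀ i, f (antisymmetrizer q μ s i) = antisymmetrizer q μ (fun j => f (s j)) i
  | 0 => map_one f
  | 1 => map_one f
  | i + 2 => by
    simp only [antisymmetrizer, map_smul, map_mul, map_baxterMinus, map_antisymmetrizer f s (i + 1)]

theorem antisymmetrizer_congr {s s' : ℕ → A} :
    ∀ {i : ℕ}, (∀ j, j + 1 < i → s j = s' j) → antisymmetrizer q μ s i = antisymmetrizer q μ s' i
  | 0, _ => rfl
  | 1, _ => rfl
  | i + 2, h => by
    have h1 := antisymmetrizer_congr (i := i + 1) fun j hj => h j (by omega)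
    simp only [antisymmetrizer, h1, h i (by omega)]

theorem antisymmetrizer_mem {B : Subalgebra ℂ A} {s : ℕ → A} :
    ∀ {i : ℕ}, (∀ j, j + 1 < i → s j ∈ B) → antisymmetrizer q μ s i ∈ B
  | 0, _ => B.one_mem
  | 1, _ => B.one_mem
  | i + 2, h => by
    have h1 := antisymmetrizer_mem (i := i + 1) fun j hj => h j (by omega)
    exact B.smul_mem (B.mul_mem (B.mul_mem h1 (baxterMinus_mem (h i (by omega)) _)) h1) _

/-- Commutation is membership in a centralizer, which is a subalgebra; the closure lemmas for
subalgebras then apply. The same device is used throughout for antisymmetrizers and diagrams. -/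
theorem commute_kappa_right {x y : A} (h : Commute x y) : Commute x (kappa q μ y) := by
  have : kappa q μ y ∈ Subalgebra.centralizer ℂ {x} :=
    kappa_mem (by simpa [Subalgebra.mem_centralizer_iff] using h.eq)
  simpa [Subalgebra.mem_centralizer_iff, commute_iff_eq] using this

theorem commute_kappa_left {x y : A} (h : Commute x y) : Commute (kappa q μ x) y :=
  (commute_kappa_right h.symm).symm

/-- An element fixed up to `-q⁻¹` by `σ` is annihilated by `κ`. -/
theorem mul_kappa_eq_zero (hp : Admissible q μ) {p x : A} (h : p * x = (-q⁻¹) • p) :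
    p * kappa q μ x = 0 := by
  have h2 : p * (x * x) = (q⁻¹ * q⁻¹) • p := by
    rw [← mul_assoc, h, smul_mul_assoc, h, smul_smul, neg_mul_neg]
  have e : (1 : ℂ) + (q - q⁻¹) * (-q⁻¹) - q⁻¹ * q⁻¹ = 0 := by
    have := mul_inv_cancel₀ hp.q_ne_zero
    linear_combination -this
  have e' : p * (1 + (q - q⁻¹) • x - x * x) = 0 := by
    rw [mul_sub, mul_add, mul_smul_comm, h, h2, mul_one]
    linear_combination (norm := module) e • p
  rw [kappa_eq hp, mul_smul_comm, e', smul_zero]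

theorem kappa_mul_eq_zero (hp : Admissible q μ) {p x : A} (h : x * p = (-q⁻¹) • p) :
    kappa q μ x * p = 0 := by
  have h2 : x * x * p = (q⁻¹ * q⁻¹) • p := by
    rw [mul_assoc, h, mul_smul_comm, h, smul_smul, neg_mul_neg]
  have e : (1 : ℂ) + (q - q⁻¹) * (-q⁻¹) - q⁻¹ * q⁻¹ = 0 := by
    have := mul_inv_cancel₀ hp.q_ne_zero
    linear_combination -this
  have e' : (1 + (q - q⁻¹) • x - x * x) * p = 0 := by
    rw [sub_mul, add_mul, smul_mul_assoc, h, h2, one_mul]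
    linear_combination (norm := module) e • p
  rw [kappa_eq hp, smul_mul_assoc, e', smul_zero]

theorem mul_baxterMinus (hp : Admissible q μ) {p x : A} (h : p * x = (-q⁻¹) • p) (y : ℂ) :
    p * baxterMinus q μ y x = (1 - q⁻¹ * ((y - 1) / (q - q⁻¹))) • p := by
  simp only [baxterMinus, mul_add, mul_smul_comm, mul_kappa_eq_zero hp h, h, mul_one]
  module

theorem baxterMinus_mul (hp : Admissible q μ) {p x : A} (h : x * p = (-q⁻¹) • p) (y : ℂ) :
    baxterMinus q μ y x * p = (1 - q⁻¹ * ((y - 1) / (q - q⁻¹))) • p := by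
  simp only [baxterMinus, add_mul, smul_mul_assoc, kappa_mul_eq_zero hp h, h, one_mul]
  module

theorem qNumber_ne_zero (hp : Admissible q μ) {i : ℕ} (h : q ^ (2 * i) ≠ 1) : qNumber q i ≠ 0 := by
  refine div_ne_zero (fun e => h ?_) hp.sub_inv_ne_zero
  have := pow_ne_zero i hp.q_ne_zero
  rw [inv_pow] at e
  field_simp at e
  rw [mul_comm, pow_mul]
  linear_combination e

/-- The value of `σ⁻(q^{-2i})` on an eigenvector of `σ` with eigenvalue `-q⁻¹`. -/
theorem baxterMinus_eigenvalue (hp : Admissible q μ) (i : ℕ) :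
    1 - q⁻¹ * (((q⁻¹) ^ (2 * i) - 1) / (q - q⁻¹)) = (q⁻¹) ^ i * qNumber q (i + 1) := by
  have h := hp.sub_inv_ne_zero
  have h0 := hp.q_ne_zero
  have hi : (q⁻¹) ^ i * q ^ i = 1 := by rw [← mul_pow, inv_mul_cancel₀ h0, one_pow]
  have h1 : q⁻¹ * q = 1 := inv_mul_cancel₀ h0
  rw [qNumber, eq_comm, ← mul_div_assoc, div_eq_iff h, sub_mul, mul_assoc, div_mul_cancel₀ _ h]
  rw [pow_succ, pow_succ, two_mul, pow_add]
  linear_combination (q) * hi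

end Algebra

/-! ### Consequences of the BMW relations and fusion of baxterized elements. -/

section Relations

variable {A : Type*} [Ring A] [Algebra ℂ A] {q μ : ℂ} {n : ℕ} {s t : ℕ → A}

local notation "κ" => kappa q μ

/-- The scalar content of `mul_fusion`: the first two expressions are coefficients of words there,
and the third enters the coefficient of `p κ_j`. The variable `r` stands for `q⁻¹`, so that the
identities become polynomial ones modulo `q r = 1`. -/
theorem fusion_coeff {q r μ x : ℂ} (hr : q * r = 1) (hl : q - r ≠ 0) (hx : μ + q * x ≠ 0)
    (hx' : μ + q * (q ^ 2 * x) ≠ 0) :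
    ((x - 1) / (q - r) + r * (1 - r * ((q ^ 2 * x - 1) / (q - r))) = 0) ∧
    ((μ * (x - 1) / (μ + q * x)) * (μ * (q ^ 2 * x - 1) / (μ + q * (q ^ 2 * x))) -
      q * ((x - 1) / (q - r)) * (μ * (q ^ 2 * x - 1) / (μ + q * (q ^ 2 * x))) +
      r * (μ * (x - 1) / (μ + q * x)) * ((q ^ 2 * x - 1) / (q - r)) = 0) ∧
    (-((q - r) * μ * ((x - 1) / (q - r))) + μ * (μ * (x - 1) / (μ + q * x)) +
      (q - r) * r * (μ * (x - 1) / (μ + q * x)) * ((q ^ 2 * x - 1) / (q - r)) +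
      r * (μ * (x - 1) / (μ + q * x)) = 0) := by
  have hx'' : μ + q ^ 3 * x ≠ 0 := by convert hx' using 2; ring
  rw [show q * (q ^ 2 * x) = q ^ 3 * x by ring]
  refine ⟨?_, ?_, ?_⟩
  · field_simp
    linear_combination (1 - x * (q * r + 1)) * hr
  -- The inverses of the three denominators are made independent variables, constrained only by
  -- `hl'`, `hu'`, `hv'`.
  · have hl' := mul_inv_cancel₀ hl
    have hu' := mul_inv_cancel₀ hx
    have hv' := mul_inv_cancel₀ hx''
    simp only [div_eq_mul_inv]
    generalize (q - r)⁻¹ = l' at *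
    generalize (μ + q * x)⁻¹ = u' at *
    generalize (μ + q ^ 3 * x)⁻¹ = v' at *
    linear_combination μ * (x - 1) * (q ^ 2 * x - 1) * (u' * v' * l' * (q ^ 2 * x) * hr -
      μ * u' * v' * hl' + q * l' * v' * hu' - r * l' * u' * hv')
  · field_simp
    linear_combination (x - 1) * q * x * μ * hr

namespace BMWRelations

/-- The BMW relations are inherited by a window of strands. -/
theorem shift (h : BMWRelations q μ n s t) {m c : ℕ} (hm : c + m ≤ n) :
    BMWRelations q μ m (fun j => s (c + j)) (fun j => t (c + j)) where
  mul_inv i hi := h.mul_inv _ (by omega)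
  inv_mul i hi := h.inv_mul _ (by omega)
  braid i hi := h.braid _ (by omega)
  comm i j hij hj := h.comm _ _ (by omega) (by omega)
  mul_kappa i hi := h.mul_kappa _ (by omega)
  kappa_mul i hi := h.kappa_mul _ (by omega)
  kappa_mul_pos i j hi hj e := h.kappa_mul_pos _ _ (by omega) (by omega) (by omega)
  kappa_mul_neg i j hi hj e := h.kappa_mul_neg _ _ (by omega) (by omega) (by omega)
  mul_kappa_pos i j hi hj e := h.mul_kappa_pos _ _ (by omega) (by omega) (by omega)
  mul_kappa_neg i j hi hj e := h.mul_kappa_neg _ _ (by omega) (by omega) (by omega)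
  kappa_mul_kappa_mul_kappa i j hi hj e :=
    h.kappa_mul_kappa_mul_kappa _ _ (by omega) (by omega) (by omega)
  kappa_sq i hi := h.kappa_sq _ (by omega)

/-- The BMW relations are invariant under the reflection `σ_i ↦ σ_{n-i}`. -/
theorem reverse (h : BMWRelations q μ n s t) :
    BMWRelations q μ n (fun j => s (n - 2 - j)) (fun j => t (n - 2 - j)) where
  mul_inv i hi := h.mul_inv _ (by omega)
  inv_mul i hi := h.inv_mul _ (by omega)
  braid i hi := by
    have e : n - 2 - i = n - 2 - (i + 1) + 1 := by omega
    have := h.braid (n - 2 - (i + 1)) (by omega)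
    simp only [e]
    exact this.symm
  comm i j hij hj := (h.comm _ _ (by omega) (by omega)).symm
  mul_kappa i hi := h.mul_kappa _ (by omega)
  kappa_mul i hi := h.kappa_mul _ (by omega)
  kappa_mul_pos i j hi hj e := h.kappa_mul_pos _ _ (by omega) (by omega) (by omega)
  kappa_mul_neg i j hi hj e := h.kappa_mul_neg _ _ (by omega) (by omega) (by omega)
  mul_kappa_pos i j hi hj e := h.mul_kappa_pos _ _ (by omega) (by omega) (by omega)
  mul_kappa_neg i j hi hj e := h.mul_kappa_neg _ _ (by omega) (by omega) (by omega)
  kappa_mul_kappa_mul_kappa i j hi hj e :=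
    h.kappa_mul_kappa_mul_kappa _ _ (by omega) (by omega) (by omega)
  kappa_sq i hi := h.kappa_sq _ (by omega)

section

variable (h : BMWRelations q μ n s t)
include h

theorem commute {i j : ℕ} (hi : i + 1 < n) (hj : j + 1 < n) (hij : i + 1 < j ∨ j + 1 < i) :
    Commute (s i) (s j) := by
  rcases hij with hij | hij
  · exact h.comm i j hij hj
  · exact (h.comm j i hij hi).symm

theorem inv_mul_kappa (hp : Admissible q μ) {i : ℕ} (hi : i + 1 < n) :
    t i * κ (s i) = μ⁻¹ • κ (s i) := by
  have e : t i * (s i * κ (s i)) = κ (s i) := by rw [← mul_assoc, h.inv_mul i hi, one_mul]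
  rw [h.mul_kappa i hi, mul_smul_comm] at e
  rw [← e, smul_smul, inv_mul_cancel₀ hp.mu_ne_zero, one_smul, e]

/-- The skein relation. -/
theorem inv_eq (hp : Admissible q μ) {i : ℕ} (hi : i + 1 < n) :
    t i = s i - (q - q⁻¹) • (1 : A) + (q - q⁻¹) • κ (s i) := by
  have e := congrArg (t i * ·) (mul_self_eq hp (s i))
  simp only [mul_sub, mul_add, mul_smul_comm, ← mul_assoc, h.inv_mul i hi, one_mul, mul_one,
    h.inv_mul_kappa hp hi, smul_smul] at e
  rw [mul_assoc, mul_inv_cancel₀ hp.mu_ne_zero, mul_one] at e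
  linear_combination (norm := module) -e

theorem inv_mem (hp : Admissible q μ) {B : Subalgebra ℂ A} {i : ℕ} (hi : i + 1 < n)
    (hs : s i ∈ B) : t i ∈ B := by
  rw [h.inv_eq hp hi]
  exact B.add_mem (B.sub_mem hs (B.smul_mem B.one_mem _)) (B.smul_mem (kappa_mem hs) _)

/-- `κ_i κ_j = κ_i σ_j σ_i` for neighbours. -/
theorem kappa_mul_kappa {i j : ℕ} (hi : i + 1 < n) (hj : j + 1 < n) (e : j = i + 1 ∨ i = j + 1) :
    κ (s i) * κ (s j) = κ (s i) * s j * s i := by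
  rw [h.kappa_mul_pos i j hi hj e, mul_assoc, h.inv_mul i hi, mul_one]

theorem kappa_mul_kappa' {i j : ℕ} (hi : i + 1 < n) (hj : j + 1 < n)
    (e : j = i + 1 ∨ i = j + 1) :
    κ (s j) * κ (s i) = s i * s j * κ (s i) := by
  rw [mul_assoc, h.mul_kappa_pos i j hi hj e, mul_assoc, ← mul_assoc, h.mul_inv i hi, one_mul]

/-- `κ_i σ_j κ_i = μ⁻¹ κ_i` for neighbours. -/
theorem kappa_mul_mul_kappa (hp : Admissible q μ) {i j : ℕ} (hi : i + 1 < n) (hj : j + 1 < n)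
    (e : j = i + 1 ∨ i = j + 1) : κ (s i) * s j * κ (s i) = μ⁻¹ • κ (s i) := by
  rw [h.kappa_mul_pos i j hi hj e, mul_assoc, h.inv_mul_kappa hp hi, mul_smul_comm,
    h.kappa_mul_kappa_mul_kappa i j hi hj e]

end

/-- Fusion of two baxterized elements to the right of an eigenvector of `σ_i`. -/
theorem mul_fusion (h : BMWRelations q μ n s t) (hp : Admissible q μ) {i j : ℕ} (hi : i + 1 < n)
    (hj : j + 1 < n) (e : j = i + 1 ∨ i = j + 1) {p : A} (hpi : p * s i = (-q⁻¹) • p) {x : ℂ}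
    (hx : μ + q * x ≠ 0) (hx' : μ + q * (q ^ 2 * x) ≠ 0) :
    p * baxterMinus q μ x (s j) * baxterMinus q μ (q ^ 2 * x) (s i) * s j =
      (-q⁻¹) • (p * baxterMinus q μ x (s j) * baxterMinus q μ (q ^ 2 * x) (s i)) := by
  have hl := hp.sub_inv_ne_zero
  have hq := hp.q_ne_zero
  have hqq : q * q⁻¹ = 1 := mul_inv_cancel₀ hq
  have hk : p * κ (s i) = 0 := mul_kappa_eq_zero hp hpi
  -- The relations `r1`–`r6` reduce all words that occur to `p`, `p σ_j`, `p κ_j`, `p σ_j σ_i`, `p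
  -- κ_j σ_i`, `p κ_j κ_i`. By `r4` the word `p σ_j σ_i` is already an eigenvector, so the other
  -- five coefficients must vanish.
  have r1 : p * s j * κ (s i) = (-q) • (p * κ (s j) * κ (s i)) := by
    have ht : p * t i = (-q) • p := by
      have e1 : p * s i * t i = p := by rw [mul_assoc, h.mul_inv i hi, mul_one]
      rw [hpi, smul_mul_assoc] at e1
      conv_rhs => rw [← e1]
      rw [smul_smul, neg_mul_neg, hqq, one_smul]
    rw [mul_assoc, h.mul_kappa_pos i j hi hj e, ← mul_assoc, ← mul_assoc, ht, smul_mul_assoc,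
      smul_mul_assoc]
  have r2 : p * s j * s j = p + (q - q⁻¹) • (p * s j) - ((q - q⁻¹) * μ) • (p * κ (s j)) := by
    rw [mul_assoc, mul_self_eq hp (s j)]
    simp only [mul_add, mul_sub, mul_smul_comm, mul_one]
  have r3 : p * κ (s j) * s j = μ • (p * κ (s j)) := by
    rw [mul_assoc, h.kappa_mul j hj, mul_smul_comm]
  have br : s j * s i * s j = s i * s j * s i := by
    rcases e with rfl | rfl
    · exact (h.braid i hj).symm
    · exact h.braid j hi
  have r4 : p * s j * s i * s j = (-q⁻¹) • (p * s j * s i) := by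
    rw [mul_assoc, mul_assoc, ← mul_assoc (s j), br, ← mul_assoc, ← mul_assoc, hpi,
      smul_mul_assoc, smul_mul_assoc]
  have r5 : p * κ (s j) * s i * s j = p * κ (s j) * κ (s i) := by
    rw [mul_assoc p (κ (s j)) (κ (s i)), h.kappa_mul_kappa hj hi (by omega)]
    simp only [mul_assoc]
  have r6 : p * κ (s j) * κ (s i) * s j =
      p * κ (s j) * s i - (q - q⁻¹) • (p * κ (s j)) + (q - q⁻¹) • (p * κ (s j) * κ (s i)) := by
    have := h.kappa_mul_neg j i hj hi (by omega)
    rw [mul_assoc p, mul_assoc p, ← this, h.inv_eq hp hi]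
    simp only [mul_add, mul_sub, mul_smul_comm, mul_one, mul_assoc]
  obtain ⟨e1, e2, e3⟩ := fusion_coeff (r := q⁻¹) hqq hl hx hx'
  unfold baxterMinus
  generalize (x - 1) / (q - q⁻¹) = α at *
  generalize μ * (x - 1) / (μ + q * x) = β at *
  generalize (q ^ 2 * x - 1) / (q - q⁻¹) = α' at *
  generalize μ * (q ^ 2 * x - 1) / (μ + q * (q ^ 2 * x)) = β' at *
  simp only [mul_add, add_mul, mul_smul_comm, smul_mul_assoc, mul_one, hpi, hk, r1, r2, r3, r4, r5,
    r6, smul_add, smul_sub, smul_zero, zero_mul]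
  have f1 : 1 - q⁻¹ * α' + q * α = 0 := by linear_combination q * e1 - (1 - q⁻¹ * α') * hqq
  have f2 : -((q - q⁻¹) * μ * α) + μ * β - (q - q⁻¹) * (β * β' - q * α * β') + q⁻¹ * β = 0 := by
    linear_combination e3 - (q - q⁻¹) * e2
  have f3 : β * α' + q * (β * β' - q * α * β') = 0 := by
    linear_combination q * e2 - (β * α') * hqq
  linear_combination (norm := module) e1 • p + f1 • (p * s j) + f2 • (p * κ (s j)) +
    e2 • (p * κ (s j) * s i) +
    f3 • (p * κ (s j) * κ (s i))

end BMWRelations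

end Relations

/-- Parameters for which the `q`-antisymmetrizers on at most `k` strands exist, together with the
baxterized elements `σ⁻(q^{-2i})`, `i ≤ k`. -/
structure Generic (q μ : ℂ) (k : ℕ) : Prop extends Admissible q μ where
  q_pow_ne_one : ∀ i : ℕ, 1 ≤ i → i ≤ k → q ^ (2 * i) ≠ 1
  mu_add_ne : ∀ i : ℕ, 1 ≤ i → i ≤ k → μ + q * (q⁻¹) ^ (2 * i) ≠ 0

/-! ### The `q`-antisymmetrizers: absorption of generators, idempotence, reflection. -/

section Antisymmetrizer

variable {A : Type*} [Ring A] [Algebra ℂ A] {q μ : ℂ} {n k : ℕ} {s t : ℕ → A}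

local notation "κ" => kappa q μ

local notation "𝔞" => antisymmetrizer q μ

theorem antisymmetrizer_succ (s : ℕ → A) (i : ℕ) : 𝔞 s (i + 2) = (q ^ (i + 1) / qNumber q (i + 2)) •
    (𝔞 s (i + 1) * baxterMinus q μ ((q⁻¹) ^ (2 * (i + 1))) (s i) * 𝔞 s (i + 1)) := rfl

/-- The prefactor in the recursion is the inverse of the value of `σ⁻(q^{-2(i+1)})` on the
eigenvalue `-q⁻¹`; this normalization makes antisymmetrizers fix everything that absorbs the
generators. -/
theorem antisymmetrizer_coeff (hp : Generic q μ k) {i : ℕ} (hi : i + 2 ≤ k) :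
    (q ^ (i + 1) / qNumber q (i + 2)) *
      (1 - q⁻¹ * (((q⁻¹) ^ (2 * (i + 1)) - 1) / (q - q⁻¹))) = 1 := by
  rw [baxterMinus_eigenvalue hp.toAdmissible]
  have h1 := qNumber_ne_zero hp.toAdmissible (hp.q_pow_ne_one (i + 2) (by omega) hi)
  rw [div_mul_eq_mul_div, ← mul_assoc, ← mul_pow, mul_inv_cancel₀ hp.q_ne_zero, one_pow, one_mul]
  exact div_self h1

/-- An element on which `σ_1, …, σ_{i-1}` act by `-q⁻¹` from the right is fixed by `a^{(i)}`. -/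
theorem mul_antisymmetrizer_of_absorb (hp : Generic q μ k) {p : A} :
    ∀ {i : ℕ}, i ≤ k → (∀ j, j + 1 < i → p * s j = (-q⁻¹) • p) → p * 𝔞 s i = p
  | 0, _, _ => mul_one p
  | 1, _, _ => mul_one p
  | i + 2, hi, h => by
    have h1 := mul_antisymmetrizer_of_absorb hp (i := i + 1) (by omega) fun j hj => h j (by omega)
    rw [antisymmetrizer_succ, mul_smul_comm, ← mul_assoc, ← mul_assoc, h1,
      mul_baxterMinus hp.toAdmissible (h i (by omega)), smul_mul_assoc, h1, smul_smul,
      antisymmetrizer_coeff hp hi, one_smul]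

theorem antisymmetrizer_mul_of_absorb (hp : Generic q μ k) {p : A} :
    ∀ {i : ℕ}, i ≤ k → (∀ j, j + 1 < i → s j * p = (-q⁻¹) • p) → 𝔞 s i * p = p
  | 0, _, _ => one_mul p
  | 1, _, _ => one_mul p
  | i + 2, hi, h => by
    have h1 := antisymmetrizer_mul_of_absorb hp (i := i + 1) (by omega) fun j hj => h j (by omega)
    rw [antisymmetrizer_succ, smul_mul_assoc, mul_assoc, mul_assoc, h1,
      baxterMinus_mul hp.toAdmissible (h i (by omega)), mul_smul_comm, h1, smul_smul,
      antisymmetrizer_coeff hp hi, one_smul]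

theorem commute_antisymmetrizer {x : A} {i : ℕ} (h : ∀ j, j + 1 < i → Commute x (s j)) :
    Commute x (𝔞 s i) := by
  have : 𝔞 s i ∈ Subalgebra.centralizer ℂ {x} :=
    antisymmetrizer_mem fun j hj => by
      simpa [Subalgebra.mem_centralizer_iff] using (h j hj).eq
  simpa [Subalgebra.mem_centralizer_iff, commute_iff_eq] using this

theorem commute_baxterMinus {x y : A} (h : Commute x y) (c : ℂ) :
    Commute x (baxterMinus q μ c y) := by
  have : baxterMinus q μ c y ∈ Subalgebra.centralizer ℂ {x} :=
    baxterMinus_mem (by simpa [Subalgebra.mem_centralizer_iff] using h.eq) _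
  simpa [Subalgebra.mem_centralizer_iff, commute_iff_eq] using this

/-- The two-strand case: `σ⁻(q⁻²)` is proportional to `a^{(2)}`. It starts the induction in
`antisymmetrizer_mul`. -/
theorem baxterMinus_mul_self (hp : Generic q μ 1) (h : BMWRelations q μ n s t) {i : ℕ}
    (hi : i + 1 < n) :
    baxterMinus q μ ((q⁻¹) ^ 2) (s i) * s i = (-q⁻¹) • baxterMinus q μ ((q⁻¹) ^ 2) (s i) := by
  have hl := hp.sub_inv_ne_zero
  have hqq : q * q⁻¹ = 1 := mul_inv_cancel₀ hp.q_ne_zero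
  have hm := hp.mu_add_ne 1 le_rfl le_rfl
  have c1 : ((q⁻¹) ^ 2 - 1) / (q - q⁻¹) = -q⁻¹ := by
    rw [div_eq_iff hl]; linear_combination hqq
  have c2 : μ * ((q⁻¹) ^ 2 - 1) / (μ + q * (q⁻¹) ^ 2) * (μ + q⁻¹) = μ * ((q⁻¹) ^ 2 - 1) := by
    have : μ + q⁻¹ = μ + q * (q⁻¹) ^ (2 * 1) := by linear_combination -q⁻¹ * hqq
    rw [this]
    exact div_mul_cancel₀ _ hm
  unfold baxterMinus
  rw [c1]
  generalize μ * ((q⁻¹) ^ 2 - 1) / (μ + q * (q⁻¹) ^ 2) = β at *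
  simp only [add_mul, smul_mul_assoc, one_mul, h.kappa_mul i hi, mul_self_eq hp.toAdmissible (s i)]
  have f2 : -q⁻¹ * -((q - q⁻¹) * μ) + β * μ + q⁻¹ * β = 0 := by
    linear_combination c2 + μ * hqq
  have f1 : 1 - q⁻¹ * (q - q⁻¹) - q⁻¹ * q⁻¹ = 0 := by linear_combination -hqq
  linear_combination (norm := module) f1 • s i + f2 • κ (s i)

/-- Only the last generator needs work; the others are absorbed by the right factor of the
recursion. Expand that factor once more: its left end commutes with the outer baxterized element and
is absorbed, leaving two consecutive baxterized elements to the right of an antisymmetrizer, where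
`mul_fusion` applies. -/
theorem antisymmetrizer_mul (h : BMWRelations q μ n s t) (hp : Generic q μ k) :
    ∀ {i : ℕ}, i ≤ n → i ≤ k → ∀ {j : ℕ}, j + 1 < i → 𝔞 s i * s j = (-q⁻¹) • 𝔞 s i := by
  intro i
  induction i using Nat.strong_induction_on with
  | _ i ih =>
  match i with
  | 0 => exact fun _ _ _ hj => by omega
  | 1 => exact fun _ _ _ hj => by omega
  | i + 2 =>
    intro hin hik j hj
    rw [antisymmetrizer_succ, smul_mul_assoc, smul_comm (-q⁻¹)]
    congr 1
    rcases Nat.lt_or_ge j i with hji | hji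
    · rw [mul_assoc, ih _ (by omega) (by omega) (by omega) (by omega), mul_smul_comm]
    obtain rfl : j = i := by omega
    match j with
    | 0 =>
      have hp1 : Generic q μ 1 :=
        ⟨hp.toAdmissible, fun i h1 h2 => hp.q_pow_ne_one i h1 (by omega),
          fun i h1 h2 => hp.mu_add_ne i h1 (by omega)⟩
      have := baxterMinus_mul_self hp1 h (i := 0) (by omega)
      simpa [antisymmetrizer] using this
    | i + 1 =>
      have ha : 𝔞 s (i + 2) * 𝔞 s (i + 1) = 𝔞 s (i + 2) :=
        mul_antisymmetrizer_of_absorb hp (by omega) fun j hj =>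
          ih _ (by omega) (by omega) (by omega) (by omega)
      have hc : Commute (s (i + 1)) (𝔞 s (i + 1)) :=
        commute_antisymmetrizer fun j hj => h.commute (by omega) (by omega) (by omega)
      have hcb := (commute_baxterMinus (q := q) (μ := μ) hc.symm ((q⁻¹) ^ (2 * (i + 1 + 1)))).eq
      have key : 𝔞 s (i + 2) * baxterMinus q μ ((q⁻¹) ^ (2 * (i + 1 + 1))) (s (i + 1)) *
          𝔞 s (i + 2) = (q ^ (i + 1) / qNumber q (i + 2)) •
            (𝔞 s (i + 2) * baxterMinus q μ ((q⁻¹) ^ (2 * (i + 1 + 1))) (s (i + 1)) *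
              baxterMinus q μ ((q⁻¹) ^ (2 * (i + 1))) (s i) * 𝔞 s (i + 1)) := by
        conv_lhs => rw [antisymmetrizer_succ s i, mul_smul_comm]
        rw [← antisymmetrizer_succ s i]
        congr 1
        rw [← mul_assoc, ← mul_assoc, mul_assoc (𝔞 s (i + 2)), ← hcb, ← mul_assoc, ha]
      -- The two spectral parameters differ by the factor `q²` required for fusion.
      have hx : (q⁻¹) ^ (2 * (i + 1)) = q ^ 2 * (q⁻¹) ^ (2 * (i + 1 + 1)) := by
        have hqq : q * q⁻¹ = 1 := mul_inv_cancel₀ hp.q_ne_zero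
        linear_combination -((q⁻¹) ^ (2 * (i + 1)) * (1 + q * q⁻¹)) * hqq
      have hf := h.mul_fusion hp.toAdmissible (i := i) (j := i + 1) (by omega) (by omega) (by omega)
        (p := 𝔞 s (i + 2)) (ih _ (by omega) (by omega) (by omega) (by omega))
        (hp.mu_add_ne (i + 1 + 1) (by omega) (by omega))
        (by rw [← hx]; exact hp.mu_add_ne (i + 1) (by omega) (by omega))
      rw [← hx] at hf
      rw [key, smul_mul_assoc, smul_comm (-q⁻¹)]
      congr 1
      rw [mul_assoc, ← hc.eq, ← mul_assoc, hf, smul_mul_assoc]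

theorem kappa_op (hp : Admissible q μ) (x : A) :
    kappa q μ (MulOpposite.op x) = MulOpposite.op (kappa q μ x) := by
  rw [kappa_eq hp, kappa_eq hp]
  simp

theorem baxterMinus_op (hp : Admissible q μ) (x : A) (c : ℂ) :
    baxterMinus q μ c (MulOpposite.op x) = MulOpposite.op (baxterMinus q μ c x) := by
  simp [baxterMinus, kappa_op hp]

theorem antisymmetrizer_op (hp : Admissible q μ) (s : ℕ → A) :
    ∀ i, 𝔞 (fun j => MulOpposite.op (s j)) i = MulOpposite.op (𝔞 s i)
  | 0 => rfl
  | 1 => rfl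
  | i + 2 => by
    rw [antisymmetrizer_succ, antisymmetrizer_succ, antisymmetrizer_op hp s (i + 1),
      baxterMinus_op hp]
    simp [mul_assoc]

/-- The relations are stable under reversal of words, so every statement about multiplication from
the right has a left counterpart obtained in the opposite algebra. The factored definition of `κ` is
palindromic only after rewriting by `kappa_eq`, hence the admissibility assumption. -/
theorem BMWRelations.op (h : BMWRelations q μ n s t) (hp : Admissible q μ) :
    BMWRelations q μ n (fun j => MulOpposite.op (s j)) (fun j => MulOpposite.op (t j)) := by
  constructor
  all_goals simp only [kappa_op hp, ← MulOpposite.op_mul, ← MulOpposite.op_smul,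
    ← MulOpposite.op_one, MulOpposite.op_inj]
  · exact h.inv_mul
  · exact h.mul_inv
  · intro i hi; rw [← mul_assoc, ← mul_assoc]; exact h.braid i hi
  · exact fun i j hij hj => (h.comm i j hij hj).symm
  · exact h.kappa_mul
  · exact h.mul_kappa
  · intro i j hi hj e; rw [← mul_assoc]; exact h.mul_kappa_pos i j hi hj e
  · intro i j hi hj e; rw [← mul_assoc]; exact h.mul_kappa_neg i j hi hj e
  · intro i j hi hj e; rw [← mul_assoc]; exact h.kappa_mul_pos i j hi hj e
  · intro i j hi hj e; rw [← mul_assoc]; exact h.kappa_mul_neg i j hi hj e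
  · intro i j hi hj e; rw [← mul_assoc]; exact h.kappa_mul_kappa_mul_kappa i j hi hj e
  · exact h.kappa_sq

theorem mul_antisymmetrizer (h : BMWRelations q μ n s t) (hp : Generic q μ k) {i : ℕ} (hin : i ≤ n)
    (hik : i ≤ k) {j : ℕ} (hj : j + 1 < i) : s j * 𝔞 s i = (-q⁻¹) • 𝔞 s i := by
  have := antisymmetrizer_mul (h.op hp.toAdmissible) hp hin hik hj
  rw [antisymmetrizer_op hp.toAdmissible] at this
  exact MulOpposite.op_injective (by simpa using this)

theorem antisymmetrizer_idem (h : BMWRelations q μ n s t) (hp : Generic q μ k) {i : ℕ}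
    (hin : i ≤ n) (hik : i ≤ k) : 𝔞 s i * 𝔞 s i = 𝔞 s i :=
  mul_antisymmetrizer_of_absorb hp hik fun _ hj => antisymmetrizer_mul h hp hin hik hj

theorem antisymmetrizer_mul_antisymmetrizer (h : BMWRelations q μ n s t) (hp : Generic q μ k)
    {i j : ℕ} (hin : i ≤ n) (hik : i ≤ k) (hj : j ≤ i) : 𝔞 s i * 𝔞 s j = 𝔞 s i :=
  mul_antisymmetrizer_of_absorb hp (by omega) fun _ _ =>
    antisymmetrizer_mul h hp hin hik (by omega)

/-- The antisymmetrizer is invariant under the reflection of the strands. -/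
theorem antisymmetrizer_reverse (h : BMWRelations q μ n s t) (hp : Generic q μ k) (hn : n ≤ k) :
    𝔞 (fun j => s (n - 2 - j)) n = 𝔞 s n := by
  -- Both elements absorb all generators on both sides, so their product equals each of them.
  have h1 : 𝔞 s n * 𝔞 (fun j => s (n - 2 - j)) n = 𝔞 s n :=
    mul_antisymmetrizer_of_absorb hp hn fun j hj =>
      antisymmetrizer_mul h hp le_rfl hn (by omega)
  have h2 : 𝔞 s n * 𝔞 (fun j => s (n - 2 - j)) n = 𝔞 (fun j => s (n - 2 - j)) n :=
    antisymmetrizer_mul_of_absorb hp hn fun j hj => by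
      have := mul_antisymmetrizer h.reverse hp le_rfl hn (j := n - 2 - j) (by omega)
      rwa [show n - 2 - (n - 2 - j) = j by omega] at this
  rw [← h2, h1]

/-- The recursion for the antisymmetrizers which adds a strand on the left. -/
theorem antisymmetrizer_succ_left (hp : Generic q μ k) {i : ℕ} (h : BMWRelations q μ (i + 2) s t)
    (hi : i + 2 ≤ k) : 𝔞 s (i + 2) = (q ^ (i + 1) / qNumber q (i + 2)) •
      (𝔞 (fun j => s (1 + j)) (i + 1) * baxterMinus q μ ((q⁻¹) ^ (2 * (i + 1))) (s 0) *
        𝔞 (fun j => s (1 + j)) (i + 1)) := by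
  have hs : BMWRelations q μ (i + 1) (fun j => s (1 + j)) (fun j => t (1 + j)) :=
    h.shift (by omega)
  rw [← antisymmetrizer_reverse h hp hi, antisymmetrizer_succ,
    ← antisymmetrizer_reverse hs hp (by omega)]
  have : ∀ j, j + 1 < i + 1 → s (i + 2 - 2 - j) = s (1 + (i + 1 - 2 - j)) := fun j hj => by
    congr 1; omega
  rw [antisymmetrizer_congr this]
  simp

end Antisymmetrizer

/-! ### Adding one strand to the BMW algebra; the conditional expectation. -/

section StrandAlgebra

variable {A : Type*} [Ring A] [Algebra ℂ A] {q μ : ℂ} {n k : ℕ} {s t : ℕ → A}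

local notation "κ" => kappa q μ

/-- The subalgebra generated by the elements of a sequence which act on the first `m` strands. -/
def strandAlg (s : ℕ → A) (m : ℕ) : Subalgebra ℂ A :=
  Algebra.adjoin ℂ {x | ∃ i, i + 1 < m ∧ x = s i}

theorem gen_mem_strandAlg {m i : ℕ} (hi : i + 1 < m) : s i ∈ strandAlg s m :=
  Algebra.subset_adjoin ⟨i, hi, rfl⟩

theorem strandAlg_mono {m m' : ℕ} (h : m ≤ m') : strandAlg s m ≤ strandAlg s m' :=
  Algebra.adjoin_mono fun _ ⟨i, hi, e⟩ => ⟨i, by omega, e⟩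

theorem strandAlg_le {m : ℕ} {B : Subalgebra ℂ A} (h : ∀ i, i + 1 < m → s i ∈ B) :
    strandAlg s m ≤ B :=
  Algebra.adjoin_le fun _ ⟨i, hi, e⟩ => e ▸ h i hi

theorem antisymmetrizer_mem_strandAlg (m : ℕ) : antisymmetrizer q μ s m ∈ strandAlg s m :=
  antisymmetrizer_mem fun _ hj => gen_mem_strandAlg hj

theorem commute_of_mem_strandAlg {m : ℕ} {x w : A} (hw : w ∈ strandAlg s m)
    (h : ∀ i, i + 1 < m → Commute x (s i)) : Commute x w := by
  have : strandAlg s m ≤ Subalgebra.centralizer ℂ {x} := strandAlg_le fun i hi => by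
    simpa [Subalgebra.mem_centralizer_iff] using (h i hi).eq
  simpa [Subalgebra.mem_centralizer_iff, commute_iff_eq] using this hw

theorem mem_strandAlg_one {m : ℕ} (hm : m ≤ 1) {w : A} (hw : w ∈ strandAlg s m) :
    ∃ c : ℂ, w = c • (1 : A) := by
  have : strandAlg s m ≤ ⊥ := strandAlg_le fun i hi => by omega
  obtain ⟨c, rfl⟩ := Algebra.mem_bot.1 (this hw)
  exact ⟨c, Algebra.algebraMap_eq_smul_one c⟩

namespace BMWRelations

variable (h : BMWRelations q μ n s t)
include h

theorem mul_mul_kappa_mul_kappa {i j : ℕ} (hi : i + 1 < n) (hj : j + 1 < n)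
    (e : j = i + 1 ∨ i = j + 1) : s i * κ (s j) * κ (s i) = t j * κ (s i) := by
  have h1 := h.mul_kappa_pos j i hj hi (by omega)
  rw [h1, mul_assoc, mul_assoc, ← mul_assoc (κ (s i)), h.kappa_mul_kappa_mul_kappa i j hi hj e]

theorem mul_mul_kappa {i j : ℕ} (hi : i + 1 < n) (hj : j + 1 < n)
    (e : j = i + 1 ∨ i = j + 1) : s i * s j * κ (s i) = κ (s j) * κ (s i) :=
  (h.kappa_mul_kappa' hi hj e).symm

theorem mul_kappa_mul {i j : ℕ} (hi : i + 1 < n) (hj : j + 1 < n)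
    (e : j = i + 1 ∨ i = j + 1) : s i * κ (s j) * s i = t j * κ (s i) * t j := by
  rw [h.mul_kappa_pos j i hj hi (by omega), mul_assoc, h.kappa_mul_pos j i hj hi (by omega)]
  rw [← mul_assoc, mul_assoc (t j), ← mul_assoc (κ (s i)), h.kappa_mul_kappa_mul_kappa i j hi hj e,
    mul_assoc]

/-- The decomposition one strand lower, with the extra information that the outer factors, living on
the first `m` strands, commute with `s m`. It is needed inside the induction that proves the
decomposition, which therefore enters as the hypothesis `ih`; for `m = 0` only scalars remain. -/
theorem strandAlg_split_aux {m : ℕ} (hm : m + 2 ≤ n)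
    (ih : ∀ m', m = m' + 1 → ∀ P : Submodule ℂ A, (∀ w ∈ strandAlg s m, w ∈ P) →
      (∀ x ∈ strandAlg s m, ∀ y ∈ strandAlg s m, x * s m' * y ∈ P) →
      (∀ x ∈ strandAlg s m, ∀ y ∈ strandAlg s m, x * κ (s m') * y ∈ P) →
      ∀ w ∈ strandAlg s (m + 1), w ∈ P)
    (P : Submodule ℂ A) (h0 : ∀ w ∈ strandAlg s m, Commute (s m) w → w ∈ P)
    (h1 : ∀ m', m = m' + 1 → ∀ x ∈ strandAlg s m, ∀ y ∈ strandAlg s m,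
      Commute (s m) x → Commute (s m) y → x * s m' * y ∈ P)
    (h2 : ∀ m', m = m' + 1 → ∀ x ∈ strandAlg s m, ∀ y ∈ strandAlg s m,
      Commute (s m) x → Commute (s m) y → x * κ (s m') * y ∈ P) :
    ∀ w ∈ strandAlg s (m + 1), w ∈ P := by
  have hc : ∀ w ∈ strandAlg s m, Commute (s m) w := fun w hw =>
    commute_of_mem_strandAlg hw fun i hi => h.commute (by omega) (by omega) (by omega)
  match m with
  | 0 =>
    intro w hw
    obtain ⟨c, rfl⟩ := mem_strandAlg_one (by omega) hw
    exact P.smul_mem _ (h0 1 (one_mem _) (Commute.one_right _))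
  | m' + 1 =>
    exact ih m' rfl P (fun w hw => h0 w hw (hc w hw))
      (fun x hx y hy => h1 m' rfl x hx y hy (hc x hx) (hc y hy))
      (fun x hx y hy => h2 m' rfl x hx y hy (hc x hx) (hc y hy))

/-- With `W` the algebra on `m + 1` strands, the span `U = W + WσW + WκW` is visibly stable under
`W` on both sides. It is a left ideal as soon as `σ w σ` and `σ w κ` lie in `U` for `w ∈ W`, and
this is checked on the decomposition of `w` one strand lower. -/
theorem strandAlg_le_of_split_aux (hp : Admissible q μ) {m : ℕ} (hm : m + 2 ≤ n)
    (ih : ∀ m', m = m' + 1 → ∀ P : Submodule ℂ A, (∀ w ∈ strandAlg s m, w ∈ P) →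
      (∀ x ∈ strandAlg s m, ∀ y ∈ strandAlg s m, x * s m' * y ∈ P) →
      (∀ x ∈ strandAlg s m, ∀ y ∈ strandAlg s m, x * κ (s m') * y ∈ P) →
      ∀ w ∈ strandAlg s (m + 1), w ∈ P)
    (P : Submodule ℂ A) (h0 : ∀ w ∈ strandAlg s (m + 1), w ∈ P)
    (h1 : ∀ x ∈ strandAlg s (m + 1), ∀ y ∈ strandAlg s (m + 1), x * s m * y ∈ P)
    (h2 : ∀ x ∈ strandAlg s (m + 1), ∀ y ∈ strandAlg s (m + 1), x * κ (s m) * y ∈ P) :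
    ∀ w ∈ strandAlg s (m + 2), w ∈ P := by
  let S : Set A := {z | z ∈ strandAlg s (m + 1) ∨
    ∃ g ∈ ({s m, κ (s m)} : Set A), ∃ x ∈ strandAlg s (m + 1), ∃ y ∈ strandAlg s (m + 1),
      z = x * g * y}
  let U : Submodule ℂ A := Submodule.span ℂ S
  have hUP : U ≤ P := by
    refine Submodule.span_le.2 ?_
    rintro z (hz | ⟨g, rfl | rfl, x, hx, y, hy, rfl⟩)
    · exact h0 z hz
    · exact h1 x hx y hy
    · exact h2 x hx y hy
  have m0 : ∀ w ∈ strandAlg s (m + 1), w ∈ U := fun w hw => Submodule.subset_span (Or.inl hw)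
  have m1 : ∀ x ∈ strandAlg s (m + 1), ∀ y ∈ strandAlg s (m + 1), x * s m * y ∈ U :=
    fun x hx y hy => Submodule.subset_span (Or.inr ⟨_, Or.inl rfl, x, hx, y, hy, rfl⟩)
  have m2 : ∀ x ∈ strandAlg s (m + 1), ∀ y ∈ strandAlg s (m + 1), x * κ (s m) * y ∈ U :=
    fun x hx y hy => Submodule.subset_span (Or.inr ⟨_, Or.inr rfl, x, hx, y, hy, rfl⟩)
  have left : ∀ a ∈ strandAlg s (m + 1), ∀ u ∈ U, a * u ∈ U := by
    intro a ha u hu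
    suffices U ≤ U.comap (LinearMap.mulLeft ℂ a) from this hu
    refine Submodule.span_le.2 ?_
    rintro z (hz | ⟨g, hg, x, hx, y, hy, rfl⟩)
    · exact m0 _ (mul_mem ha hz)
    · refine Submodule.subset_span (Or.inr ⟨g, hg, a * x, mul_mem ha hx, y, hy, ?_⟩)
      simp [mul_assoc]
  have right : ∀ a ∈ strandAlg s (m + 1), ∀ u ∈ U, u * a ∈ U := by
    intro a ha u hu
    suffices U ≤ U.comap (LinearMap.mulRight ℂ a) from this hu
    refine Submodule.span_le.2 ?_
    rintro z (hz | ⟨g, hg, x, hx, y, hy, rfl⟩)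
    · exact m0 _ (mul_mem hz ha)
    · refine Submodule.subset_span (Or.inr ⟨g, hg, x, hx, y * a, mul_mem hy ha, ?_⟩)
      simp [mul_assoc]
  -- After moving the outer factors of `w` aside, three words remain: `σσ` (the quadratic
  -- expression), `σσ'σ` (the braid relation) and `σκ'σ` (which is `σ'⁻¹ κ σ'⁻¹`).
  have k1 : ∀ w ∈ strandAlg s (m + 1), s m * w * s m ∈ U := by
    refine h.strandAlg_split_aux hm ih
      (U.comap (LinearMap.mulRight ℂ (s m) ∘ₗ LinearMap.mulLeft ℂ (s m))) ?_ ?_ ?_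
    · intro a ha hc
      have ha' := strandAlg_mono (s := s) (Nat.le_succ m) ha
      change s m * a * s m ∈ U
      rw [hc.eq, mul_assoc, mul_self_eq hp]
      refine left a ha' _ (U.sub_mem (U.add_mem (m0 _ (one_mem _)) (U.smul_mem _ ?_))
        (U.smul_mem _ ?_))
      · simpa using m1 1 (one_mem _) 1 (one_mem _)
      · simpa using m2 1 (one_mem _) 1 (one_mem _)
    · rintro m' rfl a ha b hb hca hcb
      have hs : s m' ∈ strandAlg s (m' + 1 + 1) := gen_mem_strandAlg (by omega)
      have ha' := strandAlg_mono (s := s) (Nat.le_succ _) ha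
      have hb' := strandAlg_mono (s := s) (Nat.le_succ _) hb
      change s (m' + 1) * (a * s m' * b) * s (m' + 1) ∈ U
      have e : s (m' + 1) * (a * s m' * b) * s (m' + 1) = a * s m' * s (m' + 1) * (s m' * b) := by
        have e1 := h.braid m' (by omega)
        have : a * s m' * s (m' + 1) * (s m' * b) = a * (s m' * s (m' + 1) * s m') * b := by
          simp only [mul_assoc]
        rw [this, e1]
        simp only [← mul_assoc, hca.eq]
        simp only [mul_assoc, hcb.eq]
      rw [e]
      exact m1 _ (mul_mem ha' hs) _ (mul_mem hs hb')
    · rintro m' rfl a ha b hb hca hcb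
      have hs : t m' ∈ strandAlg s (m' + 1 + 1) :=
        h.inv_mem hp (by omega) (gen_mem_strandAlg (by omega))
      have ha' := strandAlg_mono (s := s) (Nat.le_succ _) ha
      have hb' := strandAlg_mono (s := s) (Nat.le_succ _) hb
      change s (m' + 1) * (a * κ (s m') * b) * s (m' + 1) ∈ U
      have e : s (m' + 1) * (a * κ (s m') * b) * s (m' + 1) =
          a * t m' * κ (s (m' + 1)) * (t m' * b) := by
        have e1 := h.mul_kappa_mul (i := m' + 1) (j := m') (by omega) (by omega) (by omega)
        have : a * t m' * κ (s (m' + 1)) * (t m' * b) =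
            a * (t m' * κ (s (m' + 1)) * t m') * b := by
          simp only [mul_assoc]
        rw [this, ← e1]
        simp only [← mul_assoc, hca.eq]
        simp only [mul_assoc, hcb.eq]
      rw [e]
      exact m2 _ (mul_mem ha' hs) _ (mul_mem hs hb')
  have k2 : ∀ w ∈ strandAlg s (m + 1), s m * w * κ (s m) ∈ U := by
    refine h.strandAlg_split_aux hm ih
      (U.comap (LinearMap.mulRight ℂ (κ (s m)) ∘ₗ LinearMap.mulLeft ℂ (s m))) ?_ ?_ ?_
    · intro a ha hc
      have ha' := strandAlg_mono (s := s) (Nat.le_succ m) ha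
      change s m * a * κ (s m) ∈ U
      rw [hc.eq, mul_assoc, h.mul_kappa m (by omega), mul_smul_comm]
      refine U.smul_mem _ ?_
      simpa using m2 a ha' 1 (one_mem _)
    · rintro m' rfl a ha b hb hca hcb
      have hs : s m' ∈ strandAlg s (m' + 1 + 1) := gen_mem_strandAlg (by omega)
      have ha' := strandAlg_mono (s := s) (Nat.le_succ _) ha
      have hb' := strandAlg_mono (s := s) (Nat.le_succ _) hb
      change s (m' + 1) * (a * s m' * b) * κ (s (m' + 1)) ∈ U
      have e : s (m' + 1) * (a * s m' * b) * κ (s (m' + 1)) =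
          a * κ (s m') * κ (s (m' + 1)) * b := by
        have e1 := h.mul_mul_kappa (i := m' + 1) (j := m') (by omega) (by omega) (by omega)
        rw [mul_assoc a (κ _), ← e1]
        simp only [← mul_assoc, hca.eq]
        simp only [mul_assoc, (commute_kappa_left (q := q) (μ := μ) hcb).eq]
      rw [e]
      exact m2 _ (mul_mem ha' (kappa_mem hs)) _ hb'
    · rintro m' rfl a ha b hb hca hcb
      have hs : t m' ∈ strandAlg s (m' + 1 + 1) :=
        h.inv_mem hp (by omega) (gen_mem_strandAlg (by omega))
      have ha' := strandAlg_mono (s := s) (Nat.le_succ _) ha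
      have hb' := strandAlg_mono (s := s) (Nat.le_succ _) hb
      change s (m' + 1) * (a * κ (s m') * b) * κ (s (m' + 1)) ∈ U
      have e : s (m' + 1) * (a * κ (s m') * b) * κ (s (m' + 1)) =
          a * t m' * κ (s (m' + 1)) * b := by
        have e1 := h.mul_mul_kappa_mul_kappa (i := m' + 1) (j := m') (by omega) (by omega)
          (by omega)
        rw [mul_assoc a (t _), ← e1]
        simp only [← mul_assoc, hca.eq]
        simp only [mul_assoc, (commute_kappa_left (q := q) (μ := μ) hcb).eq]
      rw [e]
      exact m2 _ (mul_mem ha' hs) _ hb'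
  have k : ∀ u ∈ U, s m * u ∈ U := by
    intro u hu
    suffices U ≤ U.comap (LinearMap.mulLeft ℂ (s m)) from this hu
    refine Submodule.span_le.2 ?_
    rintro z (hz | ⟨g, rfl | rfl, x, hx, y, hy, rfl⟩)
    · simpa using m1 1 (one_mem _) z hz
    · have := right y hy _ (k1 x hx)
      simpa [mul_assoc] using this
    · have := right y hy _ (k2 x hx)
      simpa [mul_assoc] using this
  -- A left ideal containing `1` is everything.
  suffices H : ∀ w ∈ strandAlg s (m + 2), ∀ u ∈ U, w * u ∈ U from fun w hw => by
    have := H w hw 1 (m0 1 (one_mem _))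
    rw [mul_one] at this
    exact hUP this
  intro w hw
  induction hw using Algebra.adjoin_induction with
  | mem x hx =>
    obtain ⟨i, hi, rfl⟩ := hx
    rcases Nat.lt_or_ge i m with him | him
    · exact left _ (gen_mem_strandAlg (by omega))
    · obtain rfl : i = m := by omega
      exact k
  | algebraMap c =>
    intro u hu
    rw [← Algebra.smul_def]
    exact U.smul_mem _ hu
  | add x y _ _ hx hy => exact fun u hu => add_mul x y u ▸ U.add_mem (hx u hu) (hy u hu)
  | mul x y _ _ hx hy => exact fun u hu => mul_assoc x y u ▸ hx _ (hy u hu)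

/-- The BMW algebra on `m + 2` strands is `W + W σ W + W κ W`, where `W` is the BMW algebra on
`m + 1` strands and `σ`, `κ` act on the last two strands. -/
theorem strandAlg_le_of_split (hp : Admissible q μ) {m : ℕ} (hm : m + 2 ≤ n) (P : Submodule ℂ A)
    (h0 : ∀ w ∈ strandAlg s (m + 1), w ∈ P)
    (h1 : ∀ x ∈ strandAlg s (m + 1), ∀ y ∈ strandAlg s (m + 1), x * s m * y ∈ P)
    (h2 : ∀ x ∈ strandAlg s (m + 1), ∀ y ∈ strandAlg s (m + 1), x * κ (s m) * y ∈ P) :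
    ∀ w ∈ strandAlg s (m + 2), w ∈ P := by
  induction m generalizing P with
  | zero => exact h.strandAlg_le_of_split_aux hp hm (fun m' hm' => by omega) P h0 h1 h2
  | succ m ih =>
    refine h.strandAlg_le_of_split_aux hp hm (fun m' hm' => ?_) P h0 h1 h2
    obtain rfl : m = m' := by omega
    exact fun P => ih (by omega) P

/-- The ideal of the elements passing through `κ_{m+1}` is generated from the right by
`κ_{m+1}` over the algebra on `m + 1` strands. -/
theorem exists_mul_kappa (hp : Admissible q μ) {m : ℕ} (hm : m + 2 ≤ n) {w : A}
    (hw : w ∈ strandAlg s (m + 2)) : ∃ u ∈ strandAlg s (m + 1), w * κ (s m) = u * κ (s m) := by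
  let T : Submodule ℂ A :=
    (strandAlg s (m + 1)).toSubmodule.map (LinearMap.mulRight ℂ (κ (s m)))
  have memT : ∀ u ∈ strandAlg s (m + 1), ∀ z, u * κ (s m) = z → z ∈ T :=
    fun u hu z e => ⟨u, hu, e⟩
  -- Only the generator `s m` leaves the smaller algebra; the relations with `κ (s m)` on the right
  -- bring it back.
  have key : ∀ u ∈ strandAlg s (m + 1), s m * u * κ (s m) ∈ T := by
    refine fun u hu => h.strandAlg_split_aux hm ?_
      (T.comap (LinearMap.mulRight ℂ (κ (s m)) ∘ₗ LinearMap.mulLeft ℂ (s m))) ?_ ?_ ?_ u hu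
    · rintro m' rfl P
      exact h.strandAlg_le_of_split hp (by omega) P
    · intro a ha hc
      refine memT (μ • a) ( Subalgebra.smul_mem _ (strandAlg_mono (by omega) ha) _) _ ?_
      change μ • a * κ (s m) = s m * a * κ (s m)
      rw [hc.eq, mul_assoc, h.mul_kappa m (by omega), mul_smul_comm, smul_mul_assoc]
    · rintro m' rfl a ha b hb hca hcb
      have hs : s m' ∈ strandAlg s (m' + 1 + 1) := gen_mem_strandAlg (by omega)
      refine memT (a * κ (s m') * b) ( mul_mem (mul_mem (strandAlg_mono (by omega) ha) (kappa_mem hs))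
        (strandAlg_mono (by omega) hb)) _ ?_
      change a * κ (s m') * b * κ (s (m' + 1)) = s (m' + 1) * (a * s m' * b) * κ (s (m' + 1))
      have e := (commute_kappa_left (q := q) (μ := μ) hcb).eq
      rw [mul_assoc _ b, ← e, ← mul_assoc, mul_assoc a,
        ← h.mul_mul_kappa (by omega) (by omega) (by omega)]
      simp only [← mul_assoc, ← hca.eq]
      simp only [mul_assoc, e]
    · rintro m' rfl a ha b hb hca hcb
      have hs : s m' ∈ strandAlg s (m' + 1 + 1) := gen_mem_strandAlg (by omega)
      refine memT (a * t m' * b) ( mul_mem (mul_mem (strandAlg_mono (by omega) ha)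
        (h.inv_mem hp (by omega) hs)) (strandAlg_mono (by omega) hb)) _ ?_
      change a * t m' * b * κ (s (m' + 1)) = s (m' + 1) * (a * κ (s m') * b) * κ (s (m' + 1))
      have e := (commute_kappa_left (q := q) (μ := μ) hcb).eq
      rw [mul_assoc _ b, ← e, ← mul_assoc, mul_assoc a,
        ← h.mul_mul_kappa_mul_kappa (by omega) (by omega) (by omega)]
      simp only [← mul_assoc, ← hca.eq]
      simp only [mul_assoc, e]
  suffices H : ∀ u ∈ T, w * u ∈ T by
    obtain ⟨u, hu, e⟩ := H (κ (s m)) (memT 1 (one_mem _) _ (one_mul _))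
    exact ⟨u, hu, e.symm⟩
  induction hw using Algebra.adjoin_induction with
  | mem x hx =>
    obtain ⟨i, hi, rfl⟩ := hx
    rintro _ ⟨u, hu, rfl⟩
    change s i * (u * κ (s m)) ∈ T
    rw [← mul_assoc]
    rcases Nat.lt_or_ge i m with him | him
    · exact memT (s i * u) (mul_mem (gen_mem_strandAlg (by omega)) hu) _ rfl
    · obtain rfl : i = m := by omega
      exact key u hu
  | algebraMap c =>
    intro u hu
    rw [← Algebra.smul_def]
    exact T.smul_mem _ hu
  | add x y _ _ hx hy => exact fun u hu => add_mul x y u ▸ T.add_mem (hx u hu) (hy u hu)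
  | mul x y _ _ hx hy => exact fun u hu => mul_assoc x y u ▸ hx _ (hy u hu)

/-- The conditional expectation: `κ_{m+1} w κ_{m+1}` is a multiple of `κ_{m+1}` by an element of
the algebra on `m` strands. -/
theorem exists_kappa_mul_kappa (hp : Admissible q μ) {m : ℕ} (hm : m + 2 ≤ n) {w : A}
    (hw : w ∈ strandAlg s (m + 2)) :
    ∃ u ∈ strandAlg s m, κ (s m) * w * κ (s m) = u * κ (s m) := by
  obtain ⟨v, hv, e⟩ := h.exists_mul_kappa hp hm hw
  let T : Submodule ℂ A := (strandAlg s m).toSubmodule.map (LinearMap.mulRight ℂ (κ (s m)))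
  have memT : ∀ u ∈ strandAlg s m, ∀ z, u * κ (s m) = z → z ∈ T := fun u hu z e => ⟨u, hu, e⟩
  suffices H : κ (s m) * v * κ (s m) ∈ T by
    obtain ⟨u, hu, e'⟩ := H
    exact ⟨u, hu, by rw [mul_assoc, e, ← mul_assoc]; exact e'.symm⟩
  refine h.strandAlg_split_aux hm ?_
    (T.comap (LinearMap.mulRight ℂ (κ (s m)) ∘ₗ LinearMap.mulLeft ℂ (κ (s m)))) ?_ ?_ ?_ v hv
  · rintro m' rfl P
    exact h.strandAlg_le_of_split hp (by omega) P
  · intro a ha hc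
    refine memT (eta q μ • a) ( Subalgebra.smul_mem _ ha _) _ ?_
    change eta q μ • a * κ (s m) = κ (s m) * a * κ (s m)
    rw [(commute_kappa_left hc).eq, mul_assoc, h.kappa_sq m (by omega), mul_smul_comm,
      smul_mul_assoc]
  · rintro m' rfl a ha b hb hca hcb
    refine memT (μ⁻¹ • (a * b)) ( Subalgebra.smul_mem _ (mul_mem ha hb) _) _ ?_
    change μ⁻¹ • (a * b) * κ (s (m' + 1)) = κ (s (m' + 1)) * (a * s m' * b) * κ (s (m' + 1))
    have ea := (commute_kappa_left (q := q) (μ := μ) hca).eq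
    have eb := (commute_kappa_left (q := q) (μ := μ) hcb).eq
    rw [smul_mul_assoc, mul_assoc a, ← eb, ← mul_assoc, ← smul_mul_assoc, ← mul_smul_comm,
      ← h.kappa_mul_mul_kappa hp (i := m' + 1) (j := m') (by omega) (by omega) (by omega)]
    simp only [← mul_assoc, ea]
    simp only [mul_assoc, eb]
  · rintro m' rfl a ha b hb hca hcb
    refine memT (a * b) ( mul_mem ha hb) _ ?_
    change (a * b) * κ (s (m' + 1)) = κ (s (m' + 1)) * (a * κ (s m') * b) * κ (s (m' + 1))
    have ea := (commute_kappa_left (q := q) (μ := μ) hca).eq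
    have eb := (commute_kappa_left (q := q) (μ := μ) hcb).eq
    have e1 := h.kappa_mul_kappa_mul_kappa (m' + 1) m' (by omega) (by omega) (by omega)
    rw [mul_assoc a, ← eb, ← mul_assoc]
    conv_lhs => rw [← e1]
    simp only [← mul_assoc, ea]
    simp only [mul_assoc, eb]

end BMWRelations

end StrandAlgebra

/-! ### Closing antisymmetrizers with nested cups and caps; Coxeter elements. -/

section Nested

variable {A : Type*} [Ring A] [Algebra ℂ A] {q μ : ℂ} {n k : ℕ} {s t : ℕ → A}

local notation "κ" => kappa q μ

local notation "𝔞" => antisymmetrizer q μ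

theorem commute_of_mem {x y : A} (h : y ∈ Subalgebra.centralizer ℂ {x}) : Commute x y := by
  simpa [Subalgebra.mem_centralizer_iff, commute_iff_eq] using h

theorem mem_of_commute {x y : A} (h : Commute x y) : y ∈ Subalgebra.centralizer ℂ {x} := by
  simpa [Subalgebra.mem_centralizer_iff] using h.eq

/-- The coefficient in `κ_{i+1} a^{(i+1)} κ_{i+1} ∼ a^{(i)} κ_{i+1}`. -/
def sandwichCoeff (q μ : ℂ) : ℕ → ℂ
  | 0 => eta q μ
  | i + 1 => q ^ (i + 1) / qNumber q (i + 2) *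
    (eta q μ + ((q⁻¹) ^ (2 * (i + 1)) - 1) / (q - q⁻¹) * μ⁻¹ +
      μ * ((q⁻¹) ^ (2 * (i + 1)) - 1) / (μ + q * (q⁻¹) ^ (2 * (i + 1))))

/-- The sum in `sandwichCoeff` factorizes, so that its nonvanishing can be read off factor by
factor. -/
theorem sandwich_aux {q r μ x : ℂ} (hr : q * r = 1) (hl : q - r ≠ 0) (hm : μ ≠ 0)
    (hx : μ + q * x ≠ 0) :
    (q - μ) * (r + μ) / (μ * (q - r)) + (x - 1) / (q - r) * μ⁻¹ + μ * (x - 1) / (μ + q * x) =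
      (x + q * μ) * (q * x - r * μ ^ 2) / ((q - r) * μ * (μ + q * x)) := by
  field_simp
  linear_combination (μ + q * x - μ * x + μ ^ 3) * hr

/-- With `x = q^{-2(i+1)}`, the factor `x + qμ` vanishes exactly when `μ = -q^{1-2(i+2)}`, which
genericity excludes; the factor `qx - q⁻¹μ²` is excluded by `hμ`. -/
theorem sandwichCoeff_ne_zero (hp : Generic q μ k)
    (hμ : ∀ i, i + 2 ≤ k → μ ^ 2 ≠ q ^ 2 * (q⁻¹) ^ (2 * (i + 1))) {i : ℕ} (hi : i + 1 ≤ k) :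
    sandwichCoeff q μ i ≠ 0 := by
  match i with
  | 0 => exact hp.eta_ne_zero
  | i + 1 =>
    have hq := hp.q_ne_zero
    have hqq : q * q⁻¹ = 1 := mul_inv_cancel₀ hq
    have hx := hp.mu_add_ne (i + 1) (by omega) (by omega)
    refine mul_ne_zero (div_ne_zero (pow_ne_zero _ hq)
      (qNumber_ne_zero hp.toAdmissible (hp.q_pow_ne_one _ (by omega) (by omega)))) ?_
    rw [eta, sandwich_aux hqq hp.sub_inv_ne_zero hp.mu_ne_zero hx]
    refine div_ne_zero (mul_ne_zero (fun e => ?_) fun e => hμ i hi ?_)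
      (mul_ne_zero (mul_ne_zero hp.sub_inv_ne_zero hp.mu_ne_zero) hx)
    · refine hp.mu_add_ne (i + 2) (by omega) hi ?_
      have : (q⁻¹) ^ (2 * (i + 2)) = (q⁻¹) ^ (2 * (i + 1)) * (q⁻¹ * q⁻¹) := by ring
      rw [this]
      linear_combination q⁻¹ * e + (-μ + (q⁻¹) ^ (2 * (i + 1)) * q⁻¹) * hqq
    · linear_combination -q * e - μ ^ 2 * hqq

/-- In the recursion for the antisymmetrizer the outer factors commute with `κ`, so only `κ σ⁻(x) κ`
has to be evaluated, and that is a multiple of `κ`. -/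
theorem kappa_mul_antisymmetrizer_mul_kappa (h : BMWRelations q μ n s t) (hp : Generic q μ k)
    {i : ℕ} (hin : i + 2 ≤ n) (hik : i + 1 ≤ k) :
    κ (s i) * 𝔞 s (i + 1) * κ (s i) = sandwichCoeff q μ i • (𝔞 s i * κ (s i)) := by
  match i with
  | 0 => simpa [antisymmetrizer, sandwichCoeff] using h.kappa_sq 0 (by omega)
  | i + 1 =>
    have hc : Commute (𝔞 s (i + 1)) (κ (s (i + 1))) :=
      commute_kappa_right (commute_antisymmetrizer fun j hj =>
        h.commute (by omega) (by omega) (by omega)).symm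
    have hi := antisymmetrizer_idem h hp (i := i + 1) (by omega) (by omega)
    have e : κ (s (i + 1)) * baxterMinus q μ ((q⁻¹) ^ (2 * (i + 1))) (s i) * κ (s (i + 1)) =
        (eta q μ + ((q⁻¹) ^ (2 * (i + 1)) - 1) / (q - q⁻¹) * μ⁻¹ +
          μ * ((q⁻¹) ^ (2 * (i + 1)) - 1) / (μ + q * (q⁻¹) ^ (2 * (i + 1)))) • κ (s (i + 1)) := by
      simp only [baxterMinus, mul_add, add_mul, mul_smul_comm, smul_mul_assoc, mul_one,
        h.kappa_sq (i + 1) (by omega), h.kappa_mul_mul_kappa hp.toAdmissible (i := i + 1) (j := i)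
        (by omega) (by omega) (by omega), h.kappa_mul_kappa_mul_kappa (i + 1) i (by omega)
        (by omega) (by omega)]
      module
    rw [antisymmetrizer_succ, mul_smul_comm, smul_mul_assoc, sandwichCoeff, mul_smul]
    congr 1
    calc _ = 𝔞 s (i + 1) * (κ (s (i + 1)) * baxterMinus q μ ((q⁻¹) ^ (2 * (i + 1))) (s i) *
          κ (s (i + 1))) * 𝔞 s (i + 1) := by
          simp only [← mul_assoc, hc.eq]
          simp only [mul_assoc, hc.eq]
      _ = _ := by
        rw [e, mul_smul_comm, smul_mul_assoc, mul_assoc, ← hc.eq, ← mul_assoc, hi]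

variable (q μ) in
/-- The product `κ_c κ_{c+1} ⋯ κ_{c+i}`. -/
def kappaChain (s : ℕ → A) (c : ℕ) : ℕ → A
  | 0 => kappa q μ (s c)
  | i + 1 => kappaChain s c i * kappa q μ (s (c + (i + 1)))

variable (q μ) in
/-- The product `κ_{c+i} ⋯ κ_{c+1} κ_c`. -/
def kappaChainRev (s : ℕ → A) (c : ℕ) : ℕ → A
  | 0 => kappa q μ (s c)
  | i + 1 => kappa q μ (s (c + (i + 1))) * kappaChainRev s c i

variable (q μ) in
/-- The diagram on the strands `b, …, b + 2i - 1` with nested cups at the top and with caps joining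
adjacent points at the bottom. -/
def nested (s : ℕ → A) (b : ℕ) : ℕ → A
  | 0 => 1
  | i + 1 => kappaChain q μ s (b + i) i * nested s b i

variable (q μ) in
/-- The reflection of `nested` in a horizontal line. -/
def nestedRev (s : ℕ → A) (b : ℕ) : ℕ → A
  | 0 => 1
  | i + 1 => nestedRev s b i * kappaChainRev q μ s (b + i) i

variable (q μ) in
/-- The product `κ_b κ_{b+2} ⋯ κ_{b+2(i-1)}`. -/
def kappaRow (s : ℕ → A) (b : ℕ) : ℕ → A
  | 0 => 1
  | i + 1 => kappaRow s b i * kappa q μ (s (b + 2 * i))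

theorem kappaChain_mem {B : Subalgebra ℂ A} {c : ℕ} :
    ∀ {i : ℕ}, (∀ j, c ≤ j → j ≤ c + i → s j ∈ B) → kappaChain q μ s c i ∈ B
  | 0, h => kappa_mem (h c le_rfl le_rfl)
  | i + 1, h => mul_mem (kappaChain_mem fun j h1 h2 => h j h1 (by omega))
    (kappa_mem (h _ (by omega) le_rfl))

theorem kappaChainRev_mem {B : Subalgebra ℂ A} {c : ℕ} :
    ∀ {i : ℕ}, (∀ j, c ≤ j → j ≤ c + i → s j ∈ B) → kappaChainRev q μ s c i ∈ B
  | 0, h => kappa_mem (h c le_rfl le_rfl)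
  | i + 1, h => mul_mem (kappa_mem (h _ (by omega) le_rfl))
    (kappaChainRev_mem fun j h1 h2 => h j h1 (by omega))

theorem nested_mem {B : Subalgebra ℂ A} {b : ℕ} :
    ∀ {i : ℕ}, (∀ j, b ≤ j → j + 1 < b + 2 * i → s j ∈ B) → nested q μ s b i ∈ B
  | 0, _ => one_mem B
  | i + 1, h => mul_mem (kappaChain_mem fun j h1 h2 => h j (by omega) (by omega))
    (nested_mem fun j h1 h2 => h j h1 (by omega))

theorem nestedRev_mem {B : Subalgebra ℂ A} {b : ℕ} :
    ∀ {i : ℕ}, (∀ j, b ≤ j → j + 1 < b + 2 * i → s j ∈ B) → nestedRev q μ s b i ∈ B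
  | 0, _ => one_mem B
  | i + 1, h => mul_mem (nestedRev_mem fun j h1 h2 => h j h1 (by omega))
    (kappaChainRev_mem fun j h1 h2 => h j (by omega) (by omega))

theorem kappaRow_mem {B : Subalgebra ℂ A} {b : ℕ} :
    ∀ {i : ℕ}, (∀ j, b ≤ j → j + 1 < b + 2 * i → s j ∈ B) → kappaRow q μ s b i ∈ B
  | 0, _ => one_mem B
  | i + 1, h => mul_mem (kappaRow_mem fun j h1 h2 => h j h1 (by omega))
    (kappa_mem (h _ (by omega) (by omega)))

theorem kappaChain_succ_left (s : ℕ → A) (c : ℕ) :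
    ∀ i, kappaChain q μ s c (i + 1) = κ (s c) * kappaChain q μ s (c + 1) i
  | 0 => rfl
  | i + 1 => by
    rw [kappaChain, kappaChain_succ_left s c i, kappaChain, mul_assoc]
    congr 4
    omega

theorem kappaChain_op (hp : Admissible q μ) (s : ℕ → A) (c : ℕ) :
    ∀ i, kappaChain q μ (fun j => MulOpposite.op (s j)) c i =
      MulOpposite.op (kappaChainRev q μ s c i)
  | 0 => kappa_op hp _
  | i + 1 => by simp [kappaChain, kappaChainRev, kappaChain_op hp s c i, kappa_op hp]

theorem nested_op (hp : Admissible q μ) (s : ℕ → A) (b : ℕ) :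
    ∀ i, nested q μ (fun j => MulOpposite.op (s j)) b i = MulOpposite.op (nestedRev q μ s b i)
  | 0 => rfl
  | i + 1 => by simp [nested, nestedRev, nested_op hp s b i, kappaChain_op hp]

section

variable (h : BMWRelations q μ n s t)
include h

theorem commute_kappa_nested {b i j : ℕ} (hj : b + 2 * i ≤ j) (hjn : j + 1 < n) :
    Commute (κ (s j)) (nested q μ s b i) :=
  commute_of_mem <| nested_mem fun l _ h2 => mem_of_commute <|
    commute_kappa_left <| h.commute (by omega) (by omega) (by omega)

theorem commute_kappa_nestedRev {b i j : ℕ} (hj : b + 2 * i ≤ j) (hjn : j + 1 < n) :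
    Commute (κ (s j)) (nestedRev q μ s b i) :=
  commute_of_mem <| nestedRev_mem fun l _ h2 => mem_of_commute <|
    commute_kappa_left <| h.commute (by omega) (by omega) (by omega)

/-- The innermost pair `κ_c ⋯ κ_c` closes the last strand of the antisymmetrizer and produces the
coefficient; each further layer collapses by `κ_{j+1} κ_j κ_{j+1} = κ_{j+1}`. -/
theorem kappaChainRev_mul_antisymmetrizer_mul (hp : Generic q μ k) {c i : ℕ}
    (hn : c + i + 1 < n) (hk : c + 1 ≤ k) :
    kappaChainRev q μ s c i * 𝔞 s (c + 1) * kappaChain q μ s c i =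
      sandwichCoeff q μ c • (𝔞 s c * κ (s (c + i))) := by
  induction i with
  | zero => exact kappa_mul_antisymmetrizer_mul_kappa h hp (by omega) hk
  | succ i ih =>
    have hc : Commute (𝔞 s c) (κ (s (c + (i + 1)))) :=
      commute_kappa_right (commute_antisymmetrizer fun j hj =>
        h.commute (by omega) (by omega) (by omega)).symm
    have ih := ih (by omega)
    calc _ = κ (s (c + (i + 1))) * (kappaChainRev q μ s c i * 𝔞 s (c + 1) *
          kappaChain q μ s c i) * κ (s (c + (i + 1))) := by
          simp only [kappaChain, kappaChainRev, mul_assoc]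
      _ = _ := by
        rw [ih, mul_smul_comm, smul_mul_assoc, ← mul_assoc, ← hc.eq, mul_assoc (𝔞 s c), mul_assoc,
          h.kappa_mul_kappa_mul_kappa (c + (i + 1)) (c + i) (by omega) (by omega) (by omega)]

/-- The nested arcs close the last `i` strands of `a^{(b+i)}` one at a time, each contributing a
coefficient and a `κ` on an adjacent pair. This evaluates both the square and the trace of the
nested sandwich. -/
theorem nestedRev_mul_antisymmetrizer_mul_nested (hp : Generic q μ k) {b i : ℕ}
    (hn : b + 2 * i ≤ n) (hk : b + i ≤ k) :
    nestedRev q μ s b i * 𝔞 s (b + i) * nested q μ s b i =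
      (∏ j ∈ Finset.range i, sandwichCoeff q μ (b + j)) • (𝔞 s b * kappaRow q μ s b i) := by
  induction i with
  | zero => simp [nested, nestedRev, kappaRow]
  | succ i ih =>
    have ih := ih (by omega) (by omega)
    have hc := commute_kappa_nested (q := q) (μ := μ) h (b := b) (i := i) (j := b + i + i)
      (by omega) (by omega)
    calc _ = nestedRev q μ s b i * (kappaChainRev q μ s (b + i) i * 𝔞 s (b + i + 1) *
          kappaChain q μ s (b + i) i) * nested q μ s b i := by
          simp only [nested, nestedRev, mul_assoc, ← add_assoc]
      _ = _ := by
        rw [kappaChainRev_mul_antisymmetrizer_mul h hp (by omega) (by omega), mul_smul_comm,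
          smul_mul_assoc, ← mul_assoc, mul_assoc _ (κ _), hc.eq, ← mul_assoc, ih, smul_mul_assoc,
          Finset.prod_range_succ, mul_comm (∏ j ∈ _, _), mul_smul, kappaRow, mul_assoc,
          show b + i + i = b + 2 * i by omega]

theorem kappa_mul_kappaChainRev {c i : ℕ} (hn : c + i + 1 < n) :
    κ (s (c + i)) * kappaChainRev q μ s c i = eta q μ • kappaChainRev q μ s c i := by
  match i with
  | 0 => exact h.kappa_sq c hn
  | i + 1 => rw [kappaChainRev, ← mul_assoc, h.kappa_sq _ hn, smul_mul_assoc]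

/-- Arcs on adjacent points meet arcs on the same points: `i` closed loops, each worth `η`. -/
theorem kappaRow_mul_nestedRev {b i : ℕ} (hn : b + 2 * i ≤ n) :
    kappaRow q μ s b i * nestedRev q μ s b i = eta q μ ^ i • nestedRev q μ s b i := by
  induction i with
  | zero => simp [nestedRev, kappaRow]
  | succ i ih =>
    have hc := commute_kappa_nestedRev (q := q) (μ := μ) h (b := b) (i := i) (j := b + i + i)
      (by omega) (by omega)
    rw [nestedRev, kappaRow, ← mul_assoc, show b + 2 * i = b + i + i by omega, mul_assoc _ (κ _),
      hc.eq, ← mul_assoc, ih (by omega), mul_assoc, kappa_mul_kappaChainRev h (by omega),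
      mul_smul_comm, smul_mul_assoc, smul_smul, pow_succ, mul_comm]

/-- The diagram `κ_c ⋯ κ_{c+i}` has one cup, one cap and through strands displaced by two places, so
a crossing of through strands slides along them. -/
theorem mul_kappaChain {c i l : ℕ} (hn : c + i + 1 < n) (hl : c ≤ l) (hli : l + 2 ≤ c + i) :
    s (l + 2) * kappaChain q μ s c i = kappaChain q μ s c i * s l := by
  induction i with
  | zero => omega
  | succ i ih =>
    rcases Nat.lt_or_ge (c + i) (l + 2) with hlt | hge
    · obtain ⟨i, rfl⟩ : ∃ j, i = j + 1 := ⟨i - 1, by omega⟩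
      obtain rfl : l = c + i := by omega
      have h1 : Commute (s (c + i + 2)) (kappaChain q μ s c i) :=
        commute_of_mem <| kappaChain_mem fun j _ h2 => mem_of_commute <|
          h.commute (by omega) (by omega) (by omega)
      have h2 : kappaChain q μ s c i * κ (s (c + (i + 1))) * s (c + i) =
          kappaChain q μ s c i * t (c + (i + 1)) := by
        have := h.kappa_mul_neg (c + i) (c + (i + 1)) (by omega) (by omega) (by omega)
        match i with
        | 0 => exact this.symm
        | i + 1 =>
          rw [kappaChain, mul_assoc, mul_assoc, mul_assoc, this, mul_assoc]
      have h3 : Commute (κ (s (c + i + 2))) (s (c + i)) :=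
        commute_kappa_left (h.commute (by omega) (by omega) (by omega))
      have h4 := h.mul_mul_kappa_mul_kappa (i := c + i + 2) (j := c + (i + 1)) (by omega)
        (by omega) (by omega)
      simp only [kappaChain]
      rw [show c + (i + 1 + 1) = c + i + 2 by omega, mul_assoc _ _ (s _), h3.eq, ← mul_assoc _ (s _),
        h2, ← mul_assoc, ← mul_assoc, h1.eq, mul_assoc, mul_assoc, ← mul_assoc (s _), h4, mul_assoc]
    · have h3 : Commute (κ (s (c + (i + 1)))) (s l) :=
        commute_kappa_left (h.commute (by omega) (by omega) (by omega))
      rw [kappaChain, ← mul_assoc, ih (by omega) (by omega), mul_assoc, mul_assoc, h3.eq]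

/-- The two innermost cups, where sliding through a chain does not apply. Here `s_{c+1} κ_c κ_{c+1}
= s_c⁻¹ κ_{c+1}` and `s_{c-1} κ_c κ_{c-1} = s_c⁻¹ κ_{c-1}`, so both sides are brought to a word
starting with `s_c⁻¹`. -/
theorem mul_nested_one {b i : ℕ} (hn : b + 2 * (i + 2) ≤ n) :
    s (b + (i + 1) + 1) * nested q μ s b (i + 2) = s (b + i) * nested q μ s b (i + 2) := by
  set c := b + (i + 1) with hc
  have e1 : s (c + 1) * κ (s c) * kappaChain q μ s (c + 1) i =
      t c * kappaChain q μ s (c + 1) i := by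
    have h1 := h.mul_mul_kappa_mul_kappa (i := c + 1) (j := c) (by omega) (by omega) (by omega)
    match i with
    | 0 => exact h1
    | i + 1 => rw [kappaChain_succ_left, ← mul_assoc, h1, mul_assoc]
  have e2 : s (b + i) * κ (s c) * kappaChain q μ s (b + i) i =
      t c * kappaChain q μ s (b + i) i := by
    have h1 := h.mul_mul_kappa_mul_kappa (i := b + i) (j := c) (by omega) (by omega) (by omega)
    match i with
    | 0 => exact h1
    | i + 1 => rw [kappaChain_succ_left, ← mul_assoc, h1, mul_assoc]
  have e3 : kappaChain q μ s (c + 1) i * κ (s (b + i)) = κ (s (b + i)) * kappaChain q μ s (c + 1) i :=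
    (commute_of_mem <| kappaChain_mem fun j h1 h2 => mem_of_commute <|
      commute_kappa_left <| h.commute (by omega) (by omega) (by omega)).symm.eq
  have e4 : s (b + i) * κ (s c) * κ (s (b + i)) = t c * κ (s (b + i)) :=
    h.mul_mul_kappa_mul_kappa (by omega) (by omega) (by omega)
  obtain ⟨Y, hY⟩ : ∃ Y, kappaChain q μ s (b + i) i = κ (s (b + i)) * Y := by
    match i with
    | 0 => exact ⟨1, (mul_one _).symm⟩
    | i + 1 => exact ⟨_, kappaChain_succ_left _ _ _⟩
  rw [nested, ← hc, kappaChain_succ_left, nested, hY]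
  calc _ = s (c + 1) * κ (s c) * kappaChain q μ s (c + 1) i * (κ (s (b + i)) * Y) *
        nested q μ s b i := by simp only [mul_assoc]
    _ = t c * (kappaChain q μ s (c + 1) i * κ (s (b + i))) * Y * nested q μ s b i := by
      rw [e1]; simp only [mul_assoc]
    _ = (s (b + i) * κ (s c) * κ (s (b + i))) * kappaChain q μ s (c + 1) i * Y *
        nested q μ s b i := by rw [e3, e4]; simp only [mul_assoc]
    _ = s (b + i) * κ (s c) * (κ (s (b + i)) * kappaChain q μ s (c + 1) i) * Y *
        nested q μ s b i := by simp only [mul_assoc]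
    _ = _ := by rw [← e3]; simp only [mul_assoc]

/-- Sliding a generator along nested cups. -/
theorem mul_nested {b i j : ℕ} (hn : b + 2 * i ≤ n) (hj : 1 ≤ j) (hji : j < i) :
    s (b + i - 1 + j) * nested q μ s b i = s (b + i - 1 - j) * nested q μ s b i := by
  induction i generalizing j with
  | zero => omega
  | succ i ih =>
    rcases Nat.lt_or_ge 1 j with h1 | h1
    -- Passing the chain that carries the newest cup lowers the index by two, which is the same
    -- situation with one cup less and `j - 1`.
    · have ih := ih (j := j - 1) (by omega) (by omega) (by omega)
      have e1 := mul_kappaChain h (q := q) (μ := μ) (c := b + i) (i := i) (l := b + i + j - 2)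
        (by omega) (by omega) (by omega)
      have e2 : Commute (s (b + i - j)) (kappaChain q μ s (b + i) i) :=
        commute_of_mem <| kappaChain_mem fun l h1 h2 => mem_of_commute <|
          h.commute (by omega) (by omega) (by omega)
      rw [show b + (i + 1) - 1 + j = b + i + j - 2 + 2 by omega,
        show b + (i + 1) - 1 - j = b + i - j by omega, nested, ← mul_assoc, e1, mul_assoc,
        ← mul_assoc _ (kappaChain q μ s (b + i) i), e2.eq, mul_assoc,
        show b + i + j - 2 = b + i - 1 + (j - 1) by omega, ih,
        show b + i - 1 - (j - 1) = b + i - j by omega]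
    · obtain rfl : j = 1 := by omega
      obtain ⟨i, rfl⟩ : ∃ l, i = l + 1 := ⟨i - 1, by omega⟩
      have := mul_nested_one h (q := q) (μ := μ) (b := b) (i := i) hn
      rw [show b + (i + 1 + 1) - 1 + 1 = b + (i + 1) + 1 by omega,
        show b + (i + 1 + 1) - 1 - 1 = b + i by omega]
      exact this

theorem nestedRev_mul (hp : Admissible q μ) {b i j : ℕ} (hn : b + 2 * i ≤ n) (hj : 1 ≤ j)
    (hji : j < i) :
    nestedRev q μ s b i * s (b + i - 1 + j) = nestedRev q μ s b i * s (b + i - 1 - j) := by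
  have := mul_nested (h.op hp) hn hj hji
  rw [nested_op hp] at this
  exact MulOpposite.op_injective (by simpa using this)

end

/-- The product `σ_1 σ_2 ⋯ σ_m`. -/
def coxeter (s : ℕ → A) : ℕ → A
  | 0 => 1
  | m + 1 => coxeter s m * s m

theorem coxeter_mem {B : Subalgebra ℂ A} : ∀ {m : ℕ}, (∀ j < m, s j ∈ B) → coxeter s m ∈ B
  | 0, _ => one_mem B
  | m + 1, h => mul_mem (coxeter_mem fun j hj => h j (by omega)) (h m (by omega))

theorem coxeter_succ_left (s : ℕ → A) :
    ∀ m, coxeter s (m + 1) = s 0 * coxeter (fun j => s (1 + j)) m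
  | 0 => by simp [coxeter]
  | m + 1 => by
    rw [coxeter, coxeter_succ_left s m, coxeter, mul_assoc, add_comm 1 m]

section

variable (h : BMWRelations q μ n s t)
include h

theorem coxeter_mul {m j : ℕ} (hm : m < n) (hj : j + 1 < m) :
    coxeter s m * s j = s (j + 1) * coxeter s m := by
  induction m with
  | zero => omega
  | succ m ih =>
    rcases Nat.lt_or_ge (j + 1) m with hlt | hge
    · rw [coxeter, mul_assoc, (h.commute (i := m) (j := j) (by omega) (by omega) (by omega)).eq,
        ← mul_assoc, ih (by omega) hlt, mul_assoc]
    · obtain rfl : m = j + 1 := by omega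
      have hc : Commute (s (j + 1)) (coxeter s j) :=
        commute_of_mem <| coxeter_mem fun l hl => mem_of_commute <|
          h.commute (by omega) (by omega) (by omega)
      simp only [coxeter]
      rw [mul_assoc, mul_assoc, ← mul_assoc (s j), h.braid j (by omega), ← mul_assoc (s (j + 1)),
        ← mul_assoc (s (j + 1)), hc.eq]
      simp only [mul_assoc]

theorem coxeter_mul_coxeter {m l : ℕ} (hm : m < n) (hl : l < m) :
    coxeter s m * coxeter s l = coxeter (fun j => s (1 + j)) l * coxeter s m := by
  induction l with
  | zero => simp [coxeter]
  | succ l ih =>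
    rw [coxeter, coxeter, ← mul_assoc, ih (by omega), mul_assoc, coxeter_mul h hm hl, mul_assoc,
      add_comm 1 l]

/-- Conjugation by the Coxeter element shifts generators by one; its square carries the last
generator around to the first. This exchanges a pair of strands with the remaining block in
`commute_contraction_elemSum`. -/
theorem coxeter_sq_mul {m : ℕ} (hm : m + 1 < n) :
    coxeter s (m + 1) * coxeter s (m + 1) * s m =
      s 0 * (coxeter s (m + 1) * coxeter s (m + 1)) := by
  have e : coxeter s (m + 1) * coxeter s (m + 1) =
      coxeter (fun j => s (1 + j)) m * coxeter s (m + 1) * s m := by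
    conv_lhs => enter [2]; rw [coxeter]
    rw [← mul_assoc, coxeter_mul_coxeter h hm (Nat.lt_succ_self m)]
  conv_rhs => rw [e, ← mul_assoc, ← mul_assoc, ← coxeter_succ_left]

end

theorem semiconjBy_kappa {v x y : A} (h : SemiconjBy v x y) : SemiconjBy v (κ x) (κ y) := by
  unfold kappa SemiconjBy
  have hc (c : ℂ) : SemiconjBy v (algebraMap ℂ A c) (algebraMap ℂ A c) :=
    (Algebra.commutes c v).symm
  have := ((hc q).sub_right h).mul_right ((hc q⁻¹).add_right h)
  rw [mul_smul_comm, smul_mul_assoc, this.eq]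

theorem semiconjBy_antisymmetrizer {v : A} {s s' : ℕ → A} :
    ∀ {i : ℕ}, (∀ j, j + 1 < i → SemiconjBy v (s j) (s' j)) → SemiconjBy v (𝔞 s i) (𝔞 s' i)
  | 0, _ => SemiconjBy.one_right v
  | 1, _ => SemiconjBy.one_right v
  | i + 2, h => by
    have h1 := semiconjBy_antisymmetrizer (i := i + 1) fun j hj => h j (by omega)
    have h2 := h i (by omega)
    have h3 := semiconjBy_kappa (q := q) (μ := μ) h2
    have hs {x y : A} (c : ℂ) (hx : SemiconjBy v x y) : SemiconjBy v (c • x) (c • y) := by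
      rw [SemiconjBy, mul_smul_comm, smul_mul_assoc, hx.eq]
    exact hs _ ((h1.mul_right (((SemiconjBy.one_right v).add_right (hs _ h2)).add_right
      (hs _ h3))).mul_right h1)

end Nested

/-! ### Operators acting in chosen tensor factors. -/

section Embedding

variable {N : ℕ} {A : Type*} [Ring A] [Algebra ℂ A] {r n m : ℕ}

/-- The multi-index `I` with the entries in the positions `e` replaced by `K`. -/
def override (e : Fin r ↪ Fin n) (K : Fin r → Fin N) (I : Fin n → Fin N) : Fin n → Fin N :=
  Function.extend e K I

theorem override_comp (e : Fin r ↪ Fin n) (K : Fin r → Fin N) (I : Fin n → Fin N) :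
    override e K I ∘ e = K :=
  funext fun i => e.injective.extend_apply K I i

theorem override_apply (e : Fin r ↪ Fin n) (K : Fin r → Fin N) (I : Fin n → Fin N) (i : Fin r) :
    override e K I (e i) = K i := e.injective.extend_apply K I i

theorem override_of_notMem (e : Fin r ↪ Fin n) (K : Fin r → Fin N) (I : Fin n → Fin N) {j : Fin n}
    (hj : ¬∃ i, e i = j) : override e K I j = I j := Function.extend_apply' K I j hj

/-- Two multi-indices agree outside the positions `e`. -/
abbrev AgreeOff (e : Fin r ↪ Fin n) (I J : Fin n → Fin N) : Prop :=
  ∀ j, (∃ i, e i = j) ∨ I j = J j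

theorem agreeOff_override (e : Fin r ↪ Fin n) (K : Fin r → Fin N) (I J : Fin n → Fin N) :
    AgreeOff e (override e K I) J ↔ AgreeOff e I J := by
  refine forall_congr' fun j => ?_
  by_cases hj : ∃ i, e i = j
  · simp [hj]
  · simp [hj, override_of_notMem e K I hj]

theorem AgreeOff.symm {e : Fin r ↪ Fin n} {I J : Fin n → Fin N} (h : AgreeOff e I J) :
    AgreeOff e J I := fun j => (h j).imp id Eq.symm

theorem AgreeOff.override_eq {e : Fin r ↪ Fin n} {I J : Fin n → Fin N} (h : AgreeOff e I J) :
    override e (J ∘ e) I = J := by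
  funext j
  by_cases hj : ∃ i, e i = j
  · obtain ⟨i, rfl⟩ := hj
    exact override_apply e _ I i
  · rw [override_of_notMem e _ I hj]
    exact (h j).resolve_left hj

theorem AgreeOff.ext {e : Fin r ↪ Fin n} {I J : Fin n → Fin N} (h : AgreeOff e I J)
    (h' : I ∘ e = J ∘ e) : I = J := by
  rw [← h.override_eq, ← h', AgreeOff.override_eq fun j => Or.inr rfl]

theorem sum_agreeOff {M : Type*} [AddCommMonoid M] (e : Fin r ↪ Fin n) (I : Fin n → Fin N)
    (f : (Fin n → Fin N) → M) (hf : ∀ K, ¬AgreeOff e I K → f K = 0) :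
    ∑ K, f K = ∑ K, f (override e K I) := by
  symm
  refine Finset.sum_of_injOn (fun K => override e K I) ?_
    (fun _ _ => Finset.mem_coe.2 (Finset.mem_univ _)) ?_ (fun _ _ => rfl)
  · intro K _ K' _ h
    have := congrArg (· ∘ e) h
    simpa only [override_comp] using this
  · intro K _ hK
    refine hf K fun h => hK ⟨K ∘ e, Finset.mem_coe.2 (Finset.mem_univ _), h.override_eq⟩

/-- The operator on `V^{⊗ n}` acting as `X` in the factors in the positions `e`. -/
def embFun (e : Fin r ↪ Fin n) (X : Op N r A) : Op N n A :=
  fun I J => if AgreeOff e I J then X (I ∘ e) (J ∘ e) else 0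

theorem embFun_mul_apply (e : Fin r ↪ Fin n) (X : Op N r A) (Y : Op N n A) (I J : Fin n → Fin N) :
    (embFun e X * Y) I J = ∑ K, X (I ∘ e) K * Y (override e K I) J := by
  rw [Matrix.mul_apply, sum_agreeOff e I]
  · refine Finset.sum_congr rfl fun K _ => ?_
    rw [embFun, if_pos, override_comp]
    exact ((agreeOff_override e K I I).2 fun j => Or.inr rfl).symm
  · intro K hK
    rw [embFun, if_neg hK, zero_mul]

theorem mul_embFun_apply (e : Fin r ↪ Fin n) (X : Op N r A) (Y : Op N n A) (I J : Fin n → Fin N) :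
    (Y * embFun e X) I J = ∑ K, Y I (override e K J) * X K (J ∘ e) := by
  rw [Matrix.mul_apply, sum_agreeOff e J]
  · refine Finset.sum_congr rfl fun K _ => ?_
    rw [embFun, if_pos, override_comp]
    exact (agreeOff_override e K J J).2 fun j => Or.inr rfl
  · intro K hK
    rw [embFun, if_neg fun h => hK h.symm, mul_zero]

theorem embFun_mul (e : Fin r ↪ Fin n) (X Y : Op N r A) :
    embFun e (X * Y) = embFun e X * embFun e Y := by
  ext I J
  rw [embFun_mul_apply]
  simp only [embFun, agreeOff_override, override_comp]
  split_ifs with h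
  · rw [Matrix.mul_apply]
  · simp

theorem embFun_one (e : Fin r ↪ Fin n) : embFun e (1 : Op N r A) = 1 := by
  ext I J
  by_cases h : I = J
  · subst h
    rw [embFun, if_pos fun j => Or.inr rfl, Matrix.one_apply_eq, Matrix.one_apply_eq]
  · rw [Matrix.one_apply_ne h, embFun]
    split_ifs with h'
    · exact Matrix.one_apply_ne fun h'' => h (h'.ext h'')
    · rfl

/-- The homomorphism from the operators on `V^{⊗ r}` to the operators on `V^{⊗ n}` acting in the
factors in the positions `e`. -/
def embOp (e : Fin r ↪ Fin n) : Op N r A →ₐ[ℂ] Op N n A :=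
  AlgHom.ofLinearMap
    { toFun := embFun e
      map_add' := fun X Y => by
        ext I J
        simp only [embFun, Matrix.add_apply]
        split_ifs <;> simp
      map_smul' := fun c X => by
        ext I J
        simp only [embFun, Matrix.smul_apply, RingHom.id_apply]
        split_ifs <;> simp }
    (embFun_one e) (embFun_mul e)

theorem embOp_apply (e : Fin r ↪ Fin n) (X : Op N r A) (I J : Fin n → Fin N) :
    embOp e X I J = if AgreeOff e I J then X (I ∘ e) (J ∘ e) else 0 := rfl

theorem embOp_embOp (f : Fin m ↪ Fin r) (e : Fin r ↪ Fin n) (X : Op N m A) :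
    embOp e (embOp f X) = embOp (f.trans e) X := by
  ext I J
  simp only [embOp_apply]
  have : AgreeOff (f.trans e) I J ↔ AgreeOff e I J ∧ AgreeOff f (I ∘ e) (J ∘ e) := by
    constructor
    · intro h
      refine ⟨fun j => (h j).imp (fun ⟨i, hi⟩ => ⟨f i, hi⟩) id, fun j => ?_⟩
      refine (h (e j)).imp (fun ⟨i, hi⟩ => ⟨i, e.injective hi⟩) id
    · rintro ⟨h1, h2⟩ j
      rcases h1 j with ⟨i, rfl⟩ | h
      · exact (h2 i).imp (fun ⟨l, hl⟩ => ⟨l, by simp [hl]⟩) id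
      · exact Or.inr h
  by_cases h1 : AgreeOff e I J
  · rw [if_pos h1]
    by_cases h2 : AgreeOff f (I ∘ e) (J ∘ e)
    · rw [if_pos h2, if_pos (this.2 ⟨h1, h2⟩)]
      rfl
    · rw [if_neg h2, if_neg fun h => h2 (this.1 h).2]
  · rw [if_neg h1, if_neg fun h => h1 (this.1 h).1]

/-- Operators acting in disjoint sets of factors. -/
theorem embOp_mul_embOp_apply (e : Fin r ↪ Fin n) (f : Fin m ↪ Fin n) (hd : ∀ i j, e i ≠ f j)
    (X : Op N r A) (Y : Op N m A) (I J : Fin n → Fin N) :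
    (embOp e X * embOp f Y) I J =
      if ∀ l, (∃ i, e i = l) ∨ (∃ i, f i = l) ∨ I l = J l then
        X (I ∘ e) (J ∘ e) * Y (I ∘ f) (J ∘ f) else 0 := by
  have h0 : (embOp e X * embOp f Y) I J = ∑ K, X (I ∘ e) K * embOp f Y (override e K I) J :=
    embFun_mul_apply e X (embOp f Y) I J
  have hI : ∀ K, override e K I ∘ f = I ∘ f := fun K => funext fun j =>
    override_of_notMem e K I fun ⟨i, hi⟩ => hd i j hi
  rw [h0, Finset.sum_eq_single (J ∘ e)]
  · rw [embOp_apply, hI]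
    have : AgreeOff f (override e (J ∘ e) I) J ↔
        ∀ l, (∃ i, e i = l) ∨ (∃ i, f i = l) ∨ I l = J l := by
      refine forall_congr' fun l => ?_
      by_cases hl : ∃ i, e i = l
      · obtain ⟨i, rfl⟩ := hl
        simp [override_apply]
      · simp [hl, override_of_notMem e _ I hl]
    simp only [this, mul_ite, mul_zero]
  · intro K _ hK
    rw [embOp_apply, if_neg, mul_zero]
    intro h
    apply hK
    funext i
    rcases h (e i) with ⟨j, hj⟩ | h
    · exact absurd hj.symm (hd i j)
    · rwa [override_apply] at h
  · simp

theorem scalarOp_mul (X Y : Op N n ℂ) : scalarOp A (X * Y) = scalarOp A X * scalarOp A Y :=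
  Matrix.map_mul

theorem scalarOp_one : scalarOp A (1 : Op N n ℂ) = 1 :=
  Matrix.map_one _ (map_zero _) (map_one _)

theorem scalarOp_add (X Y : Op N n ℂ) : scalarOp A (X + Y) = scalarOp A X + scalarOp A Y :=
  Matrix.map_add _ (map_add _) X Y

theorem scalarOp_smul (c : ℂ) (X : Op N n ℂ) : scalarOp A (c • X) = c • scalarOp A X := by
  ext I J
  rw [Matrix.smul_apply, scalarOp, scalarOp, Matrix.map_apply, Matrix.map_apply, Matrix.smul_apply,
    smul_eq_mul, map_mul, ← Algebra.smul_def]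

theorem embOp_scalarOp (e : Fin r ↪ Fin n) (X : Op N r ℂ) :
    embOp e (scalarOp A X) = scalarOp A (embOp e X) := by
  ext I J
  simp only [embOp_apply, scalarOp, Matrix.map_apply]
  split_ifs <;> simp

/-- Disjoint positions alone do not suffice over a noncommutative `A`; one of the two operators is
numerical, so its entries are central. -/
theorem commute_embOp (e : Fin r ↪ Fin n) (f : Fin m ↪ Fin n) (hd : ∀ i j, e i ≠ f j)
    (X : Op N r A) (Y : Op N m ℂ) : Commute (embOp e X) (embOp f (scalarOp A Y)) := by
  ext I J
  rw [embOp_mul_embOp_apply e f hd, embOp_mul_embOp_apply f e fun i j => (hd j i).symm]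
  have : (∀ l, (∃ i, e i = l) ∨ (∃ i, f i = l) ∨ I l = J l) ↔
      ∀ l, (∃ i, f i = l) ∨ (∃ i, e i = l) ∨ I l = J l :=
    forall_congr' fun l => or_left_comm
  simp only [this]
  split_ifs
  · exact (Algebra.commutes _ _).symm
  · rfl

/-- The positions `c, c + 1, …, c + r - 1`. -/
def window {r n : ℕ} (c : ℕ) (h : c + r ≤ n) : Fin r ↪ Fin n :=
  ⟨fun i => ⟨c + i, by omega⟩, fun i j hij => by
    simp only [Fin.mk.injEq] at hij; exact Fin.ext (by omega)⟩

theorem window_apply (c : ℕ) (h : c + r ≤ n) (i : Fin r) :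
    window c h i = ⟨c + i, by omega⟩ := rfl

theorem mem_window (c : ℕ) (h : c + r ≤ n) (j : Fin n) :
    (∃ i, window c h i = j) ↔ c ≤ j ∧ (j : ℕ) < c + r := by
  constructor
  · rintro ⟨i, rfl⟩
    simp [window_apply]
  · rintro ⟨h1, h2⟩
    exact ⟨⟨j - c, by omega⟩, Fin.ext (by simp [window_apply]; omega)⟩

theorem embOp_twoSite (c : ℕ) (h : c + r ≤ n) {i : ℕ} (hi : i + 1 < r) (T : Op₂ N) :
    embOp (window c h) (twoSite r i T) = twoSite n (c + i) T := by
  ext I J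
  rw [embOp_apply, twoSite, twoSite, dif_pos hi, dif_pos (by omega : c + i + 1 < n)]
  have : (∀ m : Fin n, (m : ℕ) ≠ c + i → (m : ℕ) ≠ c + i + 1 → I m = J m) ↔
      AgreeOff (window c h) I J ∧ ∀ m : Fin r, (m : ℕ) ≠ i → (m : ℕ) ≠ i + 1 →
        (I ∘ window c h) m = (J ∘ window c h) m := by
    constructor
    · intro hm
      refine ⟨fun j => ?_, fun m h1 h2 => ?_⟩
      · rw [mem_window]
        by_cases hj : c ≤ j ∧ (j : ℕ) < c + r
        · exact Or.inl hj
        · exact Or.inr (hm j (by omega) (by omega))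
      · exact hm _ (by simp [window_apply]; omega) (by simp [window_apply]; omega)
    · rintro ⟨h1, h2⟩ m hm1 hm2
      rcases h1 m with ⟨j, rfl⟩ | h
      · simp only [window_apply] at hm1 hm2
        exact h2 j (by omega) (by omega)
      · exact h
  by_cases h1 : AgreeOff (window c h) I J
  · rw [if_pos h1]
    exact if_congr (this.trans (and_iff_right h1)).symm rfl rfl
  · rw [if_neg h1, if_neg fun h2 => h1 (this.1 h2).1]

theorem embOp_oneSite (h : 0 + r ≤ n) (hr : 0 < r) (X : Matrix (Fin N) (Fin N) A) :
    embOp (window 0 h) (oneSite r X) = oneSite n X := by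
  ext I J
  rw [embOp_apply, oneSite, oneSite, dif_pos hr, dif_pos (by omega : 0 < n)]
  have : (∀ m : Fin n, (m : ℕ) ≠ 0 → I m = J m) ↔
      AgreeOff (window 0 h) I J ∧ ∀ m : Fin r, (m : ℕ) ≠ 0 →
        (I ∘ window 0 h) m = (J ∘ window 0 h) m := by
    constructor
    · intro hm
      refine ⟨fun j => ?_, fun m h1 => ?_⟩
      · rw [mem_window]
        by_cases hj : 0 ≤ (j : ℕ) ∧ (j : ℕ) < 0 + r
        · exact Or.inl hj
        · exact Or.inr (hm j (by omega))
      · exact hm _ (by simp [window_apply]; omega)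
    · rintro ⟨h1, h2⟩ m hm1
      rcases h1 m with ⟨j, rfl⟩ | h
      · simp only [window_apply] at hm1
        exact h2 j (by omega)
      · exact h
  by_cases h1 : AgreeOff (window 0 h) I J
  · rw [if_pos h1]
    exact if_congr (this.trans (and_iff_right h1)).symm rfl rfl
  · rw [if_neg h1, if_neg fun h2 => h1 (this.1 h2).1]

theorem twoSite_two (T : Op₂ N) :
    twoSite 2 0 T = T.submatrix (finTwoArrowEquiv (Fin N)) (finTwoArrowEquiv (Fin N)) := by
  ext I J
  rw [twoSite, dif_pos (by omega), if_pos]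
  · rfl
  · intro m; fin_cases m <;> simp

theorem twoSite_mul {i : ℕ} (hi : i + 1 < n) (S T : Op₂ N) :
    twoSite n i S * twoSite n i T = twoSite n i (S * T) := by
  have h2 : twoSite 2 0 S * twoSite 2 0 T = twoSite 2 0 (S * T) := by
    simp only [twoSite_two]
    exact Matrix.submatrix_mul_equiv _ _ _ _ _
  simpa only [map_mul, embOp_twoSite (r := 2) i (by omega : i + 2 ≤ n) (i := 0) (by omega),
    add_zero]
    using congrArg (embOp (window i (by omega : i + 2 ≤ n))) h2

theorem twoSite_one {i : ℕ} (hi : i + 1 < n) : twoSite n i (1 : Op₂ N) = 1 := by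
  have h2 : twoSite 2 0 (1 : Op₂ N) = 1 := by
    simp only [twoSite_two]
    exact Matrix.submatrix_one_equiv _
  simpa only [map_one, embOp_twoSite (r := 2) i (by omega : i + 2 ≤ n) (i := 0) (by omega),
    add_zero]
    using congrArg (embOp (window i (by omega : i + 2 ≤ n))) h2

theorem twoSite_mul_inv {i : ℕ} (hi : i + 1 < n) (F : Aut₂ N) :
    twoSite n i (F : Op₂ N) * twoSite n i ((F⁻¹ : Aut₂ N) : Op₂ N) = 1 := by
  rw [twoSite_mul hi, Units.mul_inv, twoSite_one hi]

theorem twoSite_inv_mul {i : ℕ} (hi : i + 1 < n) (F : Aut₂ N) :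
    twoSite n i ((F⁻¹ : Aut₂ N) : Op₂ N) * twoSite n i (F : Op₂ N) = 1 := by
  rw [twoSite_mul hi, Units.inv_mul, twoSite_one hi]

/-- Operators on the first factors commute with numerical operators on the remaining ones. -/
theorem commute_embOp_twoSite (h : 0 + r ≤ n) {i : ℕ} (hri : r ≤ i) (hi : i + 1 < n)
    (X : Op N r A) (T : Op₂ N) : Commute (embOp (window 0 h) X) (scalarOp A (twoSite n i T)) := by
  have := commute_embOp (window 0 h) (window (r := 2) i (by omega : i + 2 ≤ n))
    (fun a b => by simp [window_apply, Fin.ext_iff]; omega) X (twoSite 2 0 T)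
  rwa [embOp_scalarOp, embOp_twoSite i (by omega : i + 2 ≤ n) (by omega)] at this

theorem commute_twoSite {i j : ℕ} (hi : i + 1 < n) (hj : j + 1 < n) (hij : i + 1 < j ∨ j + 1 < i)
    (S T : Op₂ N) : Commute (twoSite n i S) (twoSite n j T) := by
  have := commute_embOp (A := ℂ) (window (r := 2) i (by omega : i + 2 ≤ n))
    (window (r := 2) j (by omega : j + 2 ≤ n))
    (fun a b => by simp [window_apply, Fin.ext_iff]; omega) (twoSite 2 0 S) (twoSite 2 0 T)
  rw [embOp_scalarOp, embOp_twoSite i (by omega : i + 2 ≤ n) (by omega),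
    embOp_twoSite j (by omega : j + 2 ≤ n) (by omega)] at this
  simpa [scalarOp] using this

/-- Transports the cubic relations on `V^{⊗ 3}` (braid and twist relations) to any three consecutive
factors. -/
theorem relation_of_three {i : ℕ} (hi : i + 2 < n) {S T U S' T' U' : Op₂ N} {a b c a' b' c' : ℕ}
    (ha : a < 2) (hb : b < 2) (hc : c < 2) (ha' : a' < 2) (hb' : b' < 2) (hc' : c' < 2)
    (h : twoSite 3 a S * twoSite 3 b T * twoSite 3 c U =
      twoSite 3 a' S' * twoSite 3 b' T' * twoSite 3 c' U') :
    twoSite n (i + a) S * twoSite n (i + b) T * twoSite n (i + c) U =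
      twoSite n (i + a') S' * twoSite n (i + b') T' * twoSite n (i + c') U' := by
  have := congrArg (embOp (window i (by omega : i + 3 ≤ n))) h
  simpa only [map_mul, embOp_twoSite i (by omega : i + 3 ≤ n) (show a + 1 < 3 by omega),
    embOp_twoSite i (by omega : i + 3 ≤ n) (show b + 1 < 3 by omega),
    embOp_twoSite i (by omega : i + 3 ≤ n) (show c + 1 < 3 by omega),
    embOp_twoSite i (by omega : i + 3 ≤ n) (show a' + 1 < 3 by omega),
    embOp_twoSite i (by omega : i + 3 ≤ n) (show b' + 1 < 3 by omega),
    embOp_twoSite i (by omega : i + 3 ≤ n) (show c' + 1 < 3 by omega)] using this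

end Embedding

/-! ### Copies of a matrix shifted by the twist `F`. -/

section Copies

variable {N : ℕ} {A : Type*} [Ring A] [Algebra ℂ A] {r n : ℕ} (F : Aut₂ N)
  (X : Matrix (Fin N) (Fin N) A)

theorem embOp_copy (h : 0 + r ≤ n) {i : ℕ} (hi : i < r) :
    embOp (window 0 h) (copy F X r i) = copy F X n i := by
  induction i with
  | zero => exact embOp_oneSite h hi X
  | succ i ih =>
    rw [copy, copy, map_mul, map_mul, embOp_scalarOp, embOp_scalarOp, ih (by omega),
      embOp_twoSite 0 h hi, embOp_twoSite 0 h hi, zero_add]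

theorem map_copy {B : Type*} [Ring B] [Algebra ℂ B] (φ : A →ₐ[ℂ] B) (i : ℕ) :
    (copy F X n i).map φ = copy F (X.map φ) n i := by
  have hs (T : Op N n ℂ) : (scalarOp A T).map φ = scalarOp B T := by
    ext I J; simp [scalarOp]
  induction i with
  | zero =>
    ext I J
    simp only [copy, oneSite, Matrix.map_apply]
    split_ifs <;> simp
  | succ i ih =>
    rw [copy, copy, ← ih, Matrix.map_mul, Matrix.map_mul, hs, hs]

theorem commute_copy_of_lt {i j : ℕ} (hi : i + 1 < n) (hj : j < i) (T : Op₂ N) :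
    Commute (copy F X n j) (scalarOp A (twoSite n i T)) := by
  rw [← embOp_copy F X (by omega : 0 + i ≤ n) hj]
  exact commute_embOp_twoSite _ le_rfl hi _ T

variable {F}

/-- Numerical operators compatible with `F` commute with the distant copies. -/
theorem commute_copy {G : Op₂ N} (hG : twoSite 3 0 G * twoSite 3 1 (F : Op₂ N) *
      twoSite 3 0 (F : Op₂ N) = twoSite 3 1 (F : Op₂ N) * twoSite 3 0 (F : Op₂ N) *
      twoSite 3 1 G) {i j : ℕ} (hi : i + 1 < n) (hj : j < n) (hij : j < i ∨ i + 1 < j) :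
    Commute (scalarOp A (twoSite n i G)) (copy F X n j) := by
  rcases hij with hij | hij
  · exact (commute_copy_of_lt F X hi hij G).symm
  induction j with
  | zero => omega
  | succ j ih =>
    rcases Nat.lt_or_ge (i + 1) j with hlt | hge
    · have h1 (T : Op₂ N) : Commute (scalarOp A (twoSite n i G)) (scalarOp A (twoSite n j T)) := by
        rw [Commute, SemiconjBy, ← scalarOp_mul, ← scalarOp_mul,
          (commute_twoSite hi (by omega) (by omega) G T).eq]
      exact ((h1 _).mul_right (ih (by omega) hlt)).mul_right (h1 _)
    -- The copy in question is `F_{i+1} F_i X F_i⁻¹ F_{i+1}⁻¹` with `X` the copy of index `i`.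
    -- Conjugation by `F_{i+1} F_i` carries `G_{i+1}`, which commutes with `X`, to `G_i`.
    · obtain rfl : j = i + 1 := by omega
      have e := relation_of_three (n := n) (i := i) (by omega) (by omega) (by omega) (by omega)
        (by omega) (by omega) (by omega) hG
      have hc := commute_copy_of_lt F X (i := i + 1) (j := i) (by omega) (by omega) G
      simp only [copy]
      have e1 : SemiconjBy (scalarOp A (twoSite n (i + 1) (F : Op₂ N)) *
          scalarOp A (twoSite n i (F : Op₂ N))) (scalarOp A (twoSite n (i + 1) G))
          (scalarOp A (twoSite n i G)) := by
        simp only [add_zero] at e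
        simp only [SemiconjBy, ← scalarOp_mul]
        rw [← e, mul_assoc]
      have u1 : scalarOp A (twoSite n i ((F⁻¹ : Aut₂ N) : Op₂ N)) *
          scalarOp A (twoSite n i (F : Op₂ N)) = 1 := by
        rw [← scalarOp_mul, twoSite_inv_mul (by omega), scalarOp_one]
      have u1' : scalarOp A (twoSite n i (F : Op₂ N)) *
          scalarOp A (twoSite n i ((F⁻¹ : Aut₂ N) : Op₂ N)) = 1 := by
        rw [← scalarOp_mul, twoSite_mul_inv (by omega), scalarOp_one]
      have u2 : scalarOp A (twoSite n (i + 1) ((F⁻¹ : Aut₂ N) : Op₂ N)) *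
          scalarOp A (twoSite n (i + 1) (F : Op₂ N)) = 1 := by
        rw [← scalarOp_mul, twoSite_inv_mul (by omega), scalarOp_one]
      have u2' : scalarOp A (twoSite n (i + 1) (F : Op₂ N)) *
          scalarOp A (twoSite n (i + 1) ((F⁻¹ : Aut₂ N) : Op₂ N)) = 1 := by
        rw [← scalarOp_mul, twoSite_mul_inv (by omega), scalarOp_one]
      generalize scalarOp A (twoSite n i (F : Op₂ N)) = a at *
      generalize scalarOp A (twoSite n (i + 1) (F : Op₂ N)) = b at *
      generalize scalarOp A (twoSite n i ((F⁻¹ : Aut₂ N) : Op₂ N)) = a' at *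
      generalize scalarOp A (twoSite n (i + 1) ((F⁻¹ : Aut₂ N) : Op₂ N)) = b' at *
      generalize scalarOp A (twoSite n i G) = g at *
      generalize scalarOp A (twoSite n (i + 1) G) = g' at *
      generalize copy F X n i = x at *
      have e2 : SemiconjBy (a' * b') g g' := by
        have : (a' * b') * g * (b * a) * (a' * b') = (a' * b') * (b * a) * g' * (a' * b') := by
          rw [mul_assoc (a' * b'), ← e1.eq]; simp only [mul_assoc]
        have l : a' * b' * (b * a) = 1 := by
          rw [mul_assoc, ← mul_assoc b', u2, one_mul, u1]
        have l' : b * a * (a' * b') = 1 := by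
          rw [mul_assoc, ← mul_assoc a, u1', one_mul, u2']
        rw [l, one_mul, mul_assoc, l', mul_one] at this
        exact this
      have e3 : b * (a * x * a') * b' = (b * a) * x * (a' * b') := by simp only [mul_assoc]
      rw [e3]
      exact ((e1.mul_left hc).mul_left e2).symm

end Copies

/-! ### Products of successive copies. -/

section Strings

variable {N : ℕ} {A : Type*} [Ring A] [Algebra ℂ A] {n : ℕ}

variable (A) in
/-- Extension of coefficients as a homomorphism of algebras. -/
def scalarHom : Op N n ℂ →ₐ[ℂ] Op N n A := (Algebra.ofId ℂ A).mapMatrix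

theorem scalarHom_apply (T : Op N n ℂ) : scalarHom A T = scalarOp A T := rfl

theorem commute_scalarOp {S T : Op N n ℂ} (h : Commute S T) :
    Commute (scalarOp A S) (scalarOp A T) := by
  rw [← scalarHom_apply, ← scalarHom_apply]
  exact h.map (scalarHom A)

theorem scalarOp_mul_inv {i : ℕ} (hi : i + 1 < n) (F : Aut₂ N) :
    scalarOp A (twoSite n i (F : Op₂ N)) * scalarOp A (twoSite n i ((F⁻¹ : Aut₂ N) : Op₂ N)) =
      1 := by
  rw [← scalarOp_mul, twoSite_mul_inv hi, scalarOp_one]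

theorem scalarOp_inv_mul {i : ℕ} (hi : i + 1 < n) (F : Aut₂ N) :
    scalarOp A (twoSite n i ((F⁻¹ : Aut₂ N) : Op₂ N)) * scalarOp A (twoSite n i (F : Op₂ N)) =
      1 := by
  rw [← scalarOp_mul, twoSite_inv_mul hi, scalarOp_one]

/-- The product `X_{c+1} ⋯ X_{c+m}` of successive copies. -/
def copyProd (F : Aut₂ N) (X : Matrix (Fin N) (Fin N) A) (n c : ℕ) : ℕ → Op N n A
  | 0 => 1
  | m + 1 => copyProd F X n c m * copy F X n (c + m)

variable {F : Aut₂ N} {X : Matrix (Fin N) (Fin N) A}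

theorem prod_map_range_copy (m : ℕ) :
    ((List.range m).map (copy F X n)).prod = copyProd F X n 0 m := by
  induction m with
  | zero => rfl
  | succ m ih => rw [List.range_succ, List.map_append, List.prod_append, ih, copyProd]; simp

theorem matString_eq : matString F X n = copyProd F X n 0 n := prod_map_range_copy n

theorem copyProd_add (c m l : ℕ) :
    copyProd F X n c (m + l) = copyProd F X n c m * copyProd F X n (c + m) l := by
  induction l with
  | zero => simp [copyProd]
  | succ l ih => rw [← add_assoc, copyProd, ih, copyProd, mul_assoc, ← add_assoc c]

theorem embOp_copyProd {r : ℕ} (h : 0 + r ≤ n) {c m : ℕ} (hc : c + m ≤ r) :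
    embOp (window 0 h) (copyProd F X r c m) = copyProd F X n c m := by
  induction m with
  | zero => exact map_one _
  | succ m ih => rw [copyProd, map_mul, ih (by omega), embOp_copy F X h (by omega), copyProd]

theorem commute_copyProd {W : Op N n A} {c m : ℕ}
    (h : ∀ j < m, Commute W (copy F X n (c + j))) : Commute W (copyProd F X n c m) := by
  induction m with
  | zero => exact Commute.one_right W
  | succ m ih => exact (ih fun j hj => h j (by omega)).mul_right (h m (by omega))

end Strings

/-! ### The relations of the quantum matrix algebra in arbitrary positions. -/

section QuantumMatrix

variable {N : ℕ} {R F : Aut₂ N} {n : ℕ}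

theorem scalarOp_mul_qMatrix_two :
    scalarOp (QMAlgebra R F) (twoSite 2 0 (R : Op₂ N)) * matString F (qMatrix R F) 2 =
      matString F (qMatrix R F) 2 * scalarOp (QMAlgebra R F) (twoSite 2 0 (R : Op₂ N)) := by
  set φ : FreeAlgebra ℂ (Fin N × Fin N) →ₐ[ℂ] QMAlgebra R F := RingQuot.mkAlgHom ℂ (QMRel R F)
  have hs : φ.mapMatrix (scalarOp _ (twoSite 2 0 (R : Op₂ N))) =
      scalarOp (QMAlgebra R F) (twoSite 2 0 (R : Op₂ N)) := by
    ext I J; simp [scalarOp]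
  have hm : φ.mapMatrix (matString F (freeMatrix N) 2) = matString F (qMatrix R F) 2 := by
    have hc (i : ℕ) : φ.mapMatrix (copy F (freeMatrix N) 2 i) = copy F (qMatrix R F) 2 i :=
      map_copy F _ φ i
    simp only [matString_eq, copyProd, map_mul, map_one, hc]
  rw [← hs, ← hm, ← map_mul, ← map_mul]
  ext I J
  exact RingQuot.mkAlgHom_rel ℂ (QMRel.entry I J)

variable (hRF : CompatiblePair R F)
include hRF

/-- The defining relation is the case `i = 0`. Conjugation by `F_i F_{i+1}` carries the product of
two successive copies to the next such product, and `R_i` to `R_{i+1}` by the second twist relation.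
-/
theorem scalarOp_mul_copy_mul_copy {i : ℕ} (hi : i + 1 < n) :
    Commute (scalarOp (QMAlgebra R F) (twoSite n i (R : Op₂ N)))
      (copy F (qMatrix R F) n i * copy F (qMatrix R F) n (i + 1)) := by
  induction i with
  | zero =>
    have := congrArg (embOp (window 0 (by omega : 0 + 2 ≤ n)))
      (scalarOp_mul_qMatrix_two (R := R) (F := F))
    simp only [matString_eq, copyProd, map_mul, embOp_scalarOp, one_mul, zero_add,
      embOp_copy F (qMatrix R F) (by omega : 0 + 2 ≤ n) (show 0 < 2 by omega),
      embOp_copy F (qMatrix R F) (by omega : 0 + 2 ≤ n) (show 1 < 2 by omega),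
      embOp_twoSite 0 (by omega : 0 + 2 ≤ n) (show 0 + 1 < 2 by omega)] at this
    exact this
  | succ i ih =>
    have ih := ih (by omega)
    have e := relation_of_three (n := n) (i := i) (by omega) (by omega) (by omega) (by omega)
      (by omega) (by omega) (by omega) hRF.twist₂
    have hx := commute_copy_of_lt F (qMatrix R F) (i := i + 1) (j := i) (by omega) (by omega)
      (F : Op₂ N)
    have hy := commute_copy (X := qMatrix R F) (G := (F : Op₂ N)) hRF.yangBaxter_right (i := i)
      (j := i + 1 + 1) (n := n) (by omega) (by omega) (by omega)
    have e1 : SemiconjBy (scalarOp (QMAlgebra R F) (twoSite n i (F : Op₂ N)) *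
        scalarOp (QMAlgebra R F) (twoSite n (i + 1) (F : Op₂ N)))
        (scalarOp (QMAlgebra R F) (twoSite n i (R : Op₂ N)))
        (scalarOp (QMAlgebra R F) (twoSite n (i + 1) (R : Op₂ N))) := by
      simp only [add_zero] at e
      simp only [SemiconjBy, ← scalarOp_mul]
      rw [← e, mul_assoc]
    have u1 := scalarOp_inv_mul (A := QMAlgebra R F) (i := i) (n := n) (by omega) F
    have u1' := scalarOp_mul_inv (A := QMAlgebra R F) (i := i) (n := n) (by omega) F
    have u2 := scalarOp_inv_mul (A := QMAlgebra R F) (i := i + 1) (n := n) (by omega) F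
    have u2' := scalarOp_mul_inv (A := QMAlgebra R F) (i := i + 1) (n := n) (by omega) F
    have d1 : copy F (qMatrix R F) n (i + 1) =
        scalarOp (QMAlgebra R F) (twoSite n i (F : Op₂ N)) * copy F (qMatrix R F) n i *
          scalarOp (QMAlgebra R F) (twoSite n i ((F⁻¹ : Aut₂ N) : Op₂ N)) := rfl
    have d2 : copy F (qMatrix R F) n (i + 1 + 1) =
        scalarOp (QMAlgebra R F) (twoSite n (i + 1) (F : Op₂ N)) * copy F (qMatrix R F) n (i + 1) *
          scalarOp (QMAlgebra R F) (twoSite n (i + 1) ((F⁻¹ : Aut₂ N) : Op₂ N)) := rfl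
    generalize scalarOp (QMAlgebra R F) (twoSite n i (F : Op₂ N)) = f at *
    generalize scalarOp (QMAlgebra R F) (twoSite n (i + 1) (F : Op₂ N)) = g at *
    generalize scalarOp (QMAlgebra R F) (twoSite n i ((F⁻¹ : Aut₂ N) : Op₂ N)) = f' at *
    generalize scalarOp (QMAlgebra R F) (twoSite n (i + 1) ((F⁻¹ : Aut₂ N) : Op₂ N)) = g' at *
    generalize scalarOp (QMAlgebra R F) (twoSite n i (R : Op₂ N)) = r at *
    generalize scalarOp (QMAlgebra R F) (twoSite n (i + 1) (R : Op₂ N)) = r' at *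
    generalize copy F (qMatrix R F) n i = x at *
    generalize copy F (qMatrix R F) n (i + 1) = y at *
    generalize copy F (qMatrix R F) n (i + 1 + 1) = z at *
    have yf : y * f = f * x := by rw [d1, mul_assoc, u1, mul_one]
    have zg : z * g = g * y := by rw [d2, mul_assoc, u2, mul_one]
    have e2 : y * z * (f * g) = (f * g) * (x * y) := by
      calc y * z * (f * g) = y * (z * f) * g := by simp only [mul_assoc]
        _ = y * f * (z * g) := by rw [← hy.eq]; simp only [mul_assoc]
        _ = f * (x * g) * y := by rw [yf, zg]; simp only [mul_assoc]
        _ = _ := by rw [hx.eq]; simp only [mul_assoc]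
    have hu : f * g * (g' * f') = 1 := by rw [mul_assoc, ← mul_assoc g, u2', one_mul, u1']
    have e3 : r' * (y * z) * (f * g) = y * z * r' * (f * g) := by
      rw [mul_assoc, e2, ← mul_assoc, ← e1.eq, mul_assoc, ih.eq, ← mul_assoc, ← e2, mul_assoc _ r',
        ← e1.eq]
      simp only [mul_assoc]
    have := congrArg (· * (g' * f')) e3
    rwa [mul_assoc, hu, mul_one, mul_assoc, hu, mul_one] at this

/-- The operators `R_i` commute with the string of copies of the quantum matrix. -/
theorem commute_matString_twoSite {i : ℕ} (hi : i + 1 < n) :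
    Commute (scalarOp (QMAlgebra R F) (twoSite n i (R : Op₂ N)))
      (matString F (qMatrix R F) n) := by
  have h1 : ∀ j < i, Commute (scalarOp (QMAlgebra R F) (twoSite n i (R : Op₂ N)))
      (copy F (qMatrix R F) n (0 + j)) := fun j hj =>
    commute_copy _ hRF.twist₁ hi (by omega) (by omega)
  have h2 : ∀ j < n - (i + 2), Commute (scalarOp (QMAlgebra R F) (twoSite n i (R : Op₂ N)))
      (copy F (qMatrix R F) n (0 + (i + 2) + j)) := fun j hj =>
    commute_copy _ hRF.twist₁ hi (by omega) (by omega)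
  rw [matString_eq, show copyProd F (qMatrix R F) n 0 n =
    copyProd F (qMatrix R F) n 0 (i + 2 + (n - (i + 2))) by congr 1; omega, copyProd_add]
  refine Commute.mul_right ?_ (commute_copyProd h2)
  rw [copyProd_add, copyProd, copyProd, copyProd, one_mul]
  refine (commute_copyProd h1).mul_right ?_
  simpa using scalarOp_mul_copy_mul_copy hRF hi

theorem commute_scalarOp_matString {w : Op N n ℂ}
    (hw : w ∈ strandAlg (fun i => twoSite n i (R : Op₂ N)) n) :
    Commute (scalarOp (QMAlgebra R F) w) (matString F (qMatrix R F) n) := by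
  have : strandAlg (fun i => twoSite n i (R : Op₂ N)) n ≤
      (Subalgebra.centralizer ℂ {matString F (qMatrix R F) n}).comap
        (scalarHom (QMAlgebra R F)) := by
    refine Algebra.adjoin_le ?_
    rintro _ ⟨i, hi, rfl⟩
    exact mem_of_commute (commute_matString_twoSite hRF hi).symm
  exact (commute_of_mem (this hw)).symm

end QuantumMatrix

/-! ### Skew inverses and the weight matrix `D`. -/

section BlockMatrices

variable {N : ℕ} {B : Type*} [Ring B] [Algebra ℂ B]

/-- The block matrix `T` acting in the first factor of `V ⊗ V`. -/
def blockLeft (T : Matrix (Fin N) (Fin N) B) : Matrix (Fin N × Fin N) (Fin N × Fin N) B :=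
  fun p r => if p.2 = r.2 then T p.1 r.1 else 0

/-- The block matrix `T` acting in the second factor of `V ⊗ V`. -/
def blockRight (T : Matrix (Fin N) (Fin N) B) : Matrix (Fin N × Fin N) (Fin N × Fin N) B :=
  fun p r => if p.1 = r.1 then T p.2 r.2 else 0

theorem blockLeft_mul_blockLeft (S T : Matrix (Fin N) (Fin N) B) :
    blockLeft S * blockLeft T = blockLeft (S * T) := by
  ext ⟨a, b⟩ ⟨c, d⟩
  simp [blockLeft, Matrix.mul_apply, Fintype.sum_prod_type]

theorem blockRight_mul_blockRight (S T : Matrix (Fin N) (Fin N) B) :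
    blockRight S * blockRight T = blockRight (S * T) := by
  ext ⟨a, b⟩ ⟨c, d⟩
  simp [blockRight, Matrix.mul_apply, Fintype.sum_prod_type]

theorem blockLeft_one : blockLeft (1 : Matrix (Fin N) (Fin N) B) = 1 := by
  ext ⟨a, b⟩ ⟨c, d⟩
  simp only [blockLeft, Matrix.one_apply, Prod.mk.injEq]
  split_ifs <;> simp_all

theorem blockRight_one : blockRight (1 : Matrix (Fin N) (Fin N) B) = 1 := by
  ext ⟨a, b⟩ ⟨c, d⟩
  simp only [blockRight, Matrix.one_apply, Prod.mk.injEq]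
  split_ifs <;> simp_all

end BlockMatrices

section SkewInverse

variable {N : ℕ} {R : Op₂ N}

theorem isSkewInverse_skewInverse (hR : SkewInvertible R) : IsSkewInverse R (skewInverse R) := by
  rw [skewInverse, dif_pos hR]
  exact hR.choose_spec

theorem sum_skewInverse_mul (hR : SkewInvertible R) (a b c d : Fin N) :
    ∑ p : Fin N × Fin N, skewInverse R (a, p.1) (c, p.2) * R (p.2, b) (p.1, d) =
      if a = d ∧ b = c then 1 else 0 := by
  rw [Fintype.sum_prod_type]
  exact (isSkewInverse_skewInverse hR a b c d).2

theorem sum_mul_skewInverse (hR : SkewInvertible R) (a b c d : Fin N) :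
    ∑ p : Fin N × Fin N, R (a, p.1) (c, p.2) * skewInverse R (p.2, b) (p.1, d) =
      if a = d ∧ b = c then 1 else 0 := by
  rw [Fintype.sum_prod_type]
  exact (isSkewInverse_skewInverse hR a b c d).1

/-- This says `Tr₍₂₎ (R D₂) = 1`: it is the skew inverse relation traced over its third factor,
since `D` is the partial trace of `Ψ`. -/
theorem sum_mul_dMatrix (hR : SkewInvertible R) (a c : Fin N) :
    ∑ p : Fin N × Fin N, R (a, p.1) (c, p.2) * dMatrix R p.2 p.1 = if a = c then 1 else 0 := by
  simp only [dMatrix, Finset.mul_sum]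
  rw [Finset.sum_comm, Finset.sum_congr rfl fun b _ => sum_mul_skewInverse hR a b c b,
    Finset.sum_eq_single a (fun b _ hb => if_neg fun h => hb h.1.symm) (by simp)]
  simp

/-- For a matrix `T` over an algebra satisfying the relations `R T₁ T₂ = T₁ T₂ R`, conjugation
by `T` is compatible with the weighted trace. -/
theorem sum_dMatrix_smul_mul {B : Type*} [Ring B] [Algebra ℂ B] (hR : SkewInvertible R)
    {T T' : Matrix (Fin N) (Fin N) B} (h1 : T * T' = 1) (h2 : T' * T = 1)
    (h : R.map (algebraMap ℂ B) * (blockLeft T * blockRight T) =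
      blockLeft T * blockRight T * R.map (algebraMap ℂ B)) (e f : Fin N) :
    ∑ p : Fin N × Fin N, dMatrix R p.2 p.1 • (T p.1 f * T' e p.2) = dMatrix R e f • (1 : B) := by
  -- The relation `R T₁ T₂ = T₁ T₂ R` with `T₁` moved to the left and `T₂` to the right.
  have h3 : blockLeft T' * R.map (algebraMap ℂ B) * blockLeft T =
      blockRight T * R.map (algebraMap ℂ B) * blockRight T' := by
    have l : blockLeft T' * blockLeft T = 1 := by rw [blockLeft_mul_blockLeft, h2, blockLeft_one]
    have r : blockRight T * blockRight T' = 1 := by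
      rw [blockRight_mul_blockRight, h1, blockRight_one]
    calc _ = blockLeft T' * (R.map (algebraMap ℂ B) * (blockLeft T * blockRight T)) *
          blockRight T' := by
          simp only [mul_assoc]; rw [r, mul_one]
      _ = _ := by
        rw [h]; simp only [← mul_assoc]; rw [l, one_mul]
  have h4 (a b c d : Fin N) : ∑ r : Fin N × Fin N, R (r.1, b) (r.2, d) • (T' a r.1 * T r.2 c) =
      ∑ r : Fin N × Fin N, R (a, r.1) (c, r.2) • (T b r.1 * T' r.2 d) := by
    have := congrFun (congrFun h3 (a, b)) (c, d)
    have hc (z : ℂ) (u v : B) : u * algebraMap ℂ B z * v = z • (u * v) := by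
      rw [← Algebra.commutes, Algebra.smul_def, mul_assoc]
    simp only [Matrix.mul_apply, blockLeft, blockRight, Fintype.sum_prod_type, Matrix.map_apply,
      ite_mul, mul_ite, zero_mul, mul_zero, Finset.sum_ite_eq, Finset.sum_ite_eq',
      Finset.sum_ite_irrel, Finset.sum_const_zero,
      Finset.mem_univ, if_true, Finset.sum_mul] at this
    simp only [Fintype.sum_prod_type_right]
    simpa only [hc] using this
  -- The entries of `T ⊗ T'` are recovered from `h4` by contracting with the skew inverse of `R`.
  have h5 (b d : Fin N) : T b f * T' e d =
      ∑ p : Fin N × Fin N, ∑ r : Fin N × Fin N,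
        (skewInverse R (e, p.1) (f, p.2) * R (r.1, b) (r.2, d)) • (T' p.2 r.1 * T r.2 p.1) := by
    simp only [mul_smul, ← Finset.smul_sum, h4]
    simp only [Finset.smul_sum, smul_smul]
    rw [Finset.sum_comm]
    simp only [← Finset.sum_smul, sum_skewInverse_mul hR]
    rw [Finset.sum_eq_single (f, e)]
    · simp
    · rintro ⟨x, y⟩ _ hxy
      rw [if_neg, zero_smul]
      rintro ⟨rfl, rfl⟩
      exact hxy rfl
    · simp
  simp only [h5, Finset.smul_sum, smul_smul]
  rw [Finset.sum_comm]
  -- Weighting by `D` removes `R` through `sum_mul_dMatrix`; what is left is an entry of `T' T = 1`,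
  -- so the remaining sum is the partial trace of `Ψ`, that is `D`.
  have h6 (p : Fin N × Fin N) : ∑ r : Fin N × Fin N, ∑ x : Fin N × Fin N,
      (dMatrix R r.2 r.1 * (skewInverse R (e, p.1) (f, p.2) * R (x.1, r.1) (x.2, r.2))) •
        (T' p.2 x.1 * T x.2 p.1) =
      skewInverse R (e, p.1) (f, p.2) • (if p.1 = p.2 then (1 : B) else 0) := by
    rw [Finset.sum_comm]
    have (x : Fin N × Fin N) : ∑ r : Fin N × Fin N,
        (dMatrix R r.2 r.1 * (skewInverse R (e, p.1) (f, p.2) * R (x.1, r.1) (x.2, r.2))) •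
        (T' p.2 x.1 * T x.2 p.1) = skewInverse R (e, p.1) (f, p.2) •
          (if x.1 = x.2 then (T' p.2 x.1 * T x.2 p.1) else 0) := by
      rw [← Finset.sum_smul, show (if x.1 = x.2 then (T' p.2 x.1 * T x.2 p.1) else 0) =
        (if x.1 = x.2 then (1 : ℂ) else 0) • (T' p.2 x.1 * T x.2 p.1) by split_ifs <;> simp,
      ← sum_mul_dMatrix hR, smul_smul, Finset.mul_sum]
      congr 1
      exact Finset.sum_congr rfl fun _ _ => by ring
    simp only [this, ← Finset.smul_sum]
    rw [Fintype.sum_prod_type]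
    simp only [Finset.sum_ite_eq, Finset.mem_univ, if_true]
    rw [← Matrix.mul_apply, h2, Matrix.one_apply]
    simp only [eq_comm]
  simp only [h6]
  rw [Fintype.sum_prod_type]
  simp [dMatrix, Finset.sum_smul]

theorem sum_fin_three {M : Type*} [AddCommMonoid M] (f : (Fin 3 → Fin N) → M) :
    ∑ I, f I = ∑ a, ∑ b, ∑ c, f ![a, b, c] := by
  let e : (Fin 3 → Fin N) ≃ Fin N × Fin N × Fin N :=
    { toFun := fun I => (I 0, I 1, I 2)
      invFun := fun p => ![p.1, p.2.1, p.2.2]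
      left_inv := fun I => by ext i; fin_cases i <;> rfl
      right_inv := fun _ => rfl }
  rw [← e.symm.sum_comp, Fintype.sum_prod_type]
  exact Finset.sum_congr rfl fun a _ => Fintype.sum_prod_type _

theorem twoSite_three_zero (T : Op₂ N) (a b c x y z : Fin N) :
    twoSite 3 0 T ![a, b, c] ![x, y, z] = if c = z then T (a, b) (x, y) else 0 := by
  simp [twoSite, Fin.forall_fin_succ]

theorem twoSite_three_one (T : Op₂ N) (a b c x y z : Fin N) :
    twoSite 3 1 T ![a, b, c] ![x, y, z] = if a = x then T (b, c) (y, z) else 0 := by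
  simp [twoSite, Fin.forall_fin_succ]

/-- Partial trace of a conjugation by a twist compatible with `R`. -/
theorem sum_dMatrix_conj (hR : SkewInvertible R) {F : Aut₂ N}
    (h : twoSite 3 1 R * twoSite 3 0 (F : Op₂ N) * twoSite 3 1 (F : Op₂ N) =
      twoSite 3 0 (F : Op₂ N) * twoSite 3 1 (F : Op₂ N) * twoSite 3 0 R) (a b e f : Fin N) :
    ∑ p : Fin N × Fin N, dMatrix R p.2 p.1 *
      (∑ u, (F : Op₂ N) (a, p.1) (f, u) * ((F⁻¹ : Aut₂ N) : Op₂ N) (e, u) (b, p.2)) =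
      if a = b then dMatrix R e f else 0 := by
  -- `F` is read as a matrix `T` with entries in `End V`, the auxiliary space being its first factor
  -- for rows and its second for columns. In this reading the twist relation becomes `R T₁ T₂ = T₁
  -- T₂ R`.
  obtain ⟨T, hT⟩ : ∃ T : Matrix (Fin N) (Fin N) (Matrix (Fin N) (Fin N) ℂ),
      ∀ b x a u, T b x a u = (F : Op₂ N) (a, b) (x, u) := ⟨fun b x a u => _, fun _ _ _ _ => rfl⟩
  obtain ⟨T', hT'⟩ : ∃ T : Matrix (Fin N) (Fin N) (Matrix (Fin N) (Fin N) ℂ),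
      ∀ y p u b, T y p u b = ((F⁻¹ : Aut₂ N) : Op₂ N) (y, u) (b, p) :=
    ⟨fun y p u b => _, fun _ _ _ _ => rfl⟩
  have h1 : T * T' = 1 := by
    ext p' p a b
    have := congrFun (congrFun (Units.mul_inv F) (a, p')) (b, p)
    rw [Matrix.mul_apply, Fintype.sum_prod_type] at this
    simp only [Matrix.mul_apply, Matrix.sum_apply, hT, hT']
    rw [this]
    simp only [Matrix.one_apply, Prod.mk.injEq]
    by_cases e1 : p' = p <;> simp [e1, Matrix.one_apply]
  have h2 : T' * T = 1 := by
    ext y x u v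
    have := congrFun (congrFun (Units.inv_mul F) (y, u)) (x, v)
    rw [Matrix.mul_apply, Fintype.sum_prod_type_right] at this
    simp only [Matrix.mul_apply, Matrix.sum_apply, hT, hT']
    rw [this]
    simp only [Matrix.one_apply, Prod.mk.injEq]
    by_cases e1 : y = x <;> simp [e1, Matrix.one_apply]
  have h3 : R.map (algebraMap ℂ (Matrix (Fin N) (Fin N) ℂ)) * (blockLeft T * blockRight T) =
      blockLeft T * blockRight T * R.map (algebraMap ℂ (Matrix (Fin N) (Fin N) ℂ)) := by
    have hTT (b c x y : Fin N) : (blockLeft T * blockRight T) (b, c) (x, y) = T b x * T c y := by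
      simp [Matrix.mul_apply, blockLeft, blockRight, Fintype.sum_prod_type]
    ext ⟨b, c⟩ ⟨x, y⟩ a u
    have := congrFun (congrFun h ![a, b, c]) ![x, y, u]
    rw [Matrix.mul_apply, Matrix.mul_apply, Fintype.sum_prod_type, Fintype.sum_prod_type]
    simp only [hTT, Matrix.map_apply, ← Algebra.smul_def, ← Algebra.commutes]
    simp only [Matrix.sum_apply, Matrix.smul_apply, Matrix.mul_apply, hT, smul_eq_mul]
    simp only [mul_assoc (twoSite 3 1 R)] at this
    simp only [Matrix.mul_apply, sum_fin_three, twoSite_three_zero, twoSite_three_one, ite_mul,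
      mul_ite, zero_mul, mul_zero, Finset.sum_ite_eq, Finset.sum_ite_eq', Finset.sum_ite_irrel,
      Finset.sum_const_zero, Finset.mem_univ, if_true] at this
    refine this.trans ?_
    simp only [mul_comm]
  have := congrFun (congrFun (sum_dMatrix_smul_mul hR h1 h2 h3 e f) a) b
  simpa only [Matrix.sum_apply, Matrix.smul_apply, Matrix.mul_apply, hT, hT', smul_eq_mul,
    Matrix.one_apply, mul_ite, mul_one, mul_zero] using this

/-- The operator `D ⊗ D`. -/
def dTwo (R : Op₂ N) : Op₂ N := fun p r => dMatrix R p.1 r.1 * dMatrix R p.2 r.2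

theorem sum_skewInverse_mul_sum (hR : SkewInvertible R) (f : Fin N → Fin N → ℂ) (v w : Fin N) :
    ∑ p : Fin N × Fin N, skewInverse R (v, p.1) (w, p.2) *
      ∑ r : Fin N × Fin N, R (p.2, r.1) (p.1, r.2) * f r.1 r.2 = f w v := by
  simp only [Finset.mul_sum, ← mul_assoc]
  rw [Finset.sum_comm]
  simp only [← Finset.sum_mul, sum_skewInverse_mul hR]
  rw [Finset.sum_eq_single (w, v)]
  · simp
  · rintro ⟨x, y⟩ _ hxy
    rw [if_neg, zero_mul]
    rintro ⟨rfl, rfl⟩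
    exact hxy rfl
  · simp

/-- By the braid relation both `R` and `R⁻¹` are twists compatible with `R`, so `sum_dMatrix_conj`
applies to each. Undoing the contraction with `R` expresses `R⁻¹ D₂` and `D₂ R⁻¹` through `Ψ` and
one `D`; multiplying by the other `D` gives the same expression for `D₁ D₂ R⁻¹` and `R⁻¹ D₁ D₂`. -/
theorem commute_dTwo {R : Aut₂ N} (hR : SkewInvertible (R : Op₂ N)) (hYB : IsYangBaxter R) :
    Commute (dTwo (R : Op₂ N)) (R : Op₂ N) := by
  have h1 := sum_dMatrix_conj hR (F := R) hYB.symm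
  have h2 := sum_dMatrix_conj hR (F := R⁻¹) (by
    have a0 := twoSite_mul_inv (n := 3) (i := 0) (by omega) R
    have a1 := twoSite_mul_inv (n := 3) (i := 1) (by omega) R
    have b0 := twoSite_inv_mul (n := 3) (i := 0) (by omega) R
    have b1 := twoSite_inv_mul (n := 3) (i := 1) (by omega) R
    have hYB : twoSite 3 0 (R : Op₂ N) * twoSite 3 1 (R : Op₂ N) * twoSite 3 0 (R : Op₂ N) =
      twoSite 3 1 (R : Op₂ N) * twoSite 3 0 (R : Op₂ N) * twoSite 3 1 (R : Op₂ N) := hYB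
    generalize twoSite 3 0 (R : Op₂ N) = x at *
    generalize twoSite 3 1 (R : Op₂ N) = y at *
    generalize twoSite 3 0 ((R⁻¹ : Aut₂ N) : Op₂ N) = x' at *
    generalize twoSite 3 1 ((R⁻¹ : Aut₂ N) : Op₂ N) = y' at *
    calc y * x' * y' = (x' * y') * (y * x * y) * x' * y' := by
          simp only [mul_assoc]
          rw [← mul_assoc y' y, b1, one_mul, ← mul_assoc x' x, b0, one_mul]
      _ = x' * y' * x * (y * (x * x') * y') := by rw [← hYB]; simp only [mul_assoc]
      _ = _ := by rw [a0, mul_one, a1, mul_one])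
  set D := dMatrix (R : Op₂ N)
  set Ψ := skewInverse (R : Op₂ N)
  set S : Op₂ N := ((R⁻¹ : Aut₂ N) : Op₂ N)
  -- `e1` comes from the twist `R`, `e2` from the twist `R⁻¹`; in both, `Ψ` inverts the contraction
  -- with `R`.
  have e1 (y v b w : Fin N) : ∑ p, S (y, v) (b, p) * D p w = ∑ x, Ψ (v, x) (w, b) * D y x := by
    rw [← sum_skewInverse_mul_sum hR (fun w v => ∑ p, S (y, v) (b, p) * D p w) v w]
    have (p : Fin N × Fin N) : ∑ r : Fin N × Fin N, (R : Op₂ N) (p.2, r.1) (p.1, r.2) *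
        ∑ z, S (y, r.2) (b, z) * D z r.1 = if p.2 = b then D y p.1 else 0 := by
      rw [← h1 p.2 b y p.1]
      simp only [Fintype.sum_prod_type, Finset.mul_sum]
      refine Finset.sum_congr rfl fun a _ => ?_
      rw [Finset.sum_comm]
      exact Finset.sum_congr rfl fun c _ => Finset.sum_congr rfl fun d _ => by ring
    simp only [this, Fintype.sum_prod_type, mul_ite, mul_zero, Finset.sum_ite_eq',
      Finset.mem_univ, if_true]
    rfl
  have e2 (y v b w : Fin N) : ∑ p, D v p * S (y, p) (b, w) = ∑ x, Ψ (v, y) (w, x) * D x b := by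
    rw [← sum_skewInverse_mul_sum hR (fun w v => ∑ p, D v p * S (y, p) (b, w)) v w]
    have (p : Fin N × Fin N) : ∑ r : Fin N × Fin N, (R : Op₂ N) (p.2, r.1) (p.1, r.2) *
        ∑ z, D r.2 z * S (y, z) (b, r.1) = if y = p.1 then D p.2 b else 0 := by
      rw [← h2 y p.1 p.2 b]
      simp only [Fintype.sum_prod_type, Finset.mul_sum, inv_inv]
      refine (Finset.sum_congr rfl fun _ _ => Finset.sum_comm).trans <| Finset.sum_comm.trans <|
        Finset.sum_congr rfl fun _ _ => Finset.sum_comm.trans <| Finset.sum_congr rfl fun _ _ =>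
        Finset.sum_congr rfl fun _ _ => by ring
    simp only [this, Fintype.sum_prod_type, mul_ite, mul_zero, Finset.sum_ite_eq,
      Finset.sum_ite_irrel, Finset.sum_const_zero, Finset.mem_univ, if_true]
    rfl
  have e3 : dTwo (R : Op₂ N) * S = S * dTwo (R : Op₂ N) := by
    ext ⟨a, b⟩ ⟨c, d⟩
    simp only [Matrix.mul_apply, dTwo, Fintype.sum_prod_type]
    calc _ = ∑ x, D a x * ∑ y, D b y * S (x, y) (c, d) := by
          simp only [Finset.mul_sum, mul_assoc]; rfl
      _ = ∑ y, (∑ x, S (a, b) (y, x) * D x d) * D y c := by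
          simp only [e1, e2, Finset.mul_sum, Finset.sum_mul]
          rw [Finset.sum_comm]
          exact Finset.sum_congr rfl fun c _ => Finset.sum_congr rfl fun d _ => by ring
      _ = _ := by
          simp only [Finset.sum_mul]
          exact Finset.sum_congr rfl fun c _ => Finset.sum_congr rfl fun d _ => by ring
  have e4 : Commute (dTwo (R : Op₂ N)) ((R⁻¹ : Aut₂ N) : Op₂ N) := e3
  simpa using e4.units_inv_right

end SkewInverse

/-! ### The weighted trace and its cyclicity for numerical operators. -/

section WeightedTrace

variable {N : ℕ} {A : Type*} [Ring A] [Algebra ℂ A] {R : Op₂ N} {n r : ℕ}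

/-- The operator `D ⊗ ⋯ ⊗ D`. -/
def dAll (R : Op₂ N) (n : ℕ) : Op N n ℂ := fun I J => ∏ m, dMatrix R (I m) (J m)

theorem prod_eq_prod_mul_prod (e : Fin r ↪ Fin n) (f : Fin n → ℂ) :
    ∏ m, f m = (∏ i, f (e i)) * ∏ m ∈ Finset.univ.filter (fun m => ¬∃ i, e i = m), f m := by
  rw [← Finset.prod_filter_mul_prod_filter_not Finset.univ (fun m => ∃ i, e i = m)]
  congr 1
  rw [← Finset.prod_map]
  congr 1
  ext m
  simp

theorem dAll_override (e : Fin r ↪ Fin n) (K : Fin r → Fin N) (I J : Fin n → Fin N) :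
    dAll R n (override e K I) J = dAll R r K (J ∘ e) *
      ∏ m ∈ Finset.univ.filter (fun m => ¬∃ i, e i = m), dMatrix R (I m) (J m) := by
  rw [dAll, prod_eq_prod_mul_prod e]
  congr 1
  · simp only [override_apply]; rfl
  · refine Finset.prod_congr rfl fun m hm => ?_
    rw [override_of_notMem e K I (Finset.mem_filter.1 hm).2]

theorem dAll_override_right (e : Fin r ↪ Fin n) (K : Fin r → Fin N) (I J : Fin n → Fin N) :
    dAll R n I (override e K J) = dAll R r (I ∘ e) K *
      ∏ m ∈ Finset.univ.filter (fun m => ¬∃ i, e i = m), dMatrix R (I m) (J m) := by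
  rw [dAll, prod_eq_prod_mul_prod e]
  congr 1
  · simp only [override_apply]; rfl
  · refine Finset.prod_congr rfl fun m hm => ?_
    rw [override_of_notMem e K J (Finset.mem_filter.1 hm).2]

/-- The weights of the positions outside `e` form the same scalar factor on both sides. -/
theorem commute_dAll_embOp (e : Fin r ↪ Fin n) {X : Op N r ℂ} (h : Commute (dAll R r) X) :
    Commute (dAll R n) (embOp e X) := by
  ext I J
  have h1 : (embOp e X * dAll R n) I J = _ := embFun_mul_apply e X (dAll R n) I J
  have h2 : (dAll R n * embOp e X) I J = _ := mul_embFun_apply e X (dAll R n) I J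
  rw [h1, h2]
  simp only [dAll_override, dAll_override_right, ← mul_assoc, mul_right_comm]
  rw [← Finset.sum_mul, ← Finset.sum_mul, ← Matrix.mul_apply, ← Matrix.mul_apply, h.eq]

theorem commute_dAll_twoSite {R : Aut₂ N} (hR : SkewInvertible (R : Op₂ N)) (hYB : IsYangBaxter R)
    {i : ℕ} (hi : i + 1 < n) : Commute (dAll (R : Op₂ N) n) (twoSite n i (R : Op₂ N)) := by
  have h2 : Commute (dAll (R : Op₂ N) 2) (twoSite 2 0 (R : Op₂ N)) := by
    have : dAll (R : Op₂ N) 2 = (dTwo (R : Op₂ N)).submatrix (finTwoArrowEquiv (Fin N))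
        (finTwoArrowEquiv (Fin N)) := by
      ext I J
      simp [dAll, dTwo, Fin.prod_univ_two]
    rw [this, twoSite_two, Commute, SemiconjBy, Matrix.submatrix_mul_equiv,
      Matrix.submatrix_mul_equiv, (commute_dTwo hR hYB).eq]
  have := commute_dAll_embOp (window (r := 2) i (by omega : i + 2 ≤ n)) h2
  rwa [embOp_twoSite i (by omega : i + 2 ≤ n) (by omega), add_zero] at this

theorem rTrace_eq_trace (Y : Op N n A) :
    rTrace R Y = Matrix.trace (scalarOp A (dAll R n) * Y) := by
  simp only [rTrace, Matrix.trace, Matrix.diag, Matrix.mul_apply, scalarOp, Matrix.map_apply,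
    Algebra.smul_def]
  rfl

theorem trace_scalarOp_mul (S : Op N n ℂ) (Y : Op N n A) :
    Matrix.trace (scalarOp A S * Y) = Matrix.trace (Y * scalarOp A S) := by
  simp only [Matrix.trace, Matrix.diag, Matrix.mul_apply, scalarOp, Matrix.map_apply]
  rw [Finset.sum_comm]
  exact Finset.sum_congr rfl fun _ _ => Finset.sum_congr rfl fun _ _ => Algebra.commutes _ _

theorem rTrace_scalarOp_mul {w : Op N n ℂ} (hw : Commute (dAll R n) w) (Y : Op N n A) :
    rTrace R (scalarOp A w * Y) = rTrace R (Y * scalarOp A w) := by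
  rw [rTrace_eq_trace, rTrace_eq_trace, ← mul_assoc, (commute_scalarOp hw).eq, mul_assoc,
    trace_scalarOp_mul, mul_assoc]

theorem rTrace_add (Y Z : Op N n A) : rTrace R (Y + Z) = rTrace R Y + rTrace R Z := by
  simp only [rTrace_eq_trace, mul_add, Matrix.trace_add]

theorem rTrace_smul (c : ℂ) (Y : Op N n A) : rTrace R (c • Y) = c • rTrace R Y := by
  simp only [rTrace_eq_trace, mul_smul_comm, Matrix.trace_smul]

theorem rTrace_mul_diagonal (Y : Op N n A) (a : A) :
    rTrace R (Y * Matrix.diagonal fun _ => a) = rTrace R Y * a := by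
  simp only [rTrace, Matrix.mul_diagonal, Finset.sum_mul, smul_mul_assoc]

end WeightedTrace

/-! ### Partial weighted traces and their behaviour under twisting. -/

section PartialTrace

variable {N : ℕ} {A : Type*} [Ring A] [Algebra ℂ A] (R : Op₂ N) {n r : ℕ}

/-- The weighted trace over the last factor. -/
def ptr (Y : Op N (n + 1) A) : Op N n A :=
  fun J I => ∑ p : Fin N × Fin N, dMatrix R p.2 p.1 • Y (Fin.snoc J p.1) (Fin.snoc I p.2)

theorem rTrace_succ (Y : Op N (n + 1) A) : rTrace R Y = rTrace R (ptr R Y) := by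
  have hs (f : (Fin (n + 1) → Fin N) → A) :
      ∑ I, f I = ∑ I : Fin n → Fin N, ∑ p : Fin N, f (Fin.snoc I p) := by
    rw [← (Fin.snocEquiv fun _ => Fin N).sum_comp, Fintype.sum_prod_type_right]
    rfl
  simp only [rTrace, hs, ptr, Finset.smul_sum, smul_smul, Fin.prod_univ_castSucc,
    Fin.snoc_castSucc, Fin.snoc_last, Fintype.sum_prod_type]
  refine Finset.sum_congr rfl fun I _ => ?_
  rw [Finset.sum_comm]
  refine Finset.sum_congr rfl fun J _ => ?_
  rw [Finset.sum_comm]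

theorem snoc_comp_window (I : Fin n → Fin N) (p : Fin N) (h : 0 + n ≤ n + 1) :
    (Fin.snoc I p : Fin (n + 1) → Fin N) ∘ window 0 h = I := by
  funext i
  have : window 0 h i = i.castSucc := Fin.ext (by simp [window_apply])
  rw [Function.comp_apply, this]
  simp

theorem override_snoc (I K : Fin n → Fin N) (p : Fin N) (h : 0 + n ≤ n + 1) :
    override (window 0 h) K (Fin.snoc I p : Fin (n + 1) → Fin N) = Fin.snoc K p := by
  funext j
  induction j using Fin.lastCases with
  | last =>
    rw [override_of_notMem]
    · simp
    · rw [mem_window]; simp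
  | cast i =>
    have : i.castSucc = window 0 h i := Fin.ext (by simp [window_apply])
    rw [this, override_apply, ← this]
    simp

theorem ptr_embOp_mul (h : 0 + n ≤ n + 1) (X : Op N n A) (Y : Op N (n + 1) A) :
    ptr R (embOp (window 0 h) X * Y) = X * ptr R Y := by
  ext J I
  have h1 (J I) : (embOp (window 0 h) X * Y) J I = _ := embFun_mul_apply (window 0 h) X Y J I
  simp only [ptr, h1, snoc_comp_window, override_snoc, Matrix.mul_apply, Finset.smul_sum,
    Finset.mul_sum, mul_smul_comm]
  rw [Finset.sum_comm]

theorem ptr_mul_embOp (h : 0 + n ≤ n + 1) (X : Op N n A) (Y : Op N (n + 1) A) :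
    ptr R (Y * embOp (window 0 h) X) = ptr R Y * X := by
  ext J I
  have h1 (J I) : (Y * embOp (window 0 h) X) J I = _ := mul_embFun_apply (window 0 h) X Y J I
  simp only [ptr, h1, snoc_comp_window, override_snoc, Matrix.mul_apply, Finset.smul_sum,
    Finset.sum_mul, smul_mul_assoc]
  rw [Finset.sum_comm]

end PartialTrace

section LastFactors

variable {N : ℕ} {A : Type*} [Ring A] [Algebra ℂ A] {n : ℕ}

theorem override_snoc_snoc (h : n + 2 ≤ n + 2) (K : Fin 2 → Fin N) (I : Fin n → Fin N)
    (a p : Fin N) : override (window n h) K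
      (Fin.snoc (Fin.snoc I a : Fin (n + 1) → Fin N) p : Fin (n + 2) → Fin N) =
      Fin.snoc (Fin.snoc I (K 0) : Fin (n + 1) → Fin N) (K 1) := by
  funext j
  induction j using Fin.lastCases with
  | last =>
    have : Fin.last (n + 1) = window n h 1 := Fin.ext (by simp [window_apply])
    rw [this, override_apply, ← this, Fin.snoc_last]
  | cast j =>
    induction j using Fin.lastCases with
    | last =>
      have : (Fin.last n).castSucc = window n h 0 := Fin.ext (by simp [window_apply])
      rw [this, override_apply, ← this, Fin.snoc_castSucc, Fin.snoc_last]
    | cast j =>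
      rw [override_of_notMem]
      · simp
      · rw [mem_window]; simp

theorem snoc_snoc_comp_window (h : n + 2 ≤ n + 2) (I : Fin n → Fin N) (a p : Fin N) :
    (Fin.snoc (Fin.snoc I a : Fin (n + 1) → Fin N) p : Fin (n + 2) → Fin N) ∘ window n h =
      ![a, p] := by
  have h0 : (Fin.last n).castSucc = window n h 0 := Fin.ext (by simp [window_apply])
  have h1 : Fin.last (n + 1) = window n h 1 := Fin.ext (by simp [window_apply])
  funext j
  fin_cases j
  · simp [← h0]
  · simp [← h1]

theorem scalarOp_twoSite_eq (T : Op₂ N) :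
    scalarOp A (twoSite (n + 2) n T) = embFun (window (r := 2) n le_rfl)
      (scalarOp A (twoSite 2 0 T)) := by
  have := embOp_twoSite (r := 2) n (le_refl (n + 2)) (i := 0) (by omega) T
  rw [add_zero] at this
  rw [← this, ← embOp_scalarOp]
  rfl

theorem twoSite_last_mul_apply (T : Op₂ N) (Y : Op N (n + 2) A) (J : Fin n → Fin N) (a p : Fin N)
    (L : Fin (n + 2) → Fin N) :
    (scalarOp A (twoSite (n + 2) n T) * Y)
      (Fin.snoc (Fin.snoc J a : Fin (n + 1) → Fin N) p) L =
      ∑ x : Fin N × Fin N, T (a, p) x •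
        Y (Fin.snoc (Fin.snoc J x.1 : Fin (n + 1) → Fin N) x.2) L := by
  rw [scalarOp_twoSite_eq, embFun_mul_apply, ← (finTwoArrowEquiv (Fin N)).symm.sum_comp]
  refine Finset.sum_congr rfl fun x _ => ?_
  rw [override_snoc_snoc, snoc_snoc_comp_window, twoSite_two, scalarOp, Matrix.map_apply,
    ← Algebra.smul_def]
  rfl

theorem mul_twoSite_last_apply (T : Op₂ N) (Y : Op N (n + 2) A) (J : Fin n → Fin N) (a p : Fin N)
    (L : Fin (n + 2) → Fin N) :
    (Y * scalarOp A (twoSite (n + 2) n T)) L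
      (Fin.snoc (Fin.snoc J a : Fin (n + 1) → Fin N) p) =
      ∑ x : Fin N × Fin N, T x (a, p) •
        Y L (Fin.snoc (Fin.snoc J x.1 : Fin (n + 1) → Fin N) x.2) := by
  rw [scalarOp_twoSite_eq, mul_embFun_apply, ← (finTwoArrowEquiv (Fin N)).symm.sum_comp]
  refine Finset.sum_congr rfl fun x _ => ?_
  rw [override_snoc_snoc, snoc_snoc_comp_window, twoSite_two, scalarOp, Matrix.map_apply,
    ← Algebra.commutes,
    ← Algebra.smul_def]
  rfl

theorem embOp_snoc_apply (h : 0 + n ≤ n + 1) (Z : Op N n A) (I J : Fin n → Fin N) (x y : Fin N) :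
    embOp (window 0 h) Z (Fin.snoc I x) (Fin.snoc J y) = if x = y then Z I J else 0 := by
  rw [embOp_apply, snoc_comp_window, snoc_comp_window]
  refine if_congr ⟨fun H => ?_, ?_⟩ rfl rfl
  · have := (H (Fin.last n)).resolve_left (by rw [mem_window]; simp)
    simpa using this
  · rintro rfl j
    induction j using Fin.lastCases with
    | last => exact Or.inr (by simp)
    | cast j => exact Or.inl ⟨j, Fin.ext (by simp [window_apply])⟩

/-- The weighted trace over the last factor intertwines the shift of an operator by one factor. -/
theorem ptr_conj {R : Op₂ N} (hR : SkewInvertible R) {F : Aut₂ N}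
    (h : twoSite 3 1 R * twoSite 3 0 (F : Op₂ N) * twoSite 3 1 (F : Op₂ N) =
      twoSite 3 0 (F : Op₂ N) * twoSite 3 1 (F : Op₂ N) * twoSite 3 0 R)
    (h1 : 0 + (n + 1) ≤ n + 2) (h2 : 0 + n ≤ n + 1) (Z : Op N (n + 1) A) :
    ptr R (scalarOp A (twoSite (n + 2) n (F : Op₂ N)) * embOp (window 0 h1) Z *
      scalarOp A (twoSite (n + 2) n ((F⁻¹ : Aut₂ N) : Op₂ N))) =
      embOp (window 0 h2) (ptr R Z) := by
  ext J I
  rw [← Fin.snoc_init_self J, ← Fin.snoc_init_self I]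
  generalize Fin.init J = J₀
  generalize Fin.init I = I₀
  generalize J (Fin.last n) = a
  generalize I (Fin.last n) = b
  have key := sum_dMatrix_conj hR h a b
  simp only [ptr, embOp_snoc_apply, mul_twoSite_last_apply, twoSite_last_mul_apply]
  calc _ = ∑ x : Fin N, ∑ y : Fin N, (∑ p : Fin N × Fin N, dMatrix R p.2 p.1 *
      (∑ u, (F : Op₂ N) (a, p.1) (x, u) * ((F⁻¹ : Aut₂ N) : Op₂ N) (y, u) (b, p.2))) •
        Z (Fin.snoc J₀ x) (Fin.snoc I₀ y) := by
        simp only [Finset.sum_smul, Finset.mul_sum]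
        rw [Finset.sum_congr rfl fun x _ => Finset.sum_comm, Finset.sum_comm]
        refine Finset.sum_congr rfl fun p _ => ?_
        simp only [Fintype.sum_prod_type, smul_ite, smul_zero, Finset.sum_ite_eq', Finset.mem_univ,
          if_true, Finset.smul_sum, smul_smul]
        refine (Finset.sum_congr rfl fun _ _ => Finset.sum_comm).trans <| Finset.sum_comm.trans ?_
        refine Finset.sum_congr rfl fun _ _ => Finset.sum_congr rfl fun _ _ =>
          Finset.sum_congr rfl fun _ _ => ?_
        congr 1
        ring
    _ = _ := by
      simp only [key]
      split_ifs
      · rw [Fintype.sum_prod_type]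
      · simp

end LastFactors

/-! ### Shifting copies and generators by conjugation with the `F_i`. -/

section Shift

variable {N : ℕ} {A : Type*} [Ring A] [Algebra ℂ A] {n : ℕ}

/-- Conjugation by a unit, as a homomorphism of algebras. -/
def conjHom {B : Type*} [Ring B] [Algebra ℂ B] (u : Bˣ) : B →ₐ[ℂ] B :=
  AlgHom.ofLinearMap
    { toFun := fun x => u * x * ((u⁻¹ : Bˣ) : B)
      map_add' := fun x y => by rw [mul_add, add_mul]
      map_smul' := fun c x => by rw [mul_smul_comm, smul_mul_assoc, RingHom.id_apply] }
    (by simp)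
    (fun x y => by
      have : (u : B) * (x * y) * ((u⁻¹ : Bˣ) : B) =
          u * x * ((u⁻¹ : Bˣ) * u : B) * y * ((u⁻¹ : Bˣ) : B) := by
        rw [Units.inv_mul]; simp only [mul_assoc, mul_one]
      exact this.trans (by simp only [LinearMap.coe_mk, AddHom.coe_mk, mul_assoc]))

theorem conjHom_apply {B : Type*} [Ring B] [Algebra ℂ B] (u : Bˣ) (x : B) :
    conjHom u x = u * x * ((u⁻¹ : Bˣ) : B) := rfl

theorem conjHom_of_commute {B : Type*} [Ring B] [Algebra ℂ B] {u : Bˣ} {x : B}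
    (h : Commute (u : B) x) : conjHom u x = x := by
  rw [conjHom_apply, h.eq, Units.mul_inv_cancel_right]

theorem twoSite_of_le {i : ℕ} (hi : ¬i + 1 < n) (T : Op₂ N) : twoSite n i T = 1 := by
  ext I J
  rw [twoSite, dif_neg hi, Matrix.one_apply]

variable (A) in
/-- The operator `F_i` as a unit. -/
def siteUnit (F : Aut₂ N) (n i : ℕ) : (Op N n A)ˣ where
  val := scalarOp A (twoSite n i (F : Op₂ N))
  inv := scalarOp A (twoSite n i ((F⁻¹ : Aut₂ N) : Op₂ N))
  val_inv := by
    by_cases hi : i + 1 < n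
    · exact scalarOp_mul_inv hi F
    · rw [twoSite_of_le hi, twoSite_of_le hi, scalarOp_one, mul_one]
  inv_val := by
    by_cases hi : i + 1 < n
    · exact scalarOp_inv_mul hi F
    · rw [twoSite_of_le hi, twoSite_of_le hi, scalarOp_one, mul_one]

variable (A) in
/-- Conjugation by `F_c F_{c+1} ⋯ F_{c+m-1}`. -/
def conjChain (F : Aut₂ N) (n c : ℕ) : ℕ → (Op N n A →ₐ[ℂ] Op N n A)
  | 0 => AlgHom.id ℂ _
  | m + 1 => (conjChain F n c m).comp (conjHom (siteUnit A F n (c + m)))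

variable {F : Aut₂ N}

theorem conjChain_succ (c m : ℕ) (Y : Op N n A) : conjChain A F n c (m + 1) Y =
    conjChain A F n c m (scalarOp A (twoSite n (c + m) (F : Op₂ N)) * Y *
      scalarOp A (twoSite n (c + m) ((F⁻¹ : Aut₂ N) : Op₂ N))) := rfl

theorem conjChain_of_commute {c m : ℕ} {Y : Op N n A}
    (h : ∀ j < m, Commute (scalarOp A (twoSite n (c + j) (F : Op₂ N))) Y) :
    conjChain A F n c m Y = Y := by
  induction m with
  | zero => rfl
  | succ m ih =>
    have : conjHom (siteUnit A F n (c + m)) Y = Y := conjHom_of_commute (h m (by omega))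
    rw [conjChain, AlgHom.comp_apply, this, ih fun j hj => h j (by omega)]

/-- Of the conjugations, applied from the last to the first, those with `F_{c+j}`, `j > i`, do
nothing; the one with `F_{c+i}` is the definition of the next copy; the remaining ones commute with
that copy. -/
theorem conjChain_copy (hF : IsYangBaxter F) (X : Matrix (Fin N) (Fin N) A) {c m i : ℕ} (hi : i < m)
    (hm : c + m < n) : conjChain A F n c m (copy F X n (c + i)) = copy F X n (c + i + 1) := by
  induction m with
  | zero => omega
  | succ m ih =>
    rcases Nat.lt_or_ge i m with hlt | hge
    · have : conjHom (siteUnit A F n (c + m)) (copy F X n (c + i)) = copy F X n (c + i) :=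
        conjHom_of_commute
          (commute_copy_of_lt F X (i := c + m) (j := c + i) (by omega) (by omega) _).symm
      rw [conjChain, AlgHom.comp_apply, this, ih hlt (by omega)]
    · obtain rfl : i = m := by omega
      rw [conjChain_succ]
      refine conjChain_of_commute (Y := copy F X n (c + i + 1)) fun j hj => ?_
      exact commute_copy X hF (by omega) (by omega) (by omega)

theorem conjChain_copyProd (hF : IsYangBaxter F) (X : Matrix (Fin N) (Fin N) A) {c m i : ℕ}
    (hi : i ≤ m) (hm : c + m < n) :
    conjChain A F n c m (copyProd F X n c i) = copyProd F X n (c + 1) i := by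
  induction i with
  | zero => exact map_one _
  | succ i ih =>
    rw [copyProd, map_mul, ih (by omega), conjChain_copy hF X (by omega) hm, copyProd,
      show c + i + 1 = c + 1 + i by omega]

/-- The second twist relation moves `R_{c+i}` to `R_{c+i+1}` when conjugated by `F_{c+i} F_{c+i+1}`;
the other factors of the chain act on disjoint positions. -/
theorem conjChain_twoSite {R : Aut₂ N}
    (h : twoSite 3 1 (R : Op₂ N) * twoSite 3 0 (F : Op₂ N) * twoSite 3 1 (F : Op₂ N) =
      twoSite 3 0 (F : Op₂ N) * twoSite 3 1 (F : Op₂ N) * twoSite 3 0 (R : Op₂ N)) {c m i : ℕ}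
    (hi : i + 1 < m) (hm : c + m < n) :
    conjChain A F n c m (scalarOp A (twoSite n (c + i) (R : Op₂ N))) =
      scalarOp A (twoSite n (c + i + 1) (R : Op₂ N)) := by
  induction m with
  | zero => omega
  | succ m ih =>
    rcases Nat.lt_or_ge (i + 1) m with hlt | hge
    · have : conjHom (siteUnit A F n (c + m)) (scalarOp A (twoSite n (c + i) (R : Op₂ N))) =
          scalarOp A (twoSite n (c + i) (R : Op₂ N)) :=
        conjHom_of_commute (commute_scalarOp (commute_twoSite (by omega) (by omega) (by omega) _ _))
      rw [conjChain, AlgHom.comp_apply, this, ih hlt (by omega)]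
    · obtain rfl : m = i + 1 := by omega
      have e := relation_of_three (n := n) (i := c + i) (by omega) (by omega) (by omega) (by omega)
        (by omega) (by omega) (by omega) h
      simp only [add_zero] at e
      rw [conjChain_succ, conjChain_succ]
      have u1 := scalarOp_mul_inv (A := A) (i := c + i) (n := n) (by omega) F
      have u2 := scalarOp_mul_inv (A := A) (i := c + (i + 1)) (n := n) (by omega) F
      have e := congrArg (scalarOp A) e
      simp only [scalarOp_mul, ← add_assoc] at e u2 ⊢
      have : scalarOp A (twoSite n (c + i) (F : Op₂ N)) *
          (scalarOp A (twoSite n (c + i + 1) (F : Op₂ N)) *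
            scalarOp A (twoSite n (c + i) (R : Op₂ N)) *
            scalarOp A (twoSite n (c + i + 1) ((F⁻¹ : Aut₂ N) : Op₂ N))) *
          scalarOp A (twoSite n (c + i) ((F⁻¹ : Aut₂ N) : Op₂ N)) =
          scalarOp A (twoSite n (c + i + 1) (R : Op₂ N)) := by
        simp only [← mul_assoc]
        rw [← e, mul_assoc (scalarOp A (twoSite n (c + i + 1) (R : Op₂ N)) * _), u2, mul_one,
          mul_assoc, u1, mul_one]
      rw [this]
      exact conjChain_of_commute fun j hj =>
        commute_scalarOp (commute_twoSite (by omega) (by omega) (by omega) _ _)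

end Shift

/-! ### Iterated partial traces of shifted operators. -/

section PartialTraces

variable {N : ℕ} {A : Type*} [Ring A] [Algebra ℂ A] {n c : ℕ}

theorem embOp_window_self (h : 0 + n ≤ n) (X : Op N n A) : embOp (window 0 h) X = X := by
  have : (window 0 h : Fin n ↪ Fin n) = Function.Embedding.refl _ := by
    ext i; simp [window_apply]
  ext I J
  rw [embOp_apply, this, if_pos fun j => Or.inl ⟨j, rfl⟩]
  rfl

theorem embOp_window_window {r m : ℕ} {a b : ℕ} (h : a + r ≤ n) (h' : b + m ≤ r)
    (h'' : a + b + m ≤ n) (X : Op N m A) :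
    embOp (window a h) (embOp (window b h') X) = embOp (window (a + b) h'') X := by
  have : (window b h').trans (window a h) = window (a + b) h'' := by
    ext i; simp [window_apply, add_assoc]
  rw [embOp_embOp, this]

theorem embOp_diagonal {r : ℕ} (e : Fin r ↪ Fin n) (a : A) :
    embOp e (Matrix.diagonal fun _ : Fin r → Fin N => a) = Matrix.diagonal fun _ => a := by
  ext I J
  rw [embOp_apply]
  by_cases h : I = J
  · subst h
    rw [if_pos fun j => Or.inr rfl, Matrix.diagonal_apply_eq, Matrix.diagonal_apply_eq]
  · rw [Matrix.diagonal_apply_ne _ h]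
    split_ifs with h'
    · exact Matrix.diagonal_apply_ne _ fun h'' => h (h'.ext h'')
    · rfl

variable (R : Op₂ N)

/-- The weighted trace over the last `m` factors. -/
def ptrs : ∀ m : ℕ, Op N (c + m) A → Op N c A
  | 0, Y => Y
  | m + 1, Y => ptrs m (ptr R Y)

theorem rTrace_ptrs (m : ℕ) (Y : Op N (c + m) A) : rTrace R (ptrs R m Y) = rTrace R Y := by
  induction m with
  | zero => rfl
  | succ m ih => rw [ptrs, ih]; exact (rTrace_succ R Y).symm

theorem ptrs_embOp_mul (m : ℕ) (h : 0 + c ≤ c + m) (X : Op N c A) (Y : Op N (c + m) A) :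
    ptrs R m (embOp (window 0 h) X * Y) = X * ptrs R m Y := by
  induction m with
  | zero => rw [ptrs, ptrs]; exact congrArg (· * Y) (embOp_window_self (n := c) (by omega) X)
  | succ m ih =>
    have e : embOp (window 0 h) X = embOp (window (n := c + m + 1) (r := c + m) 0 (by omega))
        (embOp (window 0 (show 0 + c ≤ c + m by omega)) X) :=
      (embOp_window_window (n := c + m + 1) (r := c + m) (m := c) (a := 0) (b := 0) (by omega)
        (by omega) (by omega) X).symm
    rw [ptrs, ptrs, e, ← ih (by omega)]
    congr 1
    exact ptr_embOp_mul R (n := c + m) (by omega) _ Y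

variable {R} {F : Aut₂ N}

theorem ptr_conjChain {m : ℕ} (hm : c + m < n) (Y : Op N (n + 1) A) :
    ptr R (conjChain A F (n + 1) c m Y) = conjChain A F n c m (ptr R Y) := by
  induction m generalizing Y with
  | zero => rfl
  | succ m ih =>
    have e (T : Op₂ N) : scalarOp A (twoSite (n + 1) (c + m) T) =
        embOp (window 0 (by omega : 0 + n ≤ n + 1)) (scalarOp A (twoSite n (c + m) T)) := by
      rw [embOp_scalarOp, embOp_twoSite 0 _ (by omega), zero_add]
    rw [conjChain_succ, conjChain_succ, ih (by omega), e, e, ptr_mul_embOp, ptr_embOp_mul]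

section

variable (hR : SkewInvertible R)
  (h : twoSite 3 1 R * twoSite 3 0 (F : Op₂ N) * twoSite 3 1 (F : Op₂ N) =
      twoSite 3 0 (F : Op₂ N) * twoSite 3 1 (F : Op₂ N) * twoSite 3 0 R)
include hR h

/-- Each traced factor removes one conjugation: the innermost `F` disappears by `ptr_conj`, while
the other conjugations do not involve the last factor and pass through the trace. -/
theorem ptrs_conjChain (m : ℕ) (h1 : 0 + (c + m) ≤ c + 1 + m) (h2 : 0 + c ≤ c + 1)
    (Z : Op N (c + m) A) :
    ptrs R m (conjChain A F (c + 1 + m) c m (embOp (window 0 h1) Z)) =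
      embOp (window 0 h2) (ptrs R m Z) := by
  induction m with
  | zero => rfl
  | succ m ih =>
    -- `ptr_conj` restated with a free size `b`, because the sizes `c + 1 + m` and `c + m + 1` are
    -- not definitionally equal.
    have key : ∀ a b : ℕ, b = a + 1 → ∀ (h1 : 0 + (a + 1) ≤ b + 1) (h2 : 0 + a ≤ b)
        (Z : Op N (a + 1) A),
        ptr R (scalarOp A (twoSite (b + 1) a (F : Op₂ N)) * embOp (window 0 h1) Z *
          scalarOp A (twoSite (b + 1) a ((F⁻¹ : Aut₂ N) : Op₂ N))) =
          embOp (window 0 h2) (ptr R Z) := by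
      rintro a _ rfl h1 h2 Z
      exact ptr_conj hR h h1 h2 Z
    rw [ptrs, ptrs, ← ih (show 0 + (c + m) ≤ c + 1 + m by omega),
      ← key (c + m) (c + 1 + m) (by omega) h1 (by omega) Z]
    congr 1
    exact ptr_conjChain (n := c + 1 + m) (c := c) (m := m) (by omega) _

end

theorem rTrace_zero (Y : Op N 0 A) (I J : Fin 0 → Fin N) : rTrace R Y = Y I J := by
  simp [rTrace]
  congr 1 <;> exact Subsingleton.elim _ _

end PartialTraces

/-! ### Multiplicativity of the characteristic map. -/

section ProductFormula

variable {N : ℕ} {A : Type*} [Ring A] [Algebra ℂ A] {R F : Aut₂ N} {n c m : ℕ}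
  (X : Matrix (Fin N) (Fin N) A)

variable (F) in
/-- The string of copies and the operator `y` on the factors `c, …, c + m - 1`. -/
def block (n c : ℕ) (h : c + m ≤ n) (y : Op N m ℂ) : Op N n A :=
  copyProd F X n c m * scalarOp A (embOp (window c h) y)

variable (hRF : CompatiblePair R F)
include hRF

theorem conjChain_embOp {y : Op N m ℂ} (hy : y ∈ strandAlg (fun i => twoSite m i (R : Op₂ N)) m)
    (h : c + m ≤ n) (h' : c + 1 + m ≤ n) :
    conjChain A F n c m (scalarOp A (embOp (window c h) y)) =
      scalarOp A (embOp (window (c + 1) h') y) := by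
  have : strandAlg (fun i => twoSite m i (R : Op₂ N)) m ≤
      AlgHom.equalizer ((conjChain A F n c m).comp ((scalarHom A).comp (embOp (window c h))))
        ((scalarHom A).comp (embOp (window (c + 1) h'))) := by
    refine strandAlg_le fun i hi => ?_
    simp only [AlgHom.mem_equalizer, AlgHom.comp_apply, scalarHom_apply]
    rw [embOp_twoSite c h hi, embOp_twoSite (c + 1) h' hi, conjChain_twoSite hRF.twist₂ hi
      (by omega), show c + i + 1 = c + 1 + i by omega]
  exact this hy

theorem conjChain_block {y : Op N m ℂ} (hy : y ∈ strandAlg (fun i => twoSite m i (R : Op₂ N)) m)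
    (h : c + m ≤ n) (h' : c + 1 + m ≤ n) :
    conjChain A F n c m (block F X n c h y) = block F X n (c + 1) h' y := by
  rw [block, map_mul, conjChain_embOp hRF hy h h',
    conjChain_copyProd hRF.yangBaxter_right X le_rfl (by omega), block]

/-- A block of copies shifted by `c` factors has a partial trace that is a scalar matrix. Moving the
block one factor further is a chain of conjugations by the `F_i`, which the trace does not see; for
`c = 0` this is the definition of `ch`. -/
theorem ptrs_block (hR : SkewInvertible (R : Op₂ N)) {y : Op N m ℂ}
    (hy : y ∈ strandAlg (fun i => twoSite m i (R : Op₂ N)) m) (c : ℕ) (h : c + m ≤ c + m) :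
    ptrs (R : Op₂ N) m (block F X (c + m) c h y) = Matrix.diagonal fun _ => ch R F X m y := by
  induction c with
  | zero =>
    have key : ∀ T : ℕ, T = m → ∀ h : 0 + m ≤ T,
        rTrace (R : Op₂ N) (block F X T 0 h y) = ch R F X m y := by
      rintro T rfl h
      rw [block, embOp_window_self, ch, matString_eq]
    ext I J
    rw [show ptrs (R : Op₂ N) m (block F X (0 + m) 0 h y) I J =
      rTrace (R : Op₂ N) (ptrs (R : Op₂ N) m (block F X (0 + m) 0 h y)) from
        (rTrace_zero _ I J).symm, rTrace_ptrs, key _ (zero_add m),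
      Subsingleton.elim I J, Matrix.diagonal_apply_eq]
  | succ c ih =>
    have e : block F X (c + 1 + m) c (by omega) y =
        embOp (window (r := c + m) 0 (by omega)) (block F X (c + m) c le_rfl y) := by
      rw [block, block, map_mul, embOp_copyProd _ le_rfl, embOp_scalarOp,
        embOp_window_window _ _ (by omega)]
      simp only [zero_add]
    rw [← conjChain_block X hRF hy (by omega : c + m ≤ c + 1 + m) h, e,
      ptrs_conjChain hR hRF.twist₂ m _ (by omega), ih, embOp_diagonal]

/-- The characteristic map is multiplicative with respect to juxtaposition. -/
theorem ch_mul (hR : SkewInvertible (R : Op₂ N)) {x : Op N n ℂ} {y : Op N m ℂ}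
    (hx : x ∈ strandAlg (fun i => twoSite n i (R : Op₂ N)) n)
    (hy : y ∈ strandAlg (fun i => twoSite m i (R : Op₂ N)) m) (h1 : 0 + n ≤ n + m)
    (h2 : n + m ≤ n + m) :
    ch R F X (n + m) (embOp (window 0 h1) x * embOp (window n h2) y) =
      ch R F X n x * ch R F X m y := by
  -- The generators in `x` commute with the later copies by the first twist relation, so the string
  -- with `x` and `y` inserted factors into two blocks.
  have hc : Commute (copyProd F X (n + m) n m) (scalarOp A (embOp (window 0 h1) x)) := by
    have : strandAlg (fun i => twoSite n i (R : Op₂ N)) n ≤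
        (Subalgebra.centralizer ℂ {copyProd F X (n + m) n m}).comap
          ((scalarHom A).comp (embOp (window 0 h1))) := by
      refine strandAlg_le fun i hi => mem_of_commute ?_
      change Commute _ (scalarOp A (embOp (window 0 h1) (twoSite n i (R : Op₂ N))))
      rw [embOp_twoSite 0 h1 hi, zero_add]
      exact (commute_copyProd fun j hj =>
        commute_copy X hRF.twist₁ (by omega) (by omega) (by omega)).symm
    exact commute_of_mem (this hx)
  have e : matString F X (n + m) * scalarOp A (embOp (window 0 h1) x * embOp (window n h2) y) =
      embOp (window 0 h1) (matString F X n * scalarOp A x) * block F X (n + m) n h2 y := by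
    rw [matString_eq, matString_eq, copyProd_add, zero_add, scalarOp_mul, map_mul,
      embOp_copyProd h1 (by omega), block, embOp_scalarOp]
    simp only [mul_assoc]
    rw [← mul_assoc (scalarOp A _) (copyProd F X _ _ _), ← hc.eq, mul_assoc]
  rw [ch, e, ← rTrace_ptrs, ptrs_embOp_mul, ptrs_block X hRF hR hy, rTrace_mul_diagonal, ← ch]

end ProductFormula

section Trace

variable {N : ℕ} {R F : Aut₂ N} {n : ℕ}

theorem ch_add {A : Type*} [Ring A] [Algebra ℂ A] (X : Matrix (Fin N) (Fin N) A) (x y : Op N n ℂ) :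
    ch R F X n (x + y) = ch R F X n x + ch R F X n y := by
  rw [ch, scalarOp_add, mul_add, rTrace_add, ch, ch]

theorem ch_smul {A : Type*} [Ring A] [Algebra ℂ A] (X : Matrix (Fin N) (Fin N) A) (z : ℂ)
    (x : Op N n ℂ) : ch R F X n (z • x) = z • ch R F X n x := by
  rw [ch, scalarOp_smul, mul_smul_comm, rTrace_smul, ch]

theorem ch_zero_right {A : Type*} [Ring A] [Algebra ℂ A] (X : Matrix (Fin N) (Fin N) A) :
    ch R F X n 0 = 0 := by
  simpa using ch_smul (R := R) (F := F) X 0 (0 : Op N n ℂ)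

/-- The characteristic map is a trace. -/
theorem ch_mul_comm (hRF : CompatiblePair R F) (hR : SkewInvertible (R : Op₂ N)) {y : Op N n ℂ}
    (hy : y ∈ strandAlg (fun i => twoSite n i (R : Op₂ N)) n) (x : Op N n ℂ) :
    ch R F (qMatrix R F) n (x * y) = ch R F (qMatrix R F) n (y * x) := by
  have hD : Commute (dAll (R : Op₂ N) n) y :=
    commute_of_mem_strandAlg hy fun i hi => commute_dAll_twoSite hR hRF.yangBaxter_left hi
  rw [ch, scalarOp_mul, ← mul_assoc, ← rTrace_scalarOp_mul hD, ← mul_assoc,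
    (commute_scalarOp_matString hRF hy).eq, ch, scalarOp_mul, mul_assoc]

end Trace

/-! ### Generation of the characteristic subalgebra by `g` and the elementary sums. -/

section Generation

variable {N : ℕ} {R F : Aut₂ N} {q μ : ℂ} {n k : ℕ}

/-- The operators `R_i` on `V^{⊗ n}`. -/
abbrev gens (R : Aut₂ N) (n : ℕ) : ℕ → Op N n ℂ := fun i => twoSite n i (R : Op₂ N)

/-- The inverses of the operators `R_i` on `V^{⊗ n}`. -/
abbrev invGens (R : Aut₂ N) (n : ℕ) : ℕ → Op N n ℂ :=
  fun i => twoSite n i ((R⁻¹ : Aut₂ N) : Op₂ N)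

local notation "χ" => ch R F (qMatrix R F)

local notation "κ" => kappa q μ

local notation "𝔞" => antisymmetrizer q μ

theorem IsBMWType.admissible (hB : IsBMWType R q μ) : Admissible q μ :=
  ⟨hB.q_ne_zero, hB.q_sq_ne_one, hB.mu_ne_zero, hB.mu_ne_q, hB.mu_ne_neg_inv⟩

theorem exists_embOp {c a : ℕ} (h : c + a ≤ n) {x : Op N n ℂ}
    (hx : x ∈ strandAlg (fun j => gens R n (c + j)) a) :
    ∃ y ∈ strandAlg (gens R a) a, embOp (window c h) y = x := by
  have : strandAlg (fun j => gens R n (c + j)) a ≤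
      (strandAlg (gens R a) a).map (embOp (window c h)) :=
    strandAlg_le fun i hi => ⟨_, gen_mem_strandAlg hi, embOp_twoSite c h hi _⟩
  exact this hx

theorem embOp_antisymOp {c m : ℕ} (h : c + m ≤ n) :
    embOp (window c h) (antisymOp R q μ m) = 𝔞 (fun j => gens R n (c + j)) m := by
  rw [antisymOp, map_antisymmetrizer]
  exact antisymmetrizer_congr fun j hj => embOp_twoSite c h hj _

theorem antisymOp_mem (m : ℕ) : antisymOp R q μ m ∈ strandAlg (gens R m) m :=
  antisymmetrizer_mem_strandAlg m

theorem ch_zero_one : χ 0 1 = 1 := by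
  rw [ch, matString_eq, copyProd, one_mul, scalarOp_one, rTrace_zero _ (fun i => i.elim0)
    (fun i => i.elim0), Matrix.one_apply_eq]

theorem ch_antisymOp (i : ℕ) : χ i (antisymOp R q μ i) = elemSum R F q μ (qMatrix R F) i := by
  match i with
  | 0 => exact ch_zero_one
  | i + 1 => rfl

theorem ch_kappa (hp : Admissible q μ) :
    χ 2 (κ (twoSite 2 0 (R : Op₂ N))) = eta q μ • contraction R F q μ (qMatrix R F) := by
  rw [contraction, smul_smul, mul_inv_cancel₀ hp.eta_ne_zero, one_smul]

variable (hRF : CompatiblePair R F) (hR : SkewInvertible (R : Op₂ N))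
include hRF hR

theorem ch_mul_embOp {a b : ℕ} (hn : a + b = n) {x : Op N a ℂ} {y : Op N b ℂ}
    (hx : x ∈ strandAlg (gens R a) a) (hy : y ∈ strandAlg (gens R b) b) (h1 : 0 + a ≤ n)
    (h2 : a + b ≤ n) :
    χ n (embOp (window 0 h1) x * embOp (window a h2) y) = χ a x * χ b y := by
  subst hn
  exact ch_mul _ hRF hR hx hy h1 h2

theorem ch_mul_mem {S : Subalgebra ℂ (QMAlgebra R F)}
    (ih : ∀ m < n, ∀ w ∈ strandAlg (gens R m) m, χ m w ∈ S) {a b : ℕ} (ha : 1 ≤ a) (hb : 1 ≤ b)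
    (hn : a + b = n) {x y : Op N n ℂ} (hx : x ∈ strandAlg (gens R n) a)
    (hy : y ∈ strandAlg (fun j => gens R n (a + j)) b) : χ n (x * y) ∈ S := by
  obtain ⟨x', hx', rfl⟩ := exists_embOp (R := R) (c := 0) (a := a) (n := n) (by omega)
    (by simpa only [zero_add] using hx)
  obtain ⟨y', hy', rfl⟩ := exists_embOp (R := R) (c := a) (a := b) (n := n) (by omega) hy
  rw [ch_mul_embOp hRF hR hn hx' hy']
  exact S.mul_mem (ih a (by omega) _ hx') (ih b (by omega) _ hy')

variable (hB : IsBMWType R q μ)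
include hB

/-- By cyclicity the word is `z κ_j`, and conjugation by braid generators moves `κ_j` to the last
two strands. There `κ z κ = u κ` with `u` on `n - 2` strands, and `χ` of the result is a multiple of
`χ(u) g`. -/
theorem ch_mul_kappa_mem {S : Subalgebra ℂ (QMAlgebra R F)}
    (hg : contraction R F q μ (qMatrix R F) ∈ S)
    (ih : ∀ m < n, ∀ w ∈ strandAlg (gens R m) m, χ m w ∈ S) {j : ℕ} (hj : j + 1 < n)
    {x y : Op N n ℂ} (hx : x ∈ strandAlg (gens R n) n) (hy : y ∈ strandAlg (gens R n) n) :
    χ n (x * κ (gens R n j) * y) ∈ S := by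
  have hp := hB.admissible
  have h := hB.relations n
  have hκ {j : ℕ} (hj : j + 1 < n) : κ (gens R n j) ∈ strandAlg (gens R n) n :=
    kappa_mem (gen_mem_strandAlg hj)
  -- Here `d` counts the strands to the right of the pair on which `κ_j` acts.
  suffices H : ∀ d j, j + 2 + d = n → ∀ z ∈ strandAlg (gens R n) n,
      χ n (z * κ (gens R n j)) ∈ S by
    rw [ch_mul_comm hRF hR hy, ← mul_assoc]
    exact H (n - (j + 2)) j (by omega) _ (mul_mem hy hx)
  intro d
  induction d with
  | zero =>
    intro j hj z hz
    obtain rfl : j + 2 = n := hj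
    obtain ⟨u, hu, e⟩ := h.exists_kappa_mul_kappa hp (m := j) le_rfl hz
    obtain ⟨x', hx', rfl⟩ := exists_embOp (R := R) (c := 0) (a := j) (n := j + 2) (by omega)
      (by simpa only [zero_add] using hu)
    -- Doubling `κ` lets cyclicity place one copy on each side of `z`.
    have e1 : z * κ (gens R (j + 2) j) = (eta q μ)⁻¹ • (z * κ (gens R (j + 2) j) *
        κ (gens R (j + 2) j)) := by
      rw [mul_assoc, h.kappa_sq j (by omega), mul_smul_comm, smul_smul,
        inv_mul_cancel₀ hp.eta_ne_zero, one_smul]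
    have e2 : κ (gens R (j + 2) j) = embOp (window j le_rfl) (κ (twoSite 2 0 (R : Op₂ N))) := by
      rw [map_kappa, embOp_twoSite j _ (by omega), add_zero]
    rw [e1, ch_smul, ch_mul_comm hRF hR (hκ (by omega)), ← mul_assoc, e, e2, ch_mul_embOp hRF hR rfl
      hx' (kappa_mem (gen_mem_strandAlg (by omega))), ch_kappa hp]
    exact S.smul_mem (S.mul_mem (ih j (by omega) _ hx') (S.smul_mem hg _)) _
  | succ d ihd =>
    intro j hj z hz
    have hs : SemiconjBy (gens R n j * gens R n (j + 1)) (gens R n j) (gens R n (j + 1)) := by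
      rw [SemiconjBy, h.braid j (by omega), mul_assoc]
    have hs := semiconjBy_kappa (q := q) (μ := μ) hs
    have e : z * κ (gens R n j) = z * (invGens R n (j + 1) * invGens R n j) *
        κ (gens R n (j + 1)) * (gens R n j * gens R n (j + 1)) := by
      rw [mul_assoc _ (κ (gens R n (j + 1))), ← hs.eq, mul_assoc z]
      congr 1
      have := h.inv_mul j (by omega)
      have h' := h.inv_mul (j + 1) (by omega)
      simp only [mul_assoc]
      rw [← mul_assoc (invGens R n j), this, one_mul, ← mul_assoc, h', one_mul]
    have hg (i : ℕ) (hi : i + 1 < n) := gen_mem_strandAlg (s := gens R n) hi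
    rw [e, ch_mul_comm hRF hR (mul_mem (hg _ (by omega)) (hg _ (by omega))), ← mul_assoc]
    exact ihd (j + 1) (by omega) _ (mul_mem (mul_mem (hg _ (by omega)) (hg _ (by omega)))
      (mul_mem hz (mul_mem (h.inv_mem hp (by omega) (hg _ (by omega)))
        (h.inv_mem hp (by omega) (hg _ (by omega))))))

/-- Reduction to the Coxeter elements. -/
theorem ch_mem_of_coxeter {S : Subalgebra ℂ (QMAlgebra R F)}
    (hg : contraction R F q μ (qMatrix R F) ∈ S)
    (ih : ∀ m < n, ∀ w ∈ strandAlg (gens R m) m, χ m w ∈ S) (hn : 1 ≤ n)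
    (hc : χ n (coxeter (gens R n) (n - 1)) ∈ S) {w : Op N n ℂ}
    (hw : w ∈ strandAlg (gens R n) n) : χ n w ∈ S := by
  have hp := hB.admissible
  have h := hB.relations n
  -- Generalization for induction on `m`: `w` on `m + 1` strands followed by a Coxeter tail on the
  -- rest. Splitting `w` along its last strand, the part without its last generator factorizes, the
  -- part with `σ` lengthens the tail after a cyclic move, and the part with `κ` is
  -- `ch_mul_kappa_mem`.
  have key : ∀ m d, m + 1 + d = n → ∀ w ∈ strandAlg (gens R n) (m + 1),
      χ n (w * coxeter (fun j => gens R n (m + j)) d) ∈ S := by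
    intro m
    induction m with
    | zero =>
      intro d hd w hw
      obtain ⟨c, rfl⟩ := mem_strandAlg_one le_rfl hw
      rw [smul_mul_assoc, one_mul, ch_smul]
      obtain rfl : d = n - 1 := by omega
      simpa only [zero_add] using S.smul_mem hc c
    | succ m ihm =>
      intro d hd
      have ht : coxeter (fun j => gens R n (m + 1 + j)) d ∈
          strandAlg (fun j => gens R n (m + 1 + j)) (d + 1) :=
        coxeter_mem fun j hj => gen_mem_strandAlg (by omega)
      have ht' : coxeter (fun j => gens R n (m + 1 + j)) d ∈ strandAlg (gens R n) n :=
        coxeter_mem fun j hj => gen_mem_strandAlg (by omega)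
      have hle : strandAlg (gens R n) (m + 1) ≤ strandAlg (gens R n) n :=
        strandAlg_mono (by omega)
      refine h.strandAlg_le_of_split hp (m := m) (by omega)
        { carrier := {w | χ n (w * coxeter (fun j => gens R n (m + 1 + j)) d) ∈ S}
          add_mem' := fun {x y} hx hy => by
            simpa only [Set.mem_ofPred_eq, add_mul, ch_add] using S.add_mem hx hy
          zero_mem' := by
            simpa only [Set.mem_ofPred_eq, zero_mul, ch_zero_right] using S.zero_mem
          smul_mem' := fun c x hx => by
            simpa only [Set.mem_ofPred_eq, smul_mul_assoc, ch_smul] using S.smul_mem hx c } ?_ ?_ ?_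
      · intro x hx
        exact ch_mul_mem hRF hR ih (by omega) (by omega) (by omega) hx ht
      · intro x hx y hy
        have hyt : Commute (coxeter (fun j => gens R n (m + 1 + j)) d) y :=
          commute_of_mem_strandAlg hy fun i hi => (commute_of_mem (x := gens R n i)
            (coxeter_mem fun j hj => mem_of_commute
              (h.commute (by omega) (by omega) (by omega)))).symm
        change χ n (x * gens R n m * y * _) ∈ S
        rw [mul_assoc _ y, ← hyt.eq, ← mul_assoc, ch_mul_comm hRF hR (hle hy), mul_assoc, ← mul_assoc]
        have := ihm (d + 1) (by omega) (y * x) (mul_mem hy hx)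
        rw [coxeter_succ_left] at this
        simpa only [add_zero, mul_assoc, add_assoc] using this
      · intro x hx y hy
        change χ n (x * κ (gens R n m) * y * _) ∈ S
        rw [mul_assoc _ y]
        exact ch_mul_kappa_mem hRF hR hB hg ih (by omega) (hle hx) (mul_mem (hle hy) ht')
  obtain ⟨m, rfl⟩ : ∃ m, n = m + 1 := ⟨n - 1, by omega⟩
  simpa [coxeter] using key m 0 rfl w hw

variable (hq : Generic q μ k) (hh : heightOp R q μ k = 0)
include hq hh

/-- Induction along the hooks `C_d a^{(m)}`, `d + m = n`, from `d = 0` (an elementary sum) to `m =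
1` (the Coxeter element). Expanding `σ⁻(q^{-2m})` in `C_d a^{(m)↑} σ⁻ a^{(m)↑}` gives a product
term, the next hook and a term with `κ`; the coefficient of the next hook is nonzero. -/
theorem ch_coxeter_mem {S : Subalgebra ℂ (QMAlgebra R F)}
    (hg : contraction R F q μ (qMatrix R F) ∈ S)
    (he : ∀ i ≤ k, elemSum R F q μ (qMatrix R F) i ∈ S)
    (ih : ∀ m < n, ∀ w ∈ strandAlg (gens R m) m, χ m w ∈ S) (hn : 1 ≤ n) (hk : 1 ≤ k) :
    χ n (coxeter (gens R n) (n - 1)) ∈ S := by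
  have h := hB.relations n
  suffices H : ∀ d m, m + d = n → 1 ≤ m → m ≤ k →
      χ n (coxeter (gens R n) d * 𝔞 (fun j => gens R n (d + j)) m) ∈ S by
    simpa [antisymmetrizer] using H (n - 1) 1 (by omega) le_rfl hk
  intro d
  induction d with
  | zero =>
    intro m hd hm hmk
    obtain rfl : m = n := hd
    have := he m hmk
    rw [← ch_antisymOp] at this
    simp only [coxeter, zero_add, one_mul]
    exact this
  | succ d ihd =>
    intro m hd hm hmk
    set a := 𝔞 (fun j => gens R n (d + 1 + j)) m with ha
    set x := (q⁻¹) ^ (2 * m) with hx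
    set b := baxterMinus q μ x (gens R n d) with hb
    set C := coxeter (gens R n) d with hC
    have gm {i : ℕ} (hi : i + 1 < n) := gen_mem_strandAlg (s := gens R n) hi
    have haW : a ∈ strandAlg (gens R n) n := antisymmetrizer_mem fun j hj => gm (by omega)
    have hCW : C ∈ strandAlg (gens R n) n := coxeter_mem fun j hj => gm (by omega)
    have hca : Commute C a := commute_antisymmetrizer fun j hj =>
      (commute_of_mem (coxeter_mem fun l hl => mem_of_commute
        (h.commute (by omega) (by omega) (by omega)))).symm
    have haa : a * a = a := antisymmetrizer_idem (h.shift (m := m) (by omega)) hq le_rfl hmk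
    have hE : χ n (C * (a * b * a)) ∈ S := by
      rcases Nat.lt_or_ge m k with hlt | hge
      · obtain ⟨m, rfl⟩ : ∃ l, m = l + 1 := ⟨m - 1, by omega⟩
        have hc : q ^ (m + 1) / qNumber q (m + 2) ≠ 0 :=
          div_ne_zero (pow_ne_zero _ hq.q_ne_zero)
            (qNumber_ne_zero hq.toAdmissible (hq.q_pow_ne_one _ (by omega) (by omega)))
        have := ihd (m + 2) (by omega) (by omega) (by omega)
        rw [antisymmetrizer_succ_left hq (h.shift (c := d) (m := m + 2) (by omega)) (by omega),
          mul_smul_comm, ch_smul] at this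
        have := S.smul_mem this (q ^ (m + 1) / qNumber q (m + 2))⁻¹
        rw [smul_smul, inv_mul_cancel₀ hc, one_smul] at this
        simpa only [← add_assoc, add_zero] using this
      -- At `m = k` the next antisymmetrizer is replaced by zero: this is the height condition,
      -- placed on the last `k + 1` strands.
      · obtain rfl : m = k := by omega
        have e := congrArg (embOp (window d (by omega : d + (m + 1) ≤ n))) hh
        have ea : embOp (window d (by omega : d + (m + 1) ≤ n))
            (𝔞 (fun j => gens R (m + 1) (j + 1)) m) = a := by
          rw [map_antisymmetrizer]
          refine antisymmetrizer_congr fun j hj => ?_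
          rw [embOp_twoSite d _ (by omega), show d + (j + 1) = d + 1 + j by omega]
        rw [heightOp, map_mul, map_mul, map_zero, ea, map_baxterMinus, embOp_twoSite d _ (by omega),
          add_zero] at e
        rw [e, mul_zero, ch_zero_right]
        exact S.zero_mem
    -- One of the two idempotents is moved around cyclically, past `C`, and absorbed by the other.
    have e1 : χ n (C * (a * b * a)) = χ n (C * b * a) := by
      rw [← mul_assoc, ch_mul_comm hRF hR haW]
      simp only [← mul_assoc]
      rw [← hca.eq, mul_assoc C a a, haa, hca.eq, mul_assoc a, ← ch_mul_comm hRF hR haW]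
    have hxne : (x - 1) / (q - q⁻¹) ≠ 0 := by
      refine div_ne_zero (fun e => hq.q_pow_ne_one m hm hmk ?_) hq.sub_inv_ne_zero
      rw [hx, inv_pow, sub_eq_zero] at e
      exact inv_eq_one.1 e
    have e2 : C * b * a = C * a + ((x - 1) / (q - q⁻¹)) • (coxeter (gens R n) (d + 1) * a) +
        (μ * (x - 1) / (μ + q * x)) • (C * κ (gens R n d) * a) := by
      rw [hb, baxterMinus, coxeter, mul_add, mul_add, add_mul, add_mul, mul_one, mul_smul_comm,
        mul_smul_comm, smul_mul_assoc, smul_mul_assoc]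
    have h1 : χ n (C * a) ∈ S := by
      refine ch_mul_mem hRF hR ih (a := d + 1) (b := m) (by omega) hm (by omega) ?_ ?_
      · exact coxeter_mem fun j hj => gen_mem_strandAlg (by omega)
      · exact antisymmetrizer_mem_strandAlg m
    have h2 := ch_mul_kappa_mem hRF hR hB hg ih (j := d) (by omega) hCW haW
    rw [e1, e2, ch_add, ch_add, ch_smul, ch_smul] at hE
    have h3 : ((x - 1) / (q - q⁻¹)) • χ n (coxeter (gens R n) (d + 1) * a) ∈ S := by
      convert S.sub_mem (S.sub_mem hE h1) (S.smul_mem h2 (μ * (x - 1) / (μ + q * x))) using 1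
      abel
    have h4 := S.smul_mem h3 ((x - 1) / (q - q⁻¹))⁻¹
    rwa [smul_smul, inv_mul_cancel₀ hxne, one_smul] at h4

/-- The characteristic subalgebra is contained in the algebra generated by the contraction and the
elementary sums. -/
theorem ch_mem {S : Subalgebra ℂ (QMAlgebra R F)} (hg : contraction R F q μ (qMatrix R F) ∈ S)
    (he : ∀ i ≤ k, elemSum R F q μ (qMatrix R F) i ∈ S) (hk : 1 ≤ k) (n : ℕ) :
    ∀ w ∈ strandAlg (gens R n) n, χ n w ∈ S := by
  induction n using Nat.strong_induction_on with
  | _ n ih =>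
    intro w hw
    rcases Nat.eq_zero_or_pos n with rfl | hn
    · obtain ⟨c, rfl⟩ := mem_strandAlg_one (by omega) hw
      rw [ch_smul, ch_zero_one]
      exact S.smul_mem S.one_mem c
    · exact ch_mem_of_coxeter hRF hR hB hg ih hn
        (ch_coxeter_mem hRF hR hB hq hh hg he ih hn hk) hw

end Generation

/-! ### Traces of complex idempotent matrices. -/

section IdempotentTrace

variable {ι : Type*} [Fintype ι] [DecidableEq ι]

theorem trace_of_isIdempotentElem {P : Matrix ι ι ℂ} (h : P * P = P) : P.trace = P.rank := by
  have h' : IsIdempotentElem (Matrix.toLin' P) := by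
    rw [IsIdempotentElem, Module.End.mul_eq_comp, ← Matrix.toLin'_mul, h]
  rw [← Matrix.trace_toLin'_eq, (LinearMap.IsIdempotentElem.isProj_range _ h').trace]
  rfl

theorem eq_zero_of_trace_eq_zero {P : Matrix ι ι ℂ} (h : P * P = P) (h0 : P.trace = 0) :
    P = 0 := by
  have h' : IsIdempotentElem (Matrix.toLin' P) := by
    rw [IsIdempotentElem, Module.End.mul_eq_comp, ← Matrix.toLin'_mul, h]
  rw [← Matrix.trace_toLin'_eq] at h0
  simpa using LinearMap.IsIdempotentElem.eq_zero_of_trace_eq_zero h' h0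

end IdempotentTrace

/-! ### The nested sandwich as an idempotent below a product of antisymmetrizers. -/

section Sandwich

variable {A : Type*} [Ring A] [Algebra ℂ A] {q μ : ℂ} {n k b i : ℕ} {s t : ℕ → A}

local notation "𝔞" => antisymmetrizer q μ

variable (q μ) in
/-- The element `a^{(b+i)} H H' a^{(b+i)}` with the nested cups and caps `H`, `H'`. -/
def nestedSandwich (s : ℕ → A) (b i : ℕ) : A :=
  antisymmetrizer q μ s (b + i) * nested q μ s b i *
    (nestedRev q μ s b i * antisymmetrizer q μ s (b + i))

variable (q μ) in
/-- The product of the antisymmetrizers on the first `b + i` and on the last `i` strands. -/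
def antisymPair (s : ℕ → A) (b i : ℕ) : A :=
  antisymmetrizer q μ s (b + i) * antisymmetrizer q μ (fun j => s (b + i + j)) i

variable (h : BMWRelations q μ n s t) (hq : Generic q μ k) (hn : b + 2 * i ≤ n) (hk : b + i ≤ k)
include h hn

theorem commute_antisymPair :
    Commute (𝔞 s (b + i)) (𝔞 (fun j => s (b + i + j)) i) :=
  commute_antisymmetrizer fun _ _ => (commute_antisymmetrizer fun _ _ =>
    h.commute (by omega) (by omega) (by omega)).symm

include hq hk

theorem antisymPair_mul_self :
    antisymPair q μ s b i * antisymPair q μ s b i = antisymPair q μ s b i := by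
  have h1 := antisymmetrizer_idem h hq (i := b + i) (by omega) hk
  have h2 := antisymmetrizer_idem (h.shift (c := b + i) (m := i) (by omega)) hq le_rfl (by omega)
  have hc := commute_antisymPair h hn
  rw [antisymPair, hc.symm.mul_mul_mul_comm, h1, h2]

/-- A generator on the last `i` strands slides along the nested cups to its mirror image on the
first `b + i` strands, where `a^{(b+i)}` absorbs it. Hence the last strands are antisymmetrized
automatically. -/
theorem antisymmetrizer_mul_nested :
    𝔞 (fun j => s (b + i + j)) i * (𝔞 s (b + i) * nested q μ s b i) =
      𝔞 s (b + i) * nested q μ s b i := by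
  refine antisymmetrizer_mul_of_absorb hq (by omega) fun j hj => ?_
  have hc : Commute (s (b + i + j)) (𝔞 s (b + i)) := commute_antisymmetrizer fun _ _ =>
    h.commute (by omega) (by omega) (by omega)
  have e := mul_nested h (q := q) (μ := μ) (b := b) (i := i) (j := j + 1) hn (by omega) (by omega)
  rw [show b + i - 1 + (j + 1) = b + i + j by omega] at e
  rw [← mul_assoc, hc.eq, mul_assoc, e, ← mul_assoc,
    antisymmetrizer_mul h hq (i := b + i) (by omega) hk (by omega), smul_mul_assoc]

theorem nestedRev_mul_antisymmetrizer :
    nestedRev q μ s b i * 𝔞 s (b + i) * 𝔞 (fun j => s (b + i + j)) i =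
      nestedRev q μ s b i * 𝔞 s (b + i) := by
  refine mul_antisymmetrizer_of_absorb hq (by omega) fun j hj => ?_
  have hc : Commute (s (b + i + j)) (𝔞 s (b + i)) := commute_antisymmetrizer fun _ _ =>
    h.commute (by omega) (by omega) (by omega)
  have e := nestedRev_mul h hq.toAdmissible (b := b) (i := i) (j := j + 1) hn (by omega) (by omega)
  rw [show b + i - 1 + (j + 1) = b + i + j by omega] at e
  rw [mul_assoc, ← hc.eq, ← mul_assoc, e, mul_assoc,
    mul_antisymmetrizer h hq (i := b + i) (by omega) hk (by omega), mul_smul_comm]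

theorem antisymPair_mul_nestedSandwich :
    antisymPair q μ s b i * nestedSandwich q μ s b i = nestedSandwich q μ s b i := by
  have h1 := antisymmetrizer_idem h hq (i := b + i) (by omega) hk
  rw [antisymPair, nestedSandwich, ← mul_assoc, mul_assoc (𝔞 s (b + i)) _ (_ * _),
    antisymmetrizer_mul_nested h hq hn hk, ← mul_assoc (𝔞 s (b + i)) (𝔞 s (b + i)), h1]

theorem nestedSandwich_mul_antisymPair :
    nestedSandwich q μ s b i * antisymPair q μ s b i = nestedSandwich q μ s b i := by
  have h1 := antisymmetrizer_idem h hq (i := b + i) (by omega) hk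
  rw [antisymPair, nestedSandwich, mul_assoc, ← mul_assoc (nestedRev q μ s b i * _) (𝔞 s (b + i)),
    mul_assoc (nestedRev q μ s b i) (𝔞 s (b + i)) (𝔞 s (b + i)), h1,
    nestedRev_mul_antisymmetrizer h hq hn hk]

/-- In the square, the inner caps, antisymmetrizers and cups evaluate to `a^{(b)}` times a row of
`κ`'s; `a^{(b)}` is absorbed on the left and the row produces `i` loops. -/
theorem nestedSandwich_mul_self : nestedSandwich q μ s b i * nestedSandwich q μ s b i =
    ((∏ j ∈ Finset.range i, sandwichCoeff q μ (b + j)) * eta q μ ^ i) •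
      nestedSandwich q μ s b i := by
  have h1 := antisymmetrizer_idem h hq (i := b + i) (by omega) hk
  have h2 := antisymmetrizer_mul_antisymmetrizer h hq (i := b + i) (j := b) (by omega) hk (by omega)
  have h3 := nestedRev_mul_antisymmetrizer_mul_nested h hq hn hk
  have h4 := kappaRow_mul_nestedRev h (q := q) (μ := μ) (b := b) (i := i) hn
  have hc : Commute (nested q μ s b i) (𝔞 s b) := commute_antisymmetrizer fun _ _ =>
    (commute_of_mem <| nested_mem fun _ _ _ => mem_of_commute <|
      h.commute (by omega) (by omega) (by omega)).symm
  calc _ = 𝔞 s (b + i) * nested q μ s b i * (nestedRev q μ s b i * (𝔞 s (b + i) * 𝔞 s (b + i)) *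
        nested q μ s b i) * (nestedRev q μ s b i * 𝔞 s (b + i)) := by
        simp only [nestedSandwich, mul_assoc]
    _ = (∏ j ∈ Finset.range i, sandwichCoeff q μ (b + j)) •
        (𝔞 s (b + i) * (nested q μ s b i * 𝔞 s b) *
          (kappaRow q μ s b i * nestedRev q μ s b i) * 𝔞 s (b + i)) := by
        rw [h1, h3, mul_smul_comm, smul_mul_assoc]
        simp only [mul_assoc]
    _ = _ := by
        rw [h4, hc.eq, ← mul_assoc, h2, mul_smul_comm, smul_mul_assoc, smul_smul, nestedSandwich]
        simp only [mul_assoc]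

end Sandwich

/-! ### Commutation of `g` with the elementary sums, rank comparison and reciprocity. -/

section Reciprocity

variable {N : ℕ} {R F : Aut₂ N} {q μ : ℂ} {n k : ℕ}

local notation "χ" => ch R F (qMatrix R F)

local notation "κ" => kappa q μ

local notation "𝔞" => antisymmetrizer q μ

theorem trace_mul_embOp {a b : ℕ} (hn : a + b = n) (x : Op N a ℂ) (y : Op N b ℂ) (h1 : 0 + a ≤ n)
    (h2 : a + b ≤ n) :
    (embOp (window 0 h1) x * embOp (window a h2) y).trace = x.trace * y.trace := by
  subst hn
  have h (I : Fin (a + b) → Fin N) :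
      (embOp (window 0 h1) x * embOp (window a h2) y) I I =
        x (I ∘ window 0 h1) (I ∘ window 0 h1) * y (I ∘ window a h2) (I ∘ window a h2) := by
    rw [embOp_mul_embOp_apply, if_pos fun l => Or.inr (Or.inr rfl)]
    intro i j e
    have := congrArg Fin.val e
    simp only [window_apply] at this
    omega
  have e1 (I : Fin a → Fin N) (J : Fin b → Fin N) : Fin.append I J ∘ window 0 h1 = I := by
    funext i
    have : window 0 h1 i = Fin.castAdd b i := Fin.ext (by simp [window_apply])
    rw [Function.comp_apply, this, Fin.append_left]
  have e2 (I : Fin a → Fin N) (J : Fin b → Fin N) : Fin.append I J ∘ window a h2 = J := by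
    funext i
    have : window a h2 i = Fin.natAdd a i := Fin.ext (by simp [window_apply])
    rw [Function.comp_apply, this, Fin.append_right]
  simp only [Matrix.trace, Matrix.diag, h]
  rw [← (Fin.appendEquiv a b).sum_comp, Fintype.sum_prod_type, Finset.sum_mul_sum]
  exact Finset.sum_congr rfl fun I _ => Finset.sum_congr rfl fun J _ => by
    simp only [Fin.appendEquiv, Equiv.coe_fn_mk, e1, e2]

theorem embOp_kappaRow {r b i : ℕ} (h : 0 + r ≤ n) (hb : b + 2 * i ≤ r) :
    embOp (window 0 h) (kappaRow q μ (gens R r) b i) = kappaRow q μ (gens R n) b i := by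
  induction i with
  | zero => exact map_one _
  | succ i ih =>
    rw [kappaRow, map_mul, ih (by omega), map_kappa, embOp_twoSite 0 h (by omega), zero_add,
      kappaRow]

/-- Stated for an arbitrary family multiplicative under juxtaposition because it serves twice: for
the ordinary matrix trace in the rank count and for `ch` in the reciprocity relation. -/
theorem apply_mul_kappaRow {B : Type*} [Ring B] (f : ∀ n, Op N n ℂ → B)
    (hf : ∀ (a b n : ℕ), a + b = n → ∀ x ∈ strandAlg (gens R a) a, ∀ y ∈ strandAlg (gens R b) b,
      ∀ (h1 : 0 + a ≤ n) (h2 : a + b ≤ n),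
        f n (embOp (window 0 h1) x * embOp (window a h2) y) = f a x * f b y)
    {b i : ℕ} (hn : b + 2 * i = n) (h : 0 + b ≤ n) {x : Op N b ℂ}
    (hx : x ∈ strandAlg (gens R b) b) :
    f n (embOp (window 0 h) x * kappaRow q μ (gens R n) b i) =
      f b x * f 2 (κ (twoSite 2 0 (R : Op₂ N))) ^ i := by
  induction i generalizing n with
  | zero =>
    obtain rfl : b = n := hn
    rw [embOp_window_self, kappaRow, mul_one, pow_zero, mul_one]
  | succ i ih =>
    have hr : 0 + (b + 2 * i) ≤ n := by omega
    have hr' : b + 2 * i + 2 ≤ n := by omega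
    have e1 : embOp (window 0 h) x * kappaRow q μ (gens R n) b i =
        embOp (window 0 hr) (embOp (window 0 (by omega)) x *
          kappaRow q μ (gens R (b + 2 * i)) b i) := by
      rw [map_mul, embOp_kappaRow hr le_rfl,
        embOp_window_window (a := 0) (b := 0) hr (by omega) (by omega)]
    have e2 : κ (gens R n (b + 2 * i)) =
        embOp (window (b + 2 * i) hr') (κ (twoSite 2 0 (R : Op₂ N))) := by
      rw [map_kappa, embOp_twoSite _ hr' (by omega), add_zero]
    have hx' : embOp (window 0 (by omega : 0 + b ≤ b + 2 * i)) x ∈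
        strandAlg (gens R (b + 2 * i)) (b + 2 * i) := by
      have : strandAlg (gens R b) b ≤ (strandAlg (gens R (b + 2 * i)) (b + 2 * i)).comap
          (embOp (window 0 (by omega : 0 + b ≤ b + 2 * i))) := by
        refine strandAlg_le fun j hj => ?_
        rw [Subalgebra.mem_comap, embOp_twoSite 0 _ hj, zero_add]
        exact gen_mem_strandAlg (s := gens R (b + 2 * i)) (by omega)
      exact this hx
    rw [kappaRow, ← mul_assoc, e1, e2, hf _ _ _ (by omega) _ (mul_mem hx' (kappaRow_mem fun j _ hj =>
      gen_mem_strandAlg hj)) _ (kappa_mem (gen_mem_strandAlg (by omega))), ih rfl, pow_succ,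
      mul_assoc]

theorem exists_inverse (h : BMWRelations q μ n (gens R n) (invGens R n)) (hp : Admissible q μ)
    {m : ℕ} (hm : m + 1 ≤ n) : ∃ y ∈ strandAlg (gens R n) n,
      coxeter (gens R n) m * y = 1 ∧ y * coxeter (gens R n) m = 1 := by
  induction m with
  | zero => exact ⟨1, one_mem _, mul_one _, mul_one _⟩
  | succ m ih =>
    obtain ⟨y, hy, e1, e2⟩ := ih (by omega)
    refine ⟨invGens R n m * y, mul_mem (h.inv_mem hp (by omega) (gen_mem_strandAlg (by omega))) hy,
      ?_, ?_⟩
    · rw [coxeter, mul_assoc, ← mul_assoc _ _ y, h.mul_inv m (by omega), one_mul, e1]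
    · rw [coxeter, mul_assoc, ← mul_assoc y, e2, one_mul, h.inv_mul m (by omega)]

section Commutation

variable (hRF : CompatiblePair R F) (hR : SkewInvertible (R : Op₂ N)) (hB : IsBMWType R q μ)
include hRF hR hB

/-- The two products are, up to `η`, the values of `χ` on `κ` next to `a^{(i)}` in the two orders.
Conjugation by the square of the Coxeter element on `i + 2` strands exchanges the two arrangements,
and `χ` is a trace. -/
theorem commute_contraction_elemSum (i : ℕ) :
    Commute (contraction R F q μ (qMatrix R F)) (elemSum R F q μ (qMatrix R F) i) := by
  have hp := hB.admissible
  have h := hB.relations (i + 2)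
  have h02 : 0 + 2 ≤ i + 2 := by omega
  have h0i : 0 + i ≤ i + 2 := by omega
  have hi2 : i + 2 ≤ i + 2 := le_rfl
  have h2i : 2 + i ≤ i + 2 := by omega
  have hK : κ (twoSite 2 0 (R : Op₂ N)) ∈ strandAlg (gens R 2) 2 :=
    kappa_mem (gen_mem_strandAlg (s := gens R 2) (by omega))
  have e1 := ch_mul_embOp hRF hR (add_comm 2 i) hK (antisymOp_mem (q := q) (μ := μ) i) h02 h2i
  have e2 := ch_mul_embOp hRF hR (Eq.refl (i + 2)) (antisymOp_mem (q := q) (μ := μ) i) hK h0i hi2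
  rw [ch_kappa hp, ch_antisymOp] at e1 e2
  obtain ⟨y, hy, y1, y2⟩ := exists_inverse h hp (m := i + 1) le_rfl
  set C := coxeter (gens R (i + 2)) (i + 1)
  have hC : C ∈ strandAlg (gens R (i + 2)) (i + 2) :=
    coxeter_mem fun j hj => gen_mem_strandAlg (by omega)
  have ha : embOp (window 0 h0i) (antisymOp R q μ i) = 𝔞 (gens R (i + 2)) i := by
    rw [embOp_antisymOp]; simp only [zero_add]
  have s1 : SemiconjBy (C * C) (𝔞 (gens R (i + 2)) i) (𝔞 (fun j => gens R (i + 2) (2 + j)) i) := by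
    refine semiconjBy_antisymmetrizer fun j hj => ?_
    have c1 : SemiconjBy C (gens R (i + 2) j) (gens R (i + 2) (j + 1)) :=
      coxeter_mul h (by omega) (by omega)
    have c2 : SemiconjBy C (gens R (i + 2) (j + 1)) (gens R (i + 2) (2 + j)) := by
      rw [show 2 + j = j + 1 + 1 by omega]
      exact coxeter_mul h (by omega) (by omega)
    exact c2.mul_left c1
  have s2 : SemiconjBy (C * C) (κ (gens R (i + 2) i)) (κ (gens R (i + 2) 0)) :=
    semiconjBy_kappa (coxeter_sq_mul h (by omega))
  have s3 := s2.mul_right s1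
  have hk1 : embOp (window 0 h02) (κ (twoSite 2 0 (R : Op₂ N))) = κ (gens R (i + 2) 0) := by
    rw [map_kappa, embOp_twoSite 0 _ (by omega)]
  have hk2 : embOp (window i hi2) (κ (twoSite 2 0 (R : Op₂ N))) = κ (gens R (i + 2) i) := by
    rw [map_kappa, embOp_twoSite i _ (by omega), add_zero]
  have hca : Commute (κ (gens R (i + 2) i)) (𝔞 (gens R (i + 2)) i) :=
    commute_antisymmetrizer fun j hj => commute_kappa_left
      (h.commute (by omega) (by omega) (by omega))
  rw [hk1, embOp_antisymOp] at e1
  rw [hk2, ha, ← hca.eq] at e2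
  have e3 : χ (i + 2) (κ (gens R (i + 2) 0) * 𝔞 (fun j => gens R (i + 2) (2 + j)) i) =
      χ (i + 2) (κ (gens R (i + 2) i) * 𝔞 (gens R (i + 2)) i) := by
    have hu : C * C * (y * y) = 1 := by rw [mul_assoc, ← mul_assoc C y, y1, one_mul, y1]
    have hu' : y * y * (C * C) = 1 := by rw [mul_assoc, ← mul_assoc y C, y2, one_mul, y2]
    rw [← mul_one (κ (gens R (i + 2) 0) * _), ← hu, ← mul_assoc, ← s3.eq, mul_assoc,
      ← ch_mul_comm hRF hR (mul_mem hC hC), mul_assoc, hu', mul_one]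
  rw [e1, e2, smul_mul_assoc, mul_smul_comm] at e3
  exact smul_right_injective _ hp.eta_ne_zero e3

end Commutation

section Ranks

variable (hB : IsBMWType R q μ) (hq : Generic q μ k)
include hB hq

theorem trace_antisymOp {i : ℕ} (hi : i ≤ k) :
    (antisymOp R q μ i).trace = (antisymOp R q μ i).rank :=
  trace_of_isIdempotentElem (antisymmetrizer_idem (hB.relations i) hq le_rfl hi)

theorem smul_kappa_mul_self :
    ((eta q μ)⁻¹ • κ (twoSite 2 0 (R : Op₂ N))) * ((eta q μ)⁻¹ • κ (twoSite 2 0 (R : Op₂ N))) =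
      (eta q μ)⁻¹ • κ (twoSite 2 0 (R : Op₂ N)) := by
  rw [smul_mul_assoc, mul_smul_comm, (hB.relations 2).kappa_sq 0 (by omega),
    smul_smul (eta q μ)⁻¹ (eta q μ), inv_mul_cancel₀ hq.eta_ne_zero, one_smul]

theorem trace_kappa : (κ (twoSite 2 0 (R : Op₂ N))).trace =
    eta q μ * (κ (twoSite 2 0 (R : Op₂ N))).rank := by
  have hη := hq.eta_ne_zero
  have := trace_of_isIdempotentElem (smul_kappa_mul_self hB hq)
  rw [Matrix.trace_smul, smul_eq_mul] at this
  have hr : ((eta q μ)⁻¹ • κ (twoSite 2 0 (R : Op₂ N))).rank =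
      (κ (twoSite 2 0 (R : Op₂ N))).rank := by
    refine le_antisymm ?_ ?_
    · have e : (eta q μ)⁻¹ • κ (twoSite 2 0 (R : Op₂ N)) =
          κ (twoSite 2 0 (R : Op₂ N)) * ((eta q μ)⁻¹ • (1 : Op N 2 ℂ)) := by
        rw [mul_smul_comm, mul_one]
      rw [e]
      exact Matrix.rank_mul_le_left _ _
    · have e : κ (twoSite 2 0 (R : Op₂ N)) =
          ((eta q μ)⁻¹ • κ (twoSite 2 0 (R : Op₂ N))) * (eta q μ • (1 : Op N 2 ℂ)) := by
        rw [mul_smul_comm, mul_one, smul_smul, mul_inv_cancel₀ hη, one_smul]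
      conv_lhs => rw [e]
      exact Matrix.rank_mul_le_left _ _
  rw [← hr, ← this, ← mul_assoc, mul_inv_cancel₀ hη, one_mul]

variable {b i : ℕ}

/-- Cyclicity brings the caps around to meet the cups, leaving `a^{(b)}` beside `i` separate `κ`'s,
on which `f` factorizes. -/
theorem apply_nestedSandwich {B : Type*} [Ring B] [Algebra ℂ B] (f : ∀ n, Op N n ℂ → B)
    (hf : ∀ (a b n : ℕ), a + b = n → ∀ x ∈ strandAlg (gens R a) a, ∀ y ∈ strandAlg (gens R b) b,
      ∀ (h1 : 0 + a ≤ n) (h2 : a + b ≤ n),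
        f n (embOp (window 0 h1) x * embOp (window a h2) y) = f a x * f b y)
    (hc : ∀ n, ∀ y ∈ strandAlg (gens R n) n, ∀ x, f n (x * y) = f n (y * x))
    (hs : ∀ n (z : ℂ) x, f n (z • x) = z • f n x) (hn : b + 2 * i = n) (hk : b + i ≤ k) :
    f n (nestedSandwich q μ (gens R n) b i) =
      (∏ j ∈ Finset.range i, sandwichCoeff q μ (b + j)) •
        (f b (antisymOp R q μ b) * f 2 (κ (twoSite 2 0 (R : Op₂ N))) ^ i) := by
  have h := hB.relations n
  have h1 := antisymmetrizer_idem h hq (i := b + i) (by omega) hk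
  have h3 := nestedRev_mul_antisymmetrizer_mul_nested h hq hn.le hk
  have hm : nestedRev q μ (gens R n) b i * 𝔞 (gens R n) (b + i) ∈ strandAlg (gens R n) n :=
    mul_mem (nestedRev_mem fun j _ hj => gen_mem_strandAlg (by omega))
      (antisymmetrizer_mem fun j hj => gen_mem_strandAlg (by omega))
  have e : nestedRev q μ (gens R n) b i * 𝔞 (gens R n) (b + i) *
      (𝔞 (gens R n) (b + i) * nested q μ (gens R n) b i) =
      (∏ j ∈ Finset.range i, sandwichCoeff q μ (b + j)) •
        (𝔞 (gens R n) b * kappaRow q μ (gens R n) b i) := by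
    rw [← h3, mul_assoc, ← mul_assoc (𝔞 _ _) (𝔞 _ _), h1, mul_assoc]
  have e2 := apply_mul_kappaRow (q := q) (μ := μ) f hf hn (by omega) (antisymOp_mem (q := q) (μ := μ) b)
  rw [embOp_antisymOp] at e2
  simp only [zero_add] at e2
  rw [nestedSandwich, hc n _ hm, e, hs, ← e2]

theorem antisymPair_eq (h1 : 0 + (b + i) ≤ n) (h2 : b + i + i ≤ n) :
    antisymPair q μ (gens R n) b i = embOp (window 0 h1) (antisymOp R q μ (b + i)) *
      embOp (window (b + i) h2) (antisymOp R q μ i) := by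
  rw [embOp_antisymOp, embOp_antisymOp, antisymPair]
  simp only [zero_add]

variable (hsc : ∀ i < k, sandwichCoeff q μ i ≠ 0) (hrk : (antisymOp R q μ k).rank = 1)
include hsc hrk

/-- Since `tr κ = η rk κ`, the normalization `z` cancels all parameters and the trace is an integer
expression in ranks; `rk a^{(k)} = 1` simplifies the first term. -/
theorem trace_sub_nestedSandwich (hk : b + i = k) (hn : b + 2 * i = n) {z : ℂ}
    (hz : z = (∏ j ∈ Finset.range i, sandwichCoeff q μ (b + j)) * eta q μ ^ i) :
    (antisymPair q μ (gens R n) b i - z⁻¹ • nestedSandwich q μ (gens R n) b i).trace =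
      ((antisymOp R q μ i).rank : ℂ) -
        (antisymOp R q μ b).rank * (κ (twoSite 2 0 (R : Op₂ N))).rank ^ i := by
  have hη := hq.eta_ne_zero
  have hc : (∏ j ∈ Finset.range i, sandwichCoeff q μ (b + j)) ≠ 0 :=
    Finset.prod_ne_zero_iff.2 fun j hj => hsc _ (by have := Finset.mem_range.1 hj; omega)
  have e1 := apply_nestedSandwich hB hq (fun n (x : Op N n ℂ) => x.trace)
    (fun a b n hn x _ y _ h1 h2 => trace_mul_embOp hn x y h1 h2)
    (fun n y _ x => Matrix.trace_mul_comm x y) (fun n z x => Matrix.trace_smul z x) hn hk.le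
  rw [trace_kappa hB hq, trace_antisymOp hB hq (by omega)] at e1
  rw [Matrix.trace_sub, Matrix.trace_smul, e1, antisymPair_eq hB hq (by omega) (by omega),
    trace_mul_embOp (by omega), trace_antisymOp hB hq hk.le, trace_antisymOp hB hq (by omega), hk,
    hrk, hz, Nat.cast_one, one_mul, smul_eq_mul, smul_eq_mul, mul_pow]
  have hη' := pow_ne_zero i hη
  field_simp

theorem sub_nestedSandwich_mul_self (hk : b + i = k) (hn : b + 2 * i = n) {z : ℂ}
    (hz : z = (∏ j ∈ Finset.range i, sandwichCoeff q μ (b + j)) * eta q μ ^ i) :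
    (antisymPair q μ (gens R n) b i - z⁻¹ • nestedSandwich q μ (gens R n) b i) *
      (antisymPair q μ (gens R n) b i - z⁻¹ • nestedSandwich q μ (gens R n) b i) =
      antisymPair q μ (gens R n) b i - z⁻¹ • nestedSandwich q μ (gens R n) b i := by
  have h := hB.relations n
  have hz0 : z ≠ 0 := hz ▸ mul_ne_zero (Finset.prod_ne_zero_iff.2 fun j hj =>
    hsc _ (by have := Finset.mem_range.1 hj; omega)) (pow_ne_zero _ hq.eta_ne_zero)
  rw [sub_mul, mul_sub, mul_sub, mul_smul_comm, smul_mul_assoc, smul_mul_assoc, mul_smul_comm,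
    antisymPair_mul_self h hq hn.le hk.le, antisymPair_mul_nestedSandwich h hq hn.le hk.le,
    nestedSandwich_mul_antisymPair h hq hn.le hk.le, nestedSandwich_mul_self h hq hn.le hk.le, ← hz,
    smul_smul z⁻¹ z, inv_mul_cancel₀ hz0, one_smul, sub_self, sub_zero]

/-- The difference of the two idempotents is again idempotent, so the preceding trace is a rank, in
particular a natural number. -/
theorem rank_mul_pow_le (hk : b + i = k) : (antisymOp R q μ b).rank *
    (κ (twoSite 2 0 (R : Op₂ N))).rank ^ i ≤ (antisymOp R q μ i).rank := by
  have h1 := trace_sub_nestedSandwich hB hq hsc hrk hk rfl rfl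
  rw [trace_of_isIdempotentElem (sub_nestedSandwich_mul_self hB hq hsc hrk hk rfl rfl)] at h1
  set r := Matrix.rank (antisymPair q μ (gens R (b + 2 * i)) b i - _)
  have h2 : r + (antisymOp R q μ b).rank * (κ (twoSite 2 0 (R : Op₂ N))).rank ^ i =
      (antisymOp R q μ i).rank := by
    have : ((r + (antisymOp R q μ b).rank * (κ (twoSite 2 0 (R : Op₂ N))).rank ^ i : ℕ) : ℂ) =
      ((antisymOp R q μ i).rank : ℕ) := by
      push_cast
      rw [h1, sub_add_cancel]
    exact_mod_cast this
  omega

variable (hK : kappa q μ (twoSite 2 0 (R : Op₂ N)) ≠ 0)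
include hK

/-- The rank inequality holds for `(b, i)` and for `(i, b)`; together they force equality, so the
idempotent difference has trace zero and vanishes. -/
theorem nestedSandwich_eq (hk : b + i = k) (hn : b + 2 * i = n) :
    nestedSandwich q μ (gens R n) b i =
      ((∏ j ∈ Finset.range i, sandwichCoeff q μ (b + j)) * eta q μ ^ i) •
        antisymPair q μ (gens R n) b i := by
  -- This is where `κ ≠ 0` enters: an idempotent of trace zero is zero.
  have hρ : 1 ≤ (κ (twoSite 2 0 (R : Op₂ N))).rank := by
    rw [Nat.one_le_iff_ne_zero]
    intro e
    refine hK ?_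
    have h1 := trace_kappa hB hq
    rw [e, Nat.cast_zero, mul_zero] at h1
    have h2 := eq_zero_of_trace_eq_zero (smul_kappa_mul_self hB hq)
      (by rw [Matrix.trace_smul, h1, smul_zero])
    exact (smul_eq_zero.1 h2).resolve_left (inv_ne_zero hq.eta_ne_zero)
  -- With `A`, `B` the ranks for `b`, `i` and `ρ` that of `κ`: `A ≤ A ρ^i ≤ B ≤ B ρ^b ≤ A`.
  have r1 := rank_mul_pow_le hB hq hsc hrk hk
  have r2 := rank_mul_pow_le hB hq hsc hrk ((add_comm i b).trans hk)
  have r3 := Nat.le_mul_of_pos_right (antisymOp R q μ i).rank (Nat.pow_pos (n := b) hρ)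
  have r4 := Nat.le_mul_of_pos_right (antisymOp R q μ b).rank (Nat.pow_pos (n := i) hρ)
  have r5 : (antisymOp R q μ b).rank * (κ (twoSite 2 0 (R : Op₂ N))).rank ^ i =
    (antisymOp R q μ i).rank := by omega
  obtain ⟨z, hz⟩ : ∃ z, z = (∏ j ∈ Finset.range i, sandwichCoeff q μ (b + j)) * eta q μ ^ i :=
    ⟨_, rfl⟩
  have hz0 : z ≠ 0 := hz ▸ mul_ne_zero (Finset.prod_ne_zero_iff.2 fun j hj =>
    hsc _ (by have := Finset.mem_range.1 hj; omega)) (pow_ne_zero _ hq.eta_ne_zero)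
  have e := eq_zero_of_trace_eq_zero (sub_nestedSandwich_mul_self hB hq hsc hrk hk hn hz) (by
    rw [trace_sub_nestedSandwich hB hq hsc hrk hk hn hz, ← r5]
    push_cast
    exact sub_self _)
  rw [← hz, sub_eq_zero.1 e, smul_smul, mul_inv_cancel₀ hz0, one_smul]

/-- The reciprocity relations `e_k e_i = e_{k-i} g^i`. -/
theorem elemSum_mul_elemSum (hRF : CompatiblePair R F) (hR : SkewInvertible (R : Op₂ N))
    (hk : b + i = k) :
    elemSum R F q μ (qMatrix R F) k * elemSum R F q μ (qMatrix R F) i =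
      elemSum R F q μ (qMatrix R F) b * contraction R F q μ (qMatrix R F) ^ i := by
  have e1 := apply_nestedSandwich hB hq (fun n => χ n)
    (fun a b n hn x hx y hy h1 h2 => ch_mul_embOp hRF hR hn hx hy h1 h2)
    (fun n y hy x => ch_mul_comm hRF hR hy x) (fun n z x => ch_smul _ z x) (b := b) (i := i) rfl hk.le
  have hc : (∏ j ∈ Finset.range i, sandwichCoeff q μ (b + j)) * eta q μ ^ i ≠ 0 :=
    mul_ne_zero (Finset.prod_ne_zero_iff.2 fun j hj =>
      hsc _ (by have := Finset.mem_range.1 hj; omega)) (pow_ne_zero _ hq.eta_ne_zero)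
  rw [nestedSandwich_eq hB hq hsc hrk hK hk rfl, ch_smul,
    antisymPair_eq hB hq (by omega) (by omega),
    ch_mul_embOp hRF hR (by omega) (antisymOp_mem _) (antisymOp_mem _), ch_kappa hq.toAdmissible,
    ch_antisymOp, ch_antisymOp, ch_antisymOp, smul_pow, mul_smul_comm, smul_smul, hk] at e1
  exact smul_right_injective _ hc e1

end Ranks

end Reciprocity

/-! ### Genericity of the orthogonal parameters. -/

section Parameters

variable {N : ℕ} {R : Aut₂ N} {q μ : ℂ} {k : ℕ}

theorem mul_inv_pow_eq_zpow (hq : q ≠ 0) (i : ℕ) : q * (q⁻¹) ^ (2 * i) = q ^ (1 - 2 * (i : ℤ)) := by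
  rw [zpow_sub₀ hq, zpow_one, inv_pow, div_eq_mul_inv]
  norm_cast

theorem HasHeight.generic (h : HasHeight R q μ k) : Generic q μ k where
  toAdmissible := h.isBMWType.admissible
  q_pow_ne_one := h.q_pow_ne_one
  mu_add_ne i h1 hk e := h.mu_ne i h1 hk (by
    rw [mul_inv_pow_eq_zpow h.isBMWType.q_ne_zero] at e
    exact eq_neg_of_add_eq_zero_left e)

/-- For `μ = q^{1-k}` the forbidden equality `μ² = q² q^{-2(i+1)}` would say `q^{2(k-i-1)} = 1` with
`1 ≤ k - i - 1 ≤ k`, which genericity rules out. -/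
theorem sandwichCoeff_orthMu_ne_zero (hq : Generic q (orthMu q k) k) {i : ℕ} (hi : i < k) :
    sandwichCoeff q (orthMu q k) i ≠ 0 := by
  have h0 := hq.q_ne_zero
  refine sandwichCoeff_ne_zero hq (fun i hi e => ?_) hi
  refine hq.q_pow_ne_one (k - (i + 1)) (by omega) (by omega) ?_
  have e1 : orthMu q k ^ 2 = q ^ (2 - 2 * (k : ℤ)) := by
    rw [orthMu, ← zpow_natCast, ← zpow_mul]
    congr 1
    push_cast
    ring
  have e2 : q ^ 2 * (q⁻¹) ^ (2 * (i + 1)) = q ^ (2 - 2 * ((i : ℤ) + 1)) := by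
    rw [zpow_sub₀ h0, inv_pow, div_eq_mul_inv]
    norm_cast
  rw [e1, e2] at e
  have e3 : q ^ (2 * (k - (i + 1))) =
      q ^ (2 - 2 * ((i : ℤ) + 1)) * (q ^ (2 - 2 * (k : ℤ)))⁻¹ := by
    rw [← zpow_neg, ← zpow_add₀ h0, ← zpow_natCast]
    congr 1
    push_cast [Nat.cast_sub (by omega : i + 1 ≤ k)]
    ring
  rw [e3, e, mul_inv_cancel₀ (zpow_ne_zero _ h0)]

end Parameters

/-! ### The characteristic subspace as the set to be generated. -/

section Characteristic

variable {N : ℕ} {R F : Aut₂ N} {q μ : ℂ} {n k : ℕ}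

theorem braidImage_le (hB : IsBMWType R q μ) {α : Op N n ℂ} (hα : α ∈ braidImage R n) :
    α ∈ strandAlg (gens R n) n := by
  have : braidImage R n ≤ (strandAlg (gens R n) n).toSubmonoid := by
    refine Submonoid.closure_le.2 ?_
    rintro _ ⟨i, hi, rfl | rfl⟩
    · exact gen_mem_strandAlg (s := gens R n) hi
    · exact (hB.relations n).inv_mem hB.admissible hi (gen_mem_strandAlg hi)
  exact this hα

/-- The generated algebra is the linear span of monomials in the `R_i`, which lie in the image of
the braid group, and `ch` is linear. -/
theorem ch_mem_charSpace (hn : 1 ≤ n) {w : Op N n ℂ} (hw : w ∈ strandAlg (gens R n) n) :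
    ch R F (qMatrix R F) n w ∈ charSpace R F := by
  have h1 : w ∈ Submodule.span ℂ (braidImage R n : Set (Op N n ℂ)) := by
    have hw : w ∈ Subalgebra.toSubmodule (strandAlg (gens R n) n) := hw
    rw [strandAlg, Algebra.adjoin_eq_span] at hw
    refine Submodule.span_mono (SetLike.coe_subset_coe.2 (Submonoid.closure_mono ?_)) hw
    rintro _ ⟨i, hi, rfl⟩
    exact ⟨i, hi, Or.inl rfl⟩
  clear hw
  induction h1 using Submodule.span_induction with
  | mem x hx => exact Submodule.subset_span (Or.inr ⟨n, hn, x, hx, rfl⟩)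
  | zero => rw [ch_zero_right]; exact Submodule.zero_mem _
  | add x y _ _ hx hy => rw [ch_add]; exact Submodule.add_mem _ hx hy
  | smul c x _ hx => rw [ch_smul]; exact Submodule.smul_mem _ c hx

theorem one_mem_charSpace : (1 : QMAlgebra R F) ∈ charSpace R F :=
  Submodule.subset_span (Or.inl rfl)

theorem elemSum_mem_charSpace (i : ℕ) : elemSum R F q μ (qMatrix R F) i ∈ charSpace R F := by
  match i with
  | 0 => exact one_mem_charSpace
  | i + 1 => exact ch_mem_charSpace (by omega) (antisymOp_mem (i + 1))

theorem contraction_mem_charSpace : contraction R F q μ (qMatrix R F) ∈ charSpace R F :=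
  Submodule.smul_mem _ _ (ch_mem_charSpace (by omega)
    (kappa_mem (gen_mem_strandAlg (s := gens R 2) (by omega))))

variable {B : Type*} [Ring B] [Algebra ℂ B] (φ : QMAlgebra R F →ₐ[ℂ] B) {u : Bˣ}

/-- A criterion for generation of the image of the characteristic subalgebra. -/
theorem adjoin_charSpace_eq (hRF : CompatiblePair R F) (hR : SkewInvertible (R : Op₂ N))
    (hH : HasHeight R q μ k) {G : Set B} {B' : Subalgebra ℂ B}
    (hB' : B' = Algebra.adjoin ℂ (φ '' (charSpace R F : Set (QMAlgebra R F)) ∪ {((u⁻¹ : Bˣ) : B)}))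
    (hG : ∀ x ∈ G, x ∈ B')
    (hg : φ (contraction R F q μ (qMatrix R F)) ∈ generatedWithInv u G)
    (he : ∀ i ≤ k, φ (elemSum R F q μ (qMatrix R F) i) ∈ generatedWithInv u G) :
    B' = generatedWithInv u G := by
  refine le_antisymm ?_ ?_
  · rw [hB']
    refine Algebra.adjoin_le (Set.union_subset ?_ ?_)
    · have : charSpace R F ≤
          Subalgebra.toSubmodule ((generatedWithInv u G).comap φ) := by
        refine Submodule.span_le.2 (Set.union_subset ?_ ?_)
        · rintro _ rfl
          exact one_mem ((generatedWithInv u G).comap φ)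
        · rintro _ ⟨n, -, α, hα, rfl⟩
          exact ch_mem hRF hR hH.isBMWType hH.generic hH.heightOp_eq_zero
            (S := (generatedWithInv u G).comap φ) hg he (by have := hH.two_le; omega) n _
            (braidImage_le hH.isBMWType hα)
      rintro _ ⟨x, hx, rfl⟩
      exact this hx
    · exact fun x hx => Algebra.subset_adjoin (Or.inr hx)
  · refine Algebra.adjoin_le (Set.union_subset hG ?_)
    rintro _ rfl
    rw [hB']
    exact Algebra.subset_adjoin (Or.inr rfl)

end Characteristic

/-! ### Recovering the upper half of the elementary sums. -/

section Reduction

variable {B : Type*} [Ring B] [Algebra ℂ B] {u : Bˣ} {E : ℕ → B} {k : ℕ}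

theorem eq_mul_mul_inv_pow {b i : ℕ} (hE : E k * E i = E b * (u : B) ^ i) :
    E b = E k * E i * ((u⁻¹ : Bˣ) : B) ^ i := by
  rw [hE, ← Units.val_pow_eq_pow_val, ← Units.val_pow_eq_pow_val, inv_pow, Units.mul_inv_cancel_right]

/-- For `b > l` the complementary index `k - b` is at most `l`, and `E b = E k E_{k-b} u^{-(k-b)}`.
-/
theorem mem_of_reciprocity {S : Subalgebra ℂ B} (hu : ((u⁻¹ : Bˣ) : B) ∈ S)
    (hE : ∀ b i, b + i = k → E k * E i = E b * (u : B) ^ i) {l : ℕ} (hl : k ≤ 2 * l + 1)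
    (hk : E k ∈ S) (he : ∀ i ≤ l, E i ∈ S) {b : ℕ} (hb : b ≤ k) : E b ∈ S := by
  rcases Nat.lt_or_ge l b with h | h
  · rw [eq_mul_mul_inv_pow (hE b (k - b) (by omega))]
    exact mul_mem (mul_mem hk (he _ (by omega))) (pow_mem hu _)
  · exact he b h

end Reduction

/-! ### The extended algebra, its components and the three generation statements. -/

section Components

variable {N : ℕ} {R F : Aut₂ N} {q μ : ℂ} {k ℓ : ℕ}

/-- The degenerate case, in which reciprocity is not available: `g` is zero and yet invertible. -/
theorem subsingleton_extAlgebra (hK : kappa q μ (twoSite 2 0 (R : Op₂ N)) = 0) :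
    Subsingleton (ExtAlgebra R F q μ) := by
  have h0 : contraction R F q μ (qMatrix R F) = 0 := by
    rw [contraction, hK, ch_zero_right, smul_zero]
  have h1 : ((extG R F q μ : (ExtAlgebra R F q μ)ˣ) : ExtAlgebra R F q μ) = 0 := by
    change AdjoinInv.of _ (contraction R F q μ (qMatrix R F)) = 0
    rw [h0, map_zero]
  refine subsingleton_of_zero_eq_one ?_
  rw [← Units.mul_inv (extG R F q μ), h1, zero_mul]

/-- The reciprocity relations in any algebra in which the contraction is invertible. -/
theorem IsOrthogonalType.reciprocity (hRF : CompatiblePair R F)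
    (hR : SkewInvertible (R : Op₂ N)) (hO : IsOrthogonalType R q k)
    (hK : kappa q (orthMu q k) (twoSite 2 0 (R : Op₂ N)) ≠ 0) {B : Type*} [Ring B] [Algebra ℂ B]
    (φ : QMAlgebra R F →ₐ[ℂ] B) {u : Bˣ}
    (hu : (u : B) = φ (contraction R F q (orthMu q k) (qMatrix R F))) (b i : ℕ) (hk : b + i = k) :
    φ (elemSum R F q (orthMu q k) (qMatrix R F) k) *
      φ (elemSum R F q (orthMu q k) (qMatrix R F) i) =
      φ (elemSum R F q (orthMu q k) (qMatrix R F) b) * (u : B) ^ i := by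
  have hq := hO.hasHeight.generic
  rw [hu, ← map_mul, ← map_pow, ← map_mul, elemSum_mul_elemSum hO.hasHeight.isBMWType hq
    (fun i hi => sandwichCoeff_orthMu_ne_zero hq hi) hO.rank_eq_one hK hRF hR hk]

theorem extChar_eq_generated (hRF : CompatiblePair R F) (hR : SkewInvertible (R : Op₂ N))
    (hO : IsOrthogonalType R q (2 * ℓ - 1)) :
    extChar R F q (orthMu q (2 * ℓ - 1)) =
      generatedWithInv (extG R F q (orthMu q (2 * ℓ - 1)))
        ({extGHalf R F q (orthMu q (2 * ℓ - 1)) ℓ} ∪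
          {x | ∃ i : ℕ, i ≤ ℓ - 1 ∧ x = extE R F q (orthMu q (2 * ℓ - 1)) i}) := by
  -- The height is at least two, so `ℓ` is positive and the truncated subtractions are genuine; the
  -- height is `2m + 1`.
  obtain ⟨m, rfl⟩ : ∃ m, ℓ = m + 1 := ⟨ℓ - 1, by have := hO.hasHeight.two_le; omega⟩
  by_cases hK : kappa q (orthMu q (2 * (m + 1) - 1)) (twoSite 2 0 (R : Op₂ N)) = 0
  · have := subsingleton_extAlgebra (F := F) hK
    exact Subsingleton.elim _ _
  set u := extG R F q (orthMu q (2 * (m + 1) - 1)) with hu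
  set E := extE R F q (orthMu q (2 * (m + 1) - 1)) with hE
  set G : Set (ExtAlgebra R F q (orthMu q (2 * (m + 1) - 1))) :=
    {extGHalf R F q (orthMu q (2 * (m + 1) - 1)) (m + 1)} ∪ {x | ∃ i : ℕ, i ≤ m + 1 - 1 ∧ x = E i}
    with hG
  have hrec : ∀ b i, b + i = 2 * (m + 1) - 1 → E (2 * (m + 1) - 1) * E i =
      E b * (u : ExtAlgebra R F q (orthMu q (2 * (m + 1) - 1))) ^ i :=
    hO.reciprocity hRF hR hK (AdjoinInv.of _) rfl
  have hcomm (i : ℕ) : Commute (u : ExtAlgebra R F q (orthMu q (2 * (m + 1) - 1))) (E i) :=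
    (commute_contraction_elemSum hRF hR hO.hasHeight.isBMWType i).map (AdjoinInv.of _)
  have hhalf : extGHalf R F q (orthMu q (2 * (m + 1) - 1)) (m + 1) =
      ((u⁻¹ ^ m : (ExtAlgebra R F q (orthMu q (2 * (m + 1) - 1)))ˣ) :
        ExtAlgebra R F q (orthMu q (2 * (m + 1) - 1))) * E (2 * (m + 1) - 1) := by
    rw [extGHalf, inv_pow, ← zpow_natCast, ← zpow_neg, show (1 - ((m + 1 : ℕ) : ℤ)) = -(m : ℤ) by
      push_cast; ring]
  have huinv : ((u⁻¹ : (ExtAlgebra R F q (orthMu q (2 * (m + 1) - 1)))ˣ) :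
      ExtAlgebra R F q (orthMu q (2 * (m + 1) - 1))) ∈ generatedWithInv u G :=
    Algebra.subset_adjoin (Or.inr rfl)
  have hGle : ∀ x ∈ G, x ∈ generatedWithInv u G := fun x hx => Algebra.subset_adjoin (Or.inl hx)
  have hX := hGle _ (Or.inl rfl)
  have hEi : ∀ i ≤ m, E i ∈ generatedWithInv u G := fun i hi => hGle _ (Or.inr ⟨i, by omega, rfl⟩)
  -- Reciprocity with `b = 0` is `e_k² = g^k`. As `g` commutes with `e_k`, the square of `g^{-m}
  -- e_k` is `g^{k - 2m} = g`.
  have hsq : extGHalf R F q (orthMu q (2 * (m + 1) - 1)) (m + 1) *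
      extGHalf R F q (orthMu q (2 * (m + 1) - 1)) (m + 1) = u := by
    have h0 := hrec 0 (2 * (m + 1) - 1) (zero_add _)
    have e0 : E 0 = 1 := map_one (AdjoinInv.of _)
    have hc : Commute ((u⁻¹ ^ m : (ExtAlgebra R F q (orthMu q (2 * (m + 1) - 1)))ˣ) :
        ExtAlgebra R F q (orthMu q (2 * (m + 1) - 1))) (E (2 * (m + 1) - 1)) := by
      rw [Units.val_pow_eq_pow_val]
      exact (hcomm _).units_inv_left.pow_left m
    rw [hhalf, hc.symm.mul_mul_mul_comm, h0, e0, one_mul, ← Units.val_pow_eq_pow_val,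
      ← Units.val_mul, ← Units.val_mul]
    congr 1
    have hp : u ^ (2 * (m + 1) - 1) = u ^ (m + (m + 1)) := congrArg (u ^ ·) (by omega)
    rw [inv_pow, hp, pow_add, pow_succ, mul_assoc,
      inv_mul_cancel_left, inv_mul_cancel_left]
  have hum : (u : ExtAlgebra R F q (orthMu q (2 * (m + 1) - 1))) ∈ generatedWithInv u G :=
    hsq ▸ mul_mem hX hX
  have hEk : E (2 * (m + 1) - 1) ∈ generatedWithInv u G := by
    have : E (2 * (m + 1) - 1) = (u : ExtAlgebra R F q (orthMu q (2 * (m + 1) - 1))) ^ m *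
        extGHalf R F q (orthMu q (2 * (m + 1) - 1)) (m + 1) := by
      rw [hhalf, ← Units.val_pow_eq_pow_val, inv_pow, Units.mul_inv_cancel_left]
    rw [this]
    exact mul_mem (pow_mem hum m) hX
  have hEc (i : ℕ) : E i ∈ extChar R F q (orthMu q (2 * (m + 1) - 1)) :=
    Algebra.subset_adjoin (Or.inl ⟨_, elemSum_mem_charSpace i, rfl⟩)
  have huc : ((u⁻¹ : (ExtAlgebra R F q (orthMu q (2 * (m + 1) - 1)))ˣ) :
      ExtAlgebra R F q (orthMu q (2 * (m + 1) - 1))) ∈ extChar R F q (orthMu q (2 * (m + 1) - 1)) :=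
    Algebra.subset_adjoin (Or.inr rfl)
  refine adjoin_charSpace_eq (AdjoinInv.of _) hRF hR hO.hasHeight rfl ?_ hum fun i hi =>
    mem_of_reciprocity huinv hrec (l := m) (by omega) hEk hEi hi
  rintro x (rfl | ⟨i, -, rfl⟩)
  · rw [hhalf, Units.val_pow_eq_pow_val]
    exact mul_mem (pow_mem huc m) (hEc _)
  · exact hEc i

theorem compChar_eq_adjoin (ε : ℂ) : compChar R F q μ ℓ ε =
    Algebra.adjoin ℂ (((toComponent R F q μ ℓ ε).comp (AdjoinInv.of _)) ''
      (charSpace R F : Set (QMAlgebra R F)) ∪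
      {(((compG R F q μ ℓ ε)⁻¹ : (Component R F q μ ℓ ε)ˣ) : Component R F q μ ℓ ε)}) := by
  rw [compChar, extChar, AlgHom.map_adjoin, Set.image_union, Set.image_image, Set.image_singleton]
  rfl

theorem compE_two_mul (ε : ℂ) : compE R F q μ ℓ ε (2 * ℓ) =
    ε • ((compG R F q μ ℓ ε : (Component R F q μ ℓ ε)ˣ) : Component R F q μ ℓ ε) ^ ℓ := by
  have h : toComponent R F q μ ℓ ε (extSign R F q μ ℓ) = algebraMap ℂ _ ε := by
    rw [← AlgHom.commutes (toComponent R F q μ ℓ ε)]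
    exact RingQuot.mkAlgHom_rel ℂ ComponentRel.sign
  have e : extE R F q μ (2 * ℓ) =
      ((extG R F q μ : (ExtAlgebra R F q μ)ˣ) : ExtAlgebra R F q μ) ^ ℓ * extSign R F q μ ℓ := by
    rw [extSign, ← Units.val_pow_eq_pow_val, zpow_neg, zpow_natCast, Units.mul_inv_cancel_left]
  rw [compE, e, map_mul, h, map_pow, ← Algebra.commutes, ← Algebra.smul_def]
  rfl

/-- Both components at once: `l` is the largest listed index. The relation gives `e_{2ℓ} = ε g^ℓ`,
so reciprocity needs only `e_0, …, e_ℓ`; if `l = ℓ - 1`, the missing `e_ℓ` is zero because `ε = -1`.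
-/
theorem compChar_eq_generated (hRF : CompatiblePair R F) (hR : SkewInvertible (R : Op₂ N))
    (hO : IsOrthogonalType R q (2 * ℓ)) (ε : ℂ) {l : ℕ} (hl : 2 * ℓ ≤ 2 * l + 2)
    (hℓ : ℓ ≤ l ∨ ε = -1) :
    compChar R F q (orthMu q (2 * ℓ)) ℓ ε =
      generatedWithInv (compG R F q (orthMu q (2 * ℓ)) ℓ ε)
        ({((compG R F q (orthMu q (2 * ℓ)) ℓ ε : Units _) :
            Component R F q (orthMu q (2 * ℓ)) ℓ ε)} ∪
          {x | ∃ i : ℕ, i ≤ l ∧ x = compE R F q (orthMu q (2 * ℓ)) ℓ ε i}) := by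
  by_cases hK : kappa q (orthMu q (2 * ℓ)) (twoSite 2 0 (R : Op₂ N)) = 0
  · have := subsingleton_extAlgebra (F := F) hK
    have : Subsingleton (Component R F q (orthMu q (2 * ℓ)) ℓ ε) := by
      refine subsingleton_of_zero_eq_one ?_
      rw [← map_one (toComponent R F q (orthMu q (2 * ℓ)) ℓ ε),
        ← map_zero (toComponent R F q (orthMu q (2 * ℓ)) ℓ ε),
        Subsingleton.elim (0 : ExtAlgebra _ _ _ _)]
    exact Subsingleton.elim _ _
  have hsign := compE_two_mul (R := R) (F := F) (q := q) (μ := orthMu q (2 * ℓ)) (ℓ := ℓ) ε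
  set φ := (toComponent R F q (orthMu q (2 * ℓ)) ℓ ε).comp (AdjoinInv.of _)
  set u := compG R F q (orthMu q (2 * ℓ)) ℓ ε with hu
  set E := compE R F q (orthMu q (2 * ℓ)) ℓ ε with hE
  set G : Set (Component R F q (orthMu q (2 * ℓ)) ℓ ε) :=
    {(u : Component R F q (orthMu q (2 * ℓ)) ℓ ε)} ∪ {x | ∃ i : ℕ, i ≤ l ∧ x = E i} with hG
  have hrec : ∀ b i, b + i = 2 * ℓ → E (2 * ℓ) * E i =
      E b * (u : Component R F q (orthMu q (2 * ℓ)) ℓ ε) ^ i :=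
    hO.reciprocity hRF hR hK φ rfl
  have hcomm (i : ℕ) : Commute (u : Component R F q (orthMu q (2 * ℓ)) ℓ ε) (E i) :=
    (commute_contraction_elemSum hRF hR hO.hasHeight.isBMWType i).map φ
  have huinv : ((u⁻¹ : (Component R F q (orthMu q (2 * ℓ)) ℓ ε)ˣ) :
      Component R F q (orthMu q (2 * ℓ)) ℓ ε) ∈ generatedWithInv u G :=
    Algebra.subset_adjoin (Or.inr rfl)
  have hGle : ∀ x ∈ G, x ∈ generatedWithInv u G := fun x hx => Algebra.subset_adjoin (Or.inl hx)
  have hum := hGle _ (Or.inl rfl)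
  have hEk : E (2 * ℓ) ∈ generatedWithInv u G := by
    rw [hsign]
    exact Subalgebra.smul_mem _ (pow_mem hum ℓ) ε
  have hEi : ∀ i ≤ ℓ, E i ∈ generatedWithInv u G := by
    intro i hi
    by_cases hil : i ≤ l
    · exact hGle _ (Or.inr ⟨i, hil, rfl⟩)
    · obtain rfl : i = ℓ := by omega
      -- Reciprocity with `b = i = ℓ` and `e_{2ℓ} = -g^ℓ` reads `-g^ℓ e_ℓ = e_ℓ g^ℓ`; since `g`
      -- commutes with `e_ℓ`, this is `2 e_ℓ g^ℓ = 0`.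
      have hε := hℓ.resolve_left hil
      have h0 := hrec i i (by omega)
      have hs : E (2 * i) = -((u : Component R F q (orthMu q (2 * i)) i ε) ^ i) :=
        hsign.trans ((congrArg (fun z : ℂ =>
          z • ((u : Component R F q (orthMu q (2 * i)) i ε) ^ i)) hε).trans (neg_one_smul ℂ _))
      rw [hs, neg_mul, ← ((hcomm i).pow_left i).eq, neg_eq_iff_add_eq_zero,
        ← two_smul ℂ, smul_eq_zero, or_iff_right two_ne_zero, ← Units.val_pow_eq_pow_val,
        Units.mul_right_eq_zero] at h0
      rw [h0]
      exact zero_mem _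
  refine adjoin_charSpace_eq φ hRF hR hO.hasHeight (compChar_eq_adjoin ε) ?_ hum fun i hi =>
    mem_of_reciprocity huinv hrec (l := ℓ) (by omega) hEk hEi hi
  rw [compChar_eq_adjoin]
  rintro x (rfl | ⟨i, -, rfl⟩)
  · exact Algebra.subset_adjoin (Or.inl ⟨_, contraction_mem_charSpace, rfl⟩)
  · exact Algebra.subset_adjoin (Or.inl ⟨_, elemSum_mem_charSpace i, rfl⟩)

end Components

end OrthQM

end

theorem mainTheorem4 {N : ℕ} (R F : OrthQM.Aut₂ N) (hRF : OrthQM.CompatiblePair R F)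
    (hR : OrthQM.StrictSkewInvertible R) (hF : OrthQM.StrictSkewInvertible F)
    (q : ℂ) (ℓ : ℕ) :
    (OrthQM.IsOrthogonalType R q (2 * ℓ - 1) →
      OrthQM.extChar R F q (OrthQM.orthMu q (2 * ℓ - 1)) =
        OrthQM.generatedWithInv (OrthQM.extG R F q (OrthQM.orthMu q (2 * ℓ - 1)))
          ({OrthQM.extGHalf R F q (OrthQM.orthMu q (2 * ℓ - 1)) ℓ} ∪
            {x | ∃ i : ℕ, i ≤ ℓ - 1 ∧
              x = OrthQM.extE R F q (OrthQM.orthMu q (2 * ℓ - 1)) i})) ∧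
    (OrthQM.IsOrthogonalType R q (2 * ℓ) →
      OrthQM.extSign R F q (OrthQM.orthMu q (2 * ℓ)) ℓ ∈
        Subalgebra.center ℂ (OrthQM.ExtAlgebra R F q (OrthQM.orthMu q (2 * ℓ))) →
      OrthQM.compChar R F q (OrthQM.orthMu q (2 * ℓ)) ℓ 1 =
        OrthQM.generatedWithInv (OrthQM.compG R F q (OrthQM.orthMu q (2 * ℓ)) ℓ 1)
          ({((OrthQM.compG R F q (OrthQM.orthMu q (2 * ℓ)) ℓ 1 : Units _) :
              OrthQM.Component R F q (OrthQM.orthMu q (2 * ℓ)) ℓ 1)} ∪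
            {x | ∃ i : ℕ, i ≤ ℓ ∧
              x = OrthQM.compE R F q (OrthQM.orthMu q (2 * ℓ)) ℓ 1 i}) ∧
      OrthQM.compChar R F q (OrthQM.orthMu q (2 * ℓ)) ℓ (-1) =
        OrthQM.generatedWithInv (OrthQM.compG R F q (OrthQM.orthMu q (2 * ℓ)) ℓ (-1))
          ({((OrthQM.compG R F q (OrthQM.orthMu q (2 * ℓ)) ℓ (-1) : Units _) :
              OrthQM.Component R F q (OrthQM.orthMu q (2 * ℓ)) ℓ (-1))} ∪
            {x | ∃ i : ℕ, i ≤ ℓ - 1 ∧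
              x = OrthQM.compE R F q (OrthQM.orthMu q (2 * ℓ)) ℓ (-1) i})) :=
  ⟨fun hO => OrthQM.extChar_eq_generated hRF hR.1 hO, fun hO _ =>
    ⟨OrthQM.compChar_eq_generated hRF hR.1 hO 1 (by omega) (Or.inl le_rfl),
      OrthQM.compChar_eq_generated hRF hR.1 hO (-1) (by omega) (Or.inr rfl)⟩⟩
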